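/- **Setting.** Let $\mathcal X$ be the set of Borel probability measures $\mathsf x$ on $\overline{\mathbb R}=[-\infty,\infty]$ that are symmetric, i.e. $\mathsf x(-E)=\int_E e^{-\alpha}\,\mathsf x(d\alpha)$ for all Borel $E\subseteq(-\infty,\infty]$ (so $\mathsf x(\{-\infty\})=0$); a BMS channel is identified with its log-likelihood-ratio distribution $\mathsf c\in\mathcal X$. Put $\tau(\alpha)=\tanh(\alpha/2)$. For independent $\alpha_1\sim\mathsf x_1$, $\alpha_2\sim\mathsf x_2$, let $\mathsf x_1\circledast\mathsf x_2$ be the law of $\alpha_1+\alpha_2$ and $\mathsf x_1\boxtimes\mathsf x_2$ the law of $\tau^{-1}(\tau(\alpha_1)\tau(\alpha_2))$. The identities are the point masses $\Delta_0$ (for $\circledast$) and $\Delta_\infty$ (for $\boxtimes$). For $*\in\{\circledast,\boxtimes\}$ and a polynomial $p(t)=\sum_n p_nt^n$ with $p_n\ge 0$, put $p^{*}(\mathsf x)=\sum_n p_n\mathsf x^{*n}$, where $\mathsf x^{*0}$ is the identity of $*$. Let $H(\mathsf x)=\int\log_2(1+e^{-\alpha})\,\mathsf x(d\alpha)$, $M_k(\mathsf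 x)=\int\tau(\alpha)^{2k}\,\mathsf x(d\alpha)$, and $d_H(\mathsf x_1,\mathsf x_2)=\sum_{k\ge1}\frac{|M_k(\mathsf x_1)-M_k(\mathsf x_2)|}{(\log 2)\,2k(2k-1)}$. Write $\mathsf x_2\preceq\mathsf x_1$ ($\mathsf x_1$ is degraded with respect to $\mathsf x_2$) if $\int f(|\tau|)\,d\mathsf x_1\ge\int f(|\tau|)\,d\mathsf x_2$ for all concave non-increasing $f:[0,1]\to\mathbb R$. Let $L,R$ be non-constant polynomials with non-negative coefficients and $L(1)=R(1)=1$ (the information-node and generator-node degree distributions), and let $\lambda=L'/L'(1)$, $\rho=R'/R'(1)$. For the LDGM$(\lambda,\rho)$ ensemble and $\mathsf c\in\mathcal X$ define $\mathsf T(\mathsf x)=\lambda^{\circledast}(\mathsf c\boxtimes\rho^{\boxtimes}(\mathsf x))$, let $\mathsf f_0(\mathsf c)=\lim_{\ell\to\infty}\mathsf T^{\ell}(\Delta_\infty)$ be the limit in $(\mathcal X,d_H)$ (the minimal fixed point), and let $$U(\mathsf x)=\tfrac{L'(1)}{R'(1)}H(\mathsf c\boxtimes R^{\boxtimes}(\mathsf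 x))-L'(1)H(\mathsf x\boxtimes\mathsf c\boxtimes\rho^{\boxtimes}(\mathsf x))+L'(1)H(\mathsf c\boxtimes\rho^{\boxtimes}(\mathsf x))-H(L^{\circledast}(\mathsf c\boxtimes\rho^{\boxtimes}(\mathsf x)))-\tfrac{L'(1)}{R'(1)}H(\mathsf c).$$ Let $\mathcal V=\{\mathsf x\in\mathcal X:\mathsf T^{\ell}(\mathsf x)\to\mathsf f_0(\mathsf c)\text{ in }d_H\}$ and $\Delta E(\mathsf c)=\inf_{\mathsf x\in\mathcal X\setminus\mathcal V}U(\mathsf x)-U(\mathsf f_0(\mathsf c))\in(-\infty,\infty]$, where $\inf\emptyset=+\infty$. Let $$K_{\lambda,\rho}=L'(1)\bigl(2\rho''(1)+\rho'(1)+2\lambda'(1)\rho'(1)^2\bigr).$$ For integers $N\ge 0$, $w\ge 1$ and $N_w=2N+w-1$, a fixed point of density evolution for the $(\lambda,\rho,N,w)$ spatially-coupled LDGM ensemble is a vector $(\mathsf x_1,\dots,\mathsf x_{N_w})\in\mathcal X^{N_w}$ that satisfies, for $1\le i\le N_w$ and with $\mathsf x_i=\Delta_\infty$ for $i\notin\{1,\dots,N_w\}$,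 $$\mathsf x_i=\frac1w\sum_{k=0}^{w-1}\Lambda_{i-k}\Bigl(\frac1w\sum_{j=0}^{w-1}\mathsf c\boxtimes\rho^{\boxtimes}(\mathsf x_{i-k+j})\Bigr),$$ where $\Lambda_m(\mathsf y)=\lambda^{\circledast}(\mathsf y)$ if $1\le m\le 2N$ and $\Lambda_m(\mathsf y)=\Delta_\infty$ otherwise. **Theorem.** Fix an LDGM$(\lambda,\rho)$ ensemble and a BMS channel $\mathsf c\in\mathcal X$ with $\Delta E(\mathsf c)>0$. Then the limit $\mathsf f_0(\mathsf c)\in\mathcal X$ exists, and for all integers $N\ge0$ and $w>K_{\lambda,\rho}/(2\Delta E(\mathsf c))$ (where the right-hand side is $0$ if $\Delta E(\mathsf c)=\infty$), every fixed point $(\mathsf x_1,\dots,\mathsf x_{N_w})$ of density evolution for the $(\lambda,\rho,N,w)$ spatially-coupled LDGM ensemble satisfies $$\mathsf x_i\preceq\mathsf f_0(\mathsf c),\qquad 1\le i\le N_w.$$ -/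

import Mathlib

open MeasureTheory Filter Topology
open scoped ENNReal Polynomial

noncomputable section

namespace LDGM

/-! ### Symmetric probability measures on the extended real line -/

/-- The map `α ↦ tanh (α / 2)` from the extended reals to `[-1, 1]`. -/
def tau : EReal → ℝ
  | ⊤ => 1
  | ⊥ => -1
  | (r : ℝ) => Real.tanh (r / 2)

/-- The inverse `t ↦ 2 artanh t` of `tau`, sending `1` to `+∞` and `-1` to `-∞`. -/
def tauInv (t : ℝ) : EReal :=
  if 1 ≤ t then ⊤ else if t ≤ -1 then ⊥ else ((2 * Real.artanh t : ℝ) : EReal)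

/-- Symmetry of a measure on the extended reals: `x(-E) = ∫_E e^{-α} x(dα)`.
The sets `E` range over the Borel subsets of `(-∞, +∞]`; taking `E = {+∞}` yields `x({-∞}) = 0`.
(For sets containing `-∞` the right-hand side would be the indeterminate product `e^{∞} · 0`.) -/
def IsSymmetric (x : Measure EReal) : Prop :=
  ∀ E : Set EReal, MeasurableSet E → ⊥ ∉ E →
    x ((fun a => -a) ⁻¹' E) = ∫⁻ a in E, EReal.exp (-a) ∂x

/-- The set `𝒳` of symmetric probability measures on the extended reals, that is, of the
log-likelihood-ratio distributions of binary memoryless symmetric channels. -/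
def symProb : Set (Measure EReal) :=
  {x | IsProbabilityMeasure x ∧ IsSymmetric x}

/-- The unit mass at `0` (the useless channel). -/
def deltaZero : Measure EReal := Measure.dirac 0

/-- The unit mass at `+∞` (the perfect channel). -/
def deltaInf : Measure EReal := Measure.dirac ⊤

/-! ### Variable-node and check-node operations -/

/-- The variable-node operation: the law of `α₁ + α₂` for independent `α₁ ∼ x`, `α₂ ∼ y`. -/
def varOp (x y : Measure EReal) : Measure EReal :=
  (x.prod y).map fun p => p.1 + p.2

/-- The check-node operation: the law of `τ⁻¹(τ(α₁) τ(α₂))` for independent `α₁ ∼ x`, `α₂ ∼ y`. -/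
def checkOp (x y : Measure EReal) : Measure EReal :=
  (x.prod y).map fun p => tauInv (tau p.1 * tau p.2)

/-- `n`-fold variable-node power; the `0`-th power is the identity element `Δ₀`. -/
def varPow (x : Measure EReal) : ℕ → Measure EReal
  | 0 => deltaZero
  | n + 1 => varOp (varPow x n) x

/-- `n`-fold check-node power; the `0`-th power is the identity element `Δ_∞`. -/
def checkPow (x : Measure EReal) : ℕ → Measure EReal
  | 0 => deltaInf
  | n + 1 => checkOp (checkPow x n) x

/-- `∑ₙ pₙ x^{⊛ n}`, for a polynomial `p` with non-negative coefficients. -/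
def varPoly (p : ℝ[X]) (x : Measure EReal) : Measure EReal :=
  ∑ n ∈ Finset.range (p.natDegree + 1), ENNReal.ofReal (p.coeff n) • varPow x n

/-- `∑ₙ pₙ x^{⊠ n}`, for a polynomial `p` with non-negative coefficients. -/
def checkPoly (p : ℝ[X]) (x : Measure EReal) : Measure EReal :=
  ∑ n ∈ Finset.range (p.natDegree + 1), ENNReal.ofReal (p.coeff n) • checkPow x n

/-! ### Degradation, entropy and entropy distance -/

/-- `Degraded x y` says that `x` is degraded with respect to `y` (written `x ⪰ y`): the functional
`I_f(x) = ∫ f(|tanh(α/2)|) x(dα)` is at least `I_f(y)` for all concave non-increasing `f` on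
`[0, 1]`. -/
def Degraded (x y : Measure EReal) : Prop :=
  ∀ f : ℝ → ℝ, ConcaveOn ℝ (Set.Icc 0 1) f → AntitoneOn f (Set.Icc 0 1) →
    ∫ a, f |tau a| ∂y ≤ ∫ a, f |tau a| ∂x

/-- The entropy functional `H(x) = ∫ log₂(1 + e^{-α}) x(dα)`. (Symmetric measures do not charge
`-∞`, so the value of the integrand there is irrelevant.) -/
def entropy (x : Measure EReal) : ℝ :=
  ∫ a, Real.logb 2 (1 + (EReal.exp (-a)).toReal) ∂x

/-- The moment `M_k(x) = ∫ tanh(α/2)^{2k} x(dα)`. -/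
def moment (k : ℕ) (x : Measure EReal) : ℝ :=
  ∫ a, tau a ^ (2 * k) ∂x

/-- The coefficient `γ_k = 1 / (log 2 · 2k(2k-1))`, for `k ≥ 1`. -/
def gammaCoeff (k : ℕ) : ℝ :=
  (Real.log 2)⁻¹ / (2 * k * (2 * k - 1))

/-- The entropy distance `∑_{k ≥ 1} γ_k |M_k(x) - M_k(y)|`. -/
def entropyDist (x y : Measure EReal) : ℝ :=
  ∑' k : ℕ, gammaCoeff (k + 1) * |moment (k + 1) x - moment (k + 1) y|

/-! ### LDGM ensembles: the single system -/

/-- An LDGM ensemble, given by its node-perspective degree distributions: `L` for the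
information-nodes and `R` for the generator-nodes. -/
structure Ensemble where
  L : ℝ[X]
  R : ℝ[X]
  L_nonneg : ∀ n, 0 ≤ L.coeff n
  R_nonneg : ∀ n, 0 ≤ R.coeff n
  L_eval_one : L.eval 1 = 1
  R_eval_one : R.eval 1 = 1
  L_deriv_pos : 0 < L.derivative.eval 1
  R_deriv_pos : 0 < R.derivative.eval 1

namespace Ensemble

variable (E : Ensemble)

/-- `L'(1)`, the average information-node degree. -/
def avgL : ℝ := E.L.derivative.eval 1

/-- `R'(1)`, the average generator-node degree. -/
def avgR : ℝ := E.R.derivative.eval 1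

/-- The edge-perspective degree distribution `λ(t) = L'(t) / L'(1)`. -/
def lam : ℝ[X] := Polynomial.C E.avgL⁻¹ * E.L.derivative

/-- The edge-perspective degree distribution `ρ(t) = R'(t) / R'(1)`. -/
def rho : ℝ[X] := Polynomial.C E.avgR⁻¹ * E.R.derivative

/-- The generator-node output `c ⊠ ρ^⊠(x)`. -/
def genOut (c x : Measure EReal) : Measure EReal :=
  checkOp c (checkPoly E.rho x)

/-- One step of density evolution: `T_s(x; c) = λ^⊛(c ⊠ ρ^⊠(x))`. -/
def de (c x : Measure EReal) : Measure EReal :=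
  varPoly E.lam (E.genOut c x)

/-- Density evolution with channel `c`, initialized with `a`, converges to `f` in `𝒳` with respect
to the entropy distance; that is, `T_s^{(∞)}(a; c) = f`. -/
def DEConverges (c a f : Measure EReal) : Prop :=
  f ∈ symProb ∧ Tendsto (fun ℓ : ℕ => entropyDist ((E.de c)^[ℓ] a) f) atTop (𝓝 0)

open Classical in
/-- The minimal fixed point `f₀(c) = T_s^{(∞)}(Δ_∞; c)`: the limit of density evolution
initialized with `Δ_∞`. -/
def minFixedPoint (c : Measure EReal) : Measure EReal :=
  if h : ∃ f, E.DEConverges c deltaInf f then h.choose else deltaInf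

/-- The potential functional of the single system. -/
def potential (c x : Measure EReal) : ℝ :=
  E.avgL / E.avgR * entropy (checkOp c (checkPoly E.R x))
    - E.avgL * entropy (checkOp x (E.genOut c x))
    + E.avgL * entropy (E.genOut c x)
    - entropy (varPoly E.L (E.genOut c x))
    - E.avgL / E.avgR * entropy c

/-- The basin of attraction of the minimal fixed point. -/
def basin (c : Measure EReal) : Set (Measure EReal) :=
  {x | x ∈ symProb ∧ E.DEConverges c x (E.minFixedPoint c)}

/-- The energy gap `ΔE(c) = inf_{x ∈ 𝒳 \ 𝒱(c)} U_s(x; c) - U_s(f₀(c); c)`, where the infimum over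
the empty set is `+∞`. -/
def energyGap (c : Measure EReal) : EReal :=
  (⨅ x ∈ symProb \ E.basin c, (E.potential c x : EReal))
    - (E.potential c (E.minFixedPoint c) : EReal)

/-- The constant `K_{λ,ρ} = L'(1) (2 ρ''(1) + ρ'(1) + 2 λ'(1) ρ'(1)²)`. -/
def couplingConst : ℝ :=
  E.avgL * (2 * E.rho.derivative.derivative.eval 1 + E.rho.derivative.eval 1
    + 2 * E.lam.derivative.eval 1 * E.rho.derivative.eval 1 ^ 2)

/-! ### The spatially-coupled system -/

/-- Output of the information-node group at position `i` on input `y`: it is `λ^⊛(y)` at the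
positions `1, …, 2N`, and `Δ_∞` at all other positions. -/
def infoOut (N : ℕ) (i : ℤ) (y : Measure EReal) : Measure EReal :=
  if 1 ≤ i ∧ i ≤ 2 * (N : ℤ) then varPoly E.lam y else deltaInf

/-- The generator-node positions `1, …, 2N + w - 1`. -/
def genPositions (N w : ℕ) : Set ℤ := Set.Icc 1 (2 * (N : ℤ) + (w : ℤ) - 1)

open Classical in
/-- One step of density evolution of the `(λ, ρ, N, w)` spatially-coupled system. The state assigns
to every generator-node position its input distribution; it is extended to all integer positions by
the boundary value `Δ_∞`. -/
def coupledDE (N w : ℕ) (c : Measure EReal) (x : ℤ → Measure EReal) : ℤ → Measure EReal :=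
  fun i =>
    if i ∈ genPositions N w then
      (w : ℝ≥0∞)⁻¹ • ∑ k ∈ Finset.range w,
        E.infoOut N (i - (k : ℤ))
          ((w : ℝ≥0∞)⁻¹ • ∑ j ∈ Finset.range w, E.genOut c (x (i - (k : ℤ) + (j : ℤ))))
    else deltaInf

/-- A fixed point of density evolution of the spatially-coupled system: a vector of symmetric
probability measures (with value `Δ_∞` outside the generator-node positions) which is unchanged by
one step. -/
def IsCoupledFixedPoint (N w : ℕ) (c : Measure EReal) (x : ℤ → Measure EReal) : Prop :=
  (∀ i, x i ∈ symProb) ∧ E.coupledDE N w c x = x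

end Ensemble

end LDGM

end

/-! Both node operations preserve ⪰, so density evolution, single or coupled, is monotone. Put n =
2N+w-1 and consider profiles on ℤ that equal 𝖿₀(𝖼) up to position 0 and are constant from n on.
Starting from Δ₀ at the positive positions, iterate the coupled map without boundary, clamped to
this shape (`profileIter`). Every iterate is degraded with respect to every coupled fixed point,
since the boundary of the coupled system only replaces outputs by the perfect Δ_∞. The iterates get
worse from left to right and better with each step.

There is a dichotomy for the values u at the right end n. If some u lies in the basin 𝒱, then u is
degraded with respect to every x_i; on constant profiles the coupled map is 𝖳, so the bound survives
iteration of 𝖳 and passes to the limit 𝖿₀(𝖼) (`IsCoupledFixedPoint.degraded_of_mem_basin`).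
Otherwise ΔE ≤ U(u) - U(𝖿₀(𝖼)) for every iterate, and it suffices to make the right side at most
K/(2w) + ε (`exists_potential_profileIter_le`).

For this, entropy is written as 1 - Σ γ_k M_k (`entropy_eq`). Moments are multiplicative under ⊠,
and the duality rule makes the entropy of a ⊛-product explicit as well. U is then telescoped along
the profile: the generator part over positions, the information part over window averages. Summation
by parts (`sum_window_mul`) turns the first-order weights of the information part into moments of
the updated profile, and convexity of R (`genPotential_sub_nonneg`) plays them off against the
generator part, up to the defect H(z) - H(updated z) (`IsProfile.potential_sub_le`). Consecutive
window averages differ by at most ρ'(1)/w in every moment, so the second-order remainder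
(`entropy_varPoly_L_le`) sums to at most L'(1)λ'(1)ρ'(1)²/w ≤ K/(2w). Entropies decrease along the
iteration and are bounded below, so the defect becomes arbitrarily small; no limiting profile is
needed. -/

namespace LDGM

/-! ### The map `tau` and its inverse -/

@[simp] lemma tau_top : tau ⊤ = 1 := rfl

@[simp] lemma tau_bot : tau ⊥ = -1 := rfl

@[simp] lemma tau_coe (r : ℝ) : tau (r : EReal) = Real.tanh (r / 2) := rfl

@[simp] lemma tau_zero : tau 0 = 0 := by
  rw [← EReal.coe_zero, tau_coe]; simp

lemma tanh_half_eq (r : ℝ) :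
    Real.tanh (r / 2) = (1 - Real.exp (-r)) / (1 + Real.exp (-r)) := by
  have h : Real.exp (-r) = Real.exp (-(r / 2)) / Real.exp (r / 2) := by
    rw [← Real.exp_sub]; congr 1; ring
  rw [Real.tanh_eq, h]
  have := Real.exp_pos (r / 2)
  field_simp

lemma tau_le_one (a : EReal) : tau a ≤ 1 := by
  induction a with
  | bot => simp
  | top => simp
  | coe r => exact (Real.tanh_lt_one _).le

lemma tau_neg (a : EReal) : tau (-a) = -tau a := by
  induction a with
  | bot => simp
  | top => simp
  | coe r => rw [← EReal.coe_neg, tau_coe, tau_coe, neg_div, Real.tanh_neg]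

lemma neg_one_le_tau (a : EReal) : -1 ≤ tau a := by
  have := tau_le_one (-a)
  rw [tau_neg] at this
  linarith

lemma abs_tau_le_one (a : EReal) : |tau a| ≤ 1 := abs_le.2 ⟨neg_one_le_tau a, tau_le_one a⟩

lemma abs_tau_mem (a : EReal) : |tau a| ∈ Set.Icc (0 : ℝ) 1 := ⟨abs_nonneg _, abs_tau_le_one a⟩

lemma neg_one_lt_tau {a : EReal} (ha : a ≠ ⊥) : -1 < tau a := by
  induction a with
  | bot => exact absurd rfl ha
  | top => norm_num
  | coe r => exact Real.neg_one_lt_tanh _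

lemma tau_lt_one {a : EReal} (ha : a ≠ ⊤) : tau a < 1 := by
  induction a with
  | top => exact absurd rfl ha
  | bot => norm_num
  | coe r => exact Real.tanh_lt_one _

lemma tau_tauInv {t : ℝ} (ht : t ∈ Set.Icc (-1 : ℝ) 1) : tau (tauInv t) = t := by
  unfold tauInv
  split_ifs with h1 h2
  · simpa using le_antisymm h1 ht.2
  · simpa using le_antisymm ht.1 h2
  · rw [tau_coe, mul_div_cancel_left₀ _ (two_ne_zero' ℝ), Real.tanh_artanh ⟨by linarith, by linarith⟩]

lemma tau_mul_mem (a b : EReal) : tau a * tau b ∈ Set.Icc (-1 : ℝ) 1 := by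
  refine abs_le.1 ?_
  rw [abs_mul]
  exact mul_le_one₀ (abs_tau_le_one a) (abs_nonneg _) (abs_tau_le_one b)

lemma tau_tauInv_mul (a b : EReal) : tau (tauInv (tau a * tau b)) = tau a * tau b :=
  tau_tauInv (tau_mul_mem a b)

lemma strictMono_tanh : StrictMono Real.tanh := by
  intro x y hxy
  by_contra! h
  have := (Real.artanh_le_artanh_iff ⟨Real.neg_one_lt_tanh _, Real.tanh_lt_one _⟩
    ⟨Real.neg_one_lt_tanh _, Real.tanh_lt_one _⟩).2 h
  rw [Real.artanh_tanh, Real.artanh_tanh] at this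
  linarith

lemma tau_strictMono : StrictMono tau := by
  intro a b hab
  induction a with
  | top => simp at hab
  | bot => exact neg_one_lt_tau hab.ne'
  | coe r =>
    induction b with
    | bot => simp at hab
    | top => exact tau_lt_one hab.ne
    | coe s => exact strictMono_tanh (by have := EReal.coe_lt_coe_iff.1 hab; linarith)

lemma continuous_tau : Continuous tau := by
  let f : EReal → Set.Icc (-1 : ℝ) 1 := fun a => ⟨tau a, neg_one_le_tau a, tau_le_one a⟩
  have hf : StrictMono f := fun a b h => tau_strictMono h
  have hs : Function.Surjective f := fun t => ⟨tauInv t, Subtype.ext (tau_tauInv t.2)⟩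
  exact continuous_subtype_val.comp (hf.orderIsoOfSurjective f hs).continuous

lemma measurable_tau : Measurable tau := continuous_tau.measurable

lemma measurable_tauInv : Measurable tauInv := by
  have : Measurable Real.artanh := by
    unfold Real.artanh
    fun_prop
  refine Measurable.ite measurableSet_Ici measurable_const
    (Measurable.ite measurableSet_Iic measurable_const ?_)
  exact measurable_coe_real_ereal.comp (this.const_mul 2)

lemma measurable_tauInv_mul :
    Measurable fun p : EReal × EReal => tauInv (tau p.1 * tau p.2) :=
  measurable_tauInv.comp
    ((measurable_tau.comp measurable_fst).mul (measurable_tau.comp measurable_snd))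

/-- Trades the unbounded factor e^{-α} for the bounded weights 1 ± τ, which are easier to integrate
and to pass to limits. -/
lemma exp_neg_mul_one_add_tau {a : EReal} (ha : a ≠ ⊥) :
    EReal.exp (-a) * ENNReal.ofReal (1 + tau a) = ENNReal.ofReal (1 - tau a) := by
  induction a with
  | bot => exact absurd rfl ha
  | top => simp
  | coe r =>
    have h := Real.exp_pos (-r)
    rw [← EReal.coe_neg, EReal.exp_coe, ← ENNReal.ofReal_mul h.le, tau_coe, tanh_half_eq]
    congr 1
    field_simp
    ring

lemma one_add_exp_neg {a : EReal} (ha : a ≠ ⊥) :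
    1 + (EReal.exp (-a)).toReal = 2 / (1 + tau a) := by
  induction a with
  | bot => exact absurd rfl ha
  | top => norm_num
  | coe r =>
    have h := Real.exp_pos (-r)
    rw [← EReal.coe_neg, EReal.exp_coe, ENNReal.toReal_ofReal h.le, tau_coe, tanh_half_eq]
    field_simp
    ring

lemma tau_add {a b : EReal} (ha : a ≠ ⊥) (hb : b ≠ ⊥) :
    tau (a + b) = (tau a + tau b) / (1 + tau a * tau b) := by
  induction a with
  | bot => exact absurd rfl ha
  | top =>
    rw [EReal.top_add_of_ne_bot hb, tau_top, one_mul, div_self]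
    have := neg_one_lt_tau hb
    linarith
  | coe r =>
    induction b with
    | bot => exact absurd rfl hb
    | top =>
      rw [EReal.add_top_of_ne_bot ha, tau_top, mul_one, add_comm, div_self]
      have := neg_one_lt_tau ha
      linarith
    | coe s =>
      rw [← EReal.coe_add, tau_coe, tau_coe, tau_coe, tanh_half_eq, tanh_half_eq, tanh_half_eq,
        neg_add, Real.exp_add]
      have h1 := Real.exp_pos (-r)
      have h2 := Real.exp_pos (-s)
      have h3 : (1 + Real.exp (-r)) * (1 + Real.exp (-s))
        + (1 - Real.exp (-r)) * (1 - Real.exp (-s)) ≠ 0 := by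
          nlinarith [mul_pos h1 h2]
      have h4 : 1 + (1 - Real.exp (-r)) / (1 + Real.exp (-r)) *
          ((1 - Real.exp (-s)) / (1 + Real.exp (-s))) ≠ 0 := by
        field_simp
        exact div_ne_zero h3 (by positivity)
      field_simp
      ring

/-! ### Symmetric measures -/

lemma IsSymmetric.measure_bot {x : Measure EReal} (hx : IsSymmetric x) : x {⊥} = 0 := by
  have h := hx {⊤} (measurableSet_singleton _) (by simp)
  have h2 : (fun a : EReal => -a) ⁻¹' {⊤} = {⊥} := by
    ext a; simp
  rw [h2] at h
  rw [h, Measure.restrict_singleton, lintegral_smul_measure, lintegral_dirac]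
  simp

lemma IsSymmetric.ae_ne_bot {x : Measure EReal} (hx : IsSymmetric x) : ∀ᵐ a ∂x, a ≠ ⊥ := by
  rw [ae_iff]
  simpa using hx.measure_bot

/-- Symmetry says that two measures agree away from -∞; `g ⊥ = 0` is what allows restricting to that
set. -/
lemma IsSymmetric.lintegral_neg {x : Measure EReal} (hx : IsSymmetric x) {g : EReal → ℝ≥0∞}
    (hg : Measurable g) (h0 : g ⊥ = 0) :
    ∫⁻ a, g (-a) ∂x = ∫⁻ a, g a * EReal.exp (-a) ∂x := by
  have hexp : Measurable fun a : EReal => EReal.exp (-a) :=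
    EReal.measurable_exp.comp measurable_neg
  have key : (x.map (fun a => -a)).restrict {⊥}ᶜ
      = (x.withDensity fun a => EReal.exp (-a)).restrict {⊥}ᶜ := by
    ext s hs
    have hm : MeasurableSet (s ∩ {⊥}ᶜ : Set EReal) := hs.inter (measurableSet_singleton _).compl
    rw [Measure.restrict_apply hs, Measure.restrict_apply hs,
      Measure.map_apply measurable_neg hm, withDensity_apply _ hm]
    exact hx _ hm (by simp)
  have hind : ({⊥}ᶜ : Set EReal).indicator g = g := by
    ext a
    by_cases ha : a = ⊥
    · simp [ha, h0]
    · simp [ha]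
  have hms : MeasurableSet ({⊥}ᶜ : Set EReal) := (measurableSet_singleton _).compl
  calc ∫⁻ a, g (-a) ∂x = ∫⁻ a, g a ∂(x.map (fun a => -a)) := by
        rw [lintegral_map hg measurable_neg]
    _ = ∫⁻ a in {⊥}ᶜ, g a ∂(x.map (fun a => -a)) := by
        rw [← lintegral_indicator hms, hind]
    _ = ∫⁻ a, g a ∂(x.withDensity fun a => EReal.exp (-a)) := by
        rw [key, ← lintegral_indicator hms, hind]
    _ = _ := by
        rw [lintegral_withDensity_eq_lintegral_mul _ hexp hg]
        simp only [Pi.mul_apply, mul_comm]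

/-- The bounded form of symmetry: (1-τ)dx is invariant under reflection. Test against g(1+τ), which
vanishes at -∞, and use e^{-α}(1+τ) = 1-τ. -/
lemma IsSymmetric.lintegral_neg_mul {x : Measure EReal} (hx : IsSymmetric x) {g : EReal → ℝ≥0∞}
    (hg : Measurable g) :
    ∫⁻ a, g (-a) * ENNReal.ofReal (1 - tau a) ∂x = ∫⁻ a, g a * ENNReal.ofReal (1 - tau a) ∂x := by
  have hm : Measurable fun a => ENNReal.ofReal (1 + tau a) :=
    (measurable_tau.const_add 1).ennreal_ofReal
  have := hx.lintegral_neg (g := fun a => g a * ENNReal.ofReal (1 + tau a)) (hg.mul hm) (by simp)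
  simp only [tau_neg, ← sub_eq_add_neg] at this
  rw [this]
  refine lintegral_congr_ae ?_
  filter_upwards [hx.ae_ne_bot] with a ha
  rw [mul_assoc, mul_comm (ENNReal.ofReal (1 + tau a)), exp_neg_mul_one_add_tau ha]

/-- The converse takes g = 1_E/(1+τ), where 1+τ is positive because E avoids -∞. -/
lemma isSymmetric_of_lintegral_neg_mul {x : Measure EReal}
    (h : ∀ g : EReal → ℝ≥0∞, Measurable g →
      ∫⁻ a, g (-a) * ENNReal.ofReal (1 - tau a) ∂x
        = ∫⁻ a, g a * ENNReal.ofReal (1 - tau a) ∂x) : IsSymmetric x := by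
  intro E hE hbot
  have hm : Measurable fun a => (ENNReal.ofReal (1 + tau a))⁻¹ :=
    (measurable_tau.const_add 1).ennreal_ofReal.inv
  have hpos : ∀ a ∈ E, ENNReal.ofReal (1 + tau a) ≠ 0 := by
    intro a ha
    have := neg_one_lt_tau (a := a) (fun h => hbot (h ▸ ha))
    simp only [ne_eq, ENNReal.ofReal_eq_zero, not_le]
    linarith
  have := h (E.indicator fun a => (ENNReal.ofReal (1 + tau a))⁻¹) (hm.indicator hE)
  have h1 : ∀ a, E.indicator (fun a => (ENNReal.ofReal (1 + tau a))⁻¹) (-a) *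
      ENNReal.ofReal (1 - tau a) = ((fun a => -a) ⁻¹' E).indicator 1 a := by
    intro a
    by_cases ha : -a ∈ E
    · have h2 := hpos _ ha
      rw [Set.indicator_of_mem ha, Set.indicator_of_mem (by exact ha), tau_neg, ← sub_eq_add_neg]
      rw [tau_neg, ← sub_eq_add_neg] at h2
      exact ENNReal.inv_mul_cancel h2 ENNReal.ofReal_ne_top
    · rw [Set.indicator_of_notMem ha, Set.indicator_of_notMem (by exact ha), zero_mul]
  have h2 : ∀ a, E.indicator (fun a => (ENNReal.ofReal (1 + tau a))⁻¹) a *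
      ENNReal.ofReal (1 - tau a) = E.indicator (fun a => EReal.exp (-a)) a := by
    intro a
    by_cases ha : a ∈ E
    · rw [Set.indicator_of_mem ha, Set.indicator_of_mem ha,
        ← exp_neg_mul_one_add_tau (fun h => hbot (h ▸ ha)), mul_comm, mul_assoc,
        ENNReal.mul_inv_cancel (hpos a ha) ENNReal.ofReal_ne_top, mul_one]
    · rw [Set.indicator_of_notMem ha, Set.indicator_of_notMem ha, zero_mul]
  simp only [h1, h2] at this
  rwa [lintegral_indicator_one (measurable_neg hE), lintegral_indicator hE] at this

/-- Splitting `1 = (1 + τ)/2 + (1 - τ)/2` and reflecting the second part. -/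
lemma IsSymmetric.lintegral_eq {x : Measure EReal} (hx : IsSymmetric x) {g : EReal → ℝ≥0∞}
    (hg : Measurable g) :
    ∫⁻ a, g a ∂x = ∫⁻ a, (ENNReal.ofReal ((1 + tau a) / 2) * g a
      + ENNReal.ofReal ((1 - tau a) / 2) * g (-a)) ∂x := by
  have hp : Measurable fun a => ENNReal.ofReal ((1 + tau a) / 2) :=
    ((measurable_tau.const_add 1).div_const 2).ennreal_ofReal
  have hm : Measurable fun a => ENNReal.ofReal ((1 - tau a) / 2) :=
    ((measurable_tau.const_sub 1).div_const 2).ennreal_ofReal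
  have h2 : ∀ a, ENNReal.ofReal ((1 - tau a) / 2)
      = ENNReal.ofReal (1 / 2) * ENNReal.ofReal (1 - tau a) := by
    intro a
    rw [← ENNReal.ofReal_mul (by norm_num)]
    congr 1; ring
  have key : ∫⁻ a, ENNReal.ofReal ((1 - tau a) / 2) * g (-a) ∂x
      = ∫⁻ a, ENNReal.ofReal ((1 - tau a) / 2) * g a ∂x := by
    have := hx.lintegral_neg_mul (g := fun a => ENNReal.ofReal (1 / 2) * g a) (hg.const_mul _)
    calc _ = _ := lintegral_congr fun a => by rw [h2]; ring
      _ = _ := this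
      _ = _ := lintegral_congr fun a => by rw [h2]; ring
  have hpg : Measurable fun a => ENNReal.ofReal ((1 + tau a) / 2) * g a := hp.mul hg
  rw [lintegral_add_left hpg, key, ← lintegral_add_left hpg]
  refine lintegral_congr fun a => ?_
  rw [← add_mul, ← ENNReal.ofReal_add]
  · rw [← add_div, add_add_sub_cancel]; norm_num
  · linarith [neg_one_le_tau a]
  · linarith [tau_le_one a]

lemma IsSymmetric.measurePreserving_neg {x : Measure EReal} (hx : IsSymmetric x) :
    MeasurePreserving (fun a : EReal => -a) (x.withDensity fun a => ENNReal.ofReal (1 - tau a))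
      (x.withDensity fun a => ENNReal.ofReal (1 - tau a)) := by
  have hm : Measurable fun a => ENNReal.ofReal (1 - tau a) :=
    (measurable_tau.const_sub 1).ennreal_ofReal
  refine ⟨measurable_neg, ?_⟩
  ext s hs
  rw [Measure.map_apply measurable_neg hs, withDensity_apply _ (measurable_neg hs),
    withDensity_apply _ hs, ← lintegral_indicator (measurable_neg hs), ← lintegral_indicator hs]
  have := hx.lintegral_neg_mul (g := s.indicator 1) (measurable_one.indicator hs)
  convert this using 3 with a a
  · by_cases h : -a ∈ s <;> simp [h, Set.indicator]
  · by_cases h : a ∈ s <;> simp [h]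

lemma IsSymmetric.integral_neg_mul {x : Measure EReal} (hx : IsSymmetric x) (φ : EReal → ℝ) :
    ∫ a, (1 - tau a) * φ (-a) ∂x = ∫ a, (1 - tau a) * φ a ∂x := by
  have hm : Measurable fun a => ENNReal.ofReal (1 - tau a) :=
    (measurable_tau.const_sub 1).ennreal_ofReal
  have h (ψ : EReal → ℝ) : ∫ a, (1 - tau a) * ψ a ∂x
      = ∫ a, ψ a ∂(x.withDensity fun a => ENNReal.ofReal (1 - tau a)) := by
    rw [integral_withDensity_eq_integral_toReal_smul hm (by simp)]
    refine integral_congr_ae (ae_of_all _ fun a => ?_)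
    simp [ENNReal.toReal_ofReal (by linarith [tau_le_one a] : 0 ≤ 1 - tau a)]
  rw [h (fun a => φ (-a)), h φ]
  exact hx.measurePreserving_neg.integral_comp' (f := MeasurableEquiv.neg EReal) φ

/-- A symmetric measure integrates an odd function `φ` as `τ φ`. -/
lemma IsSymmetric.integral_odd {x : Measure EReal} (hx : IsSymmetric x) {φ : EReal → ℝ}
    (hodd : ∀ a, φ (-a) = -φ a) (hi : Integrable φ x) :
    ∫ a, φ a ∂x = ∫ a, tau a * φ a ∂x := by
  -- For odd φ, invariance of (1-τ)dx forces ∫(1-τ)φ = 0.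
  have h := hx.integral_neg_mul φ
  simp only [hodd, mul_neg, integral_neg] at h
  have h0 : ∫ a, (1 - tau a) * φ a ∂x = 0 := by linarith
  have hi2 : Integrable (fun a => tau a * φ a) x :=
    hi.bdd_mul measurable_tau.aestronglyMeasurable (ae_of_all _ abs_tau_le_one)
  simp only [sub_mul, one_mul] at h0
  rw [integral_sub hi hi2] at h0
  linarith

/-! ### Closure properties of `symProb` -/

instance (x y : Measure EReal) [IsProbabilityMeasure x] [IsProbabilityMeasure y] :
    IsProbabilityMeasure (varOp x y) :=
  Measure.isProbabilityMeasure_map (measurable_fst.add measurable_snd).aemeasurable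

instance (x y : Measure EReal) [IsProbabilityMeasure x] [IsProbabilityMeasure y] :
    IsProbabilityMeasure (checkOp x y) :=
  Measure.isProbabilityMeasure_map measurable_tauInv_mul.aemeasurable

lemma deltaInf_mem : deltaInf ∈ symProb := by
  refine ⟨by unfold deltaInf; infer_instance, isSymmetric_of_lintegral_neg_mul fun g _ => ?_⟩
  simp [deltaInf]

lemma deltaZero_mem : deltaZero ∈ symProb := by
  refine ⟨by unfold deltaZero; infer_instance, isSymmetric_of_lintegral_neg_mul fun g _ => ?_⟩
  simp [deltaZero]

lemma tauInv_neg {t : ℝ} (ht : t ∈ Set.Icc (-1 : ℝ) 1) : tauInv (-t) = -tauInv t := by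
  apply tau_strictMono.injective
  rw [tau_neg, tau_tauInv ht, tau_tauInv ⟨by linarith [ht.2], by linarith [ht.1]⟩]

/-- The weight splits as 1-τ(a)τ(b) = ½(1-τ(a))(1+τ(b)) + ½(1+τ(a))(1-τ(b)). Each summand carries
the invariant weight of one variable, and reflecting that variable alone reflects the output. -/
lemma checkOp_mem {x y : Measure EReal} (hx : x ∈ symProb) (hy : y ∈ symProb) :
    checkOp x y ∈ symProb := by
  have := hx.1
  have := hy.1
  refine ⟨inferInstance, isSymmetric_of_lintegral_neg_mul fun g hg => ?_⟩
  have hw : Measurable fun a => ENNReal.ofReal (1 - tau a) :=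
    (measurable_tau.const_sub 1).ennreal_ofReal
  have hw' : Measurable fun a => ENNReal.ofReal (1 + tau a) :=
    (measurable_tau.const_add 1).ennreal_ofReal
  let T : EReal → EReal → EReal := fun a b => tauInv (tau a * tau b)
  have hT : Measurable fun p : EReal × EReal => T p.1 p.2 := measurable_tauInv_mul
  have hT1 (a b) : T (-a) b = -T a b := by
    simp only [T, tau_neg, neg_mul, tauInv_neg (tau_mul_mem a b)]
  have hT2 (a b) : T a (-b) = -T a b := by
    simp only [T, tau_neg, mul_neg, tauInv_neg (tau_mul_mem a b)]
  have hsplit (a b : EReal) : ENNReal.ofReal (1 - tau (T a b))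
      = ENNReal.ofReal (1 / 2) * (ENNReal.ofReal (1 - tau a) * ENNReal.ofReal (1 + tau b))
        + ENNReal.ofReal (1 / 2) * (ENNReal.ofReal (1 + tau a) * ENNReal.ofReal (1 - tau b)) := by
    have h1 := tau_le_one a
    have h2 := tau_le_one b
    have h3 := neg_one_le_tau a
    have h4 := neg_one_le_tau b
    have h5 : 0 ≤ (1 - tau a) * (1 + tau b) := mul_nonneg (by linarith) (by linarith)
    have h6 : 0 ≤ (1 + tau a) * (1 - tau b) := mul_nonneg (by linarith) (by linarith)
    rw [← ENNReal.ofReal_mul (p := 1 - tau a) (by linarith),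
      ← ENNReal.ofReal_mul (p := 1 + tau a) (by linarith), ← ENNReal.ofReal_mul (by norm_num), ← ENNReal.ofReal_mul (by norm_num),
      ← ENNReal.ofReal_add (by positivity) (by positivity)]
    simp only [T, tau_tauInv_mul]
    congr 1; ring
  have hmeas (k : EReal → ℝ≥0∞) (hk : Measurable k) (u v : EReal → ℝ≥0∞) (hu : Measurable u)
      (hv : Measurable v) : Measurable fun p : EReal × EReal =>
      k (T p.1 p.2) * (ENNReal.ofReal (1 / 2) * (u p.1 * v p.2)) := by
    have := hk.comp hT
    fun_prop
  have hexpand (k : EReal → ℝ≥0∞) (hk : Measurable k) :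
      ∫⁻ a, k a * ENNReal.ofReal (1 - tau a) ∂(checkOp x y)
      = (∫⁻ b, ∫⁻ a, k (T a b) * (ENNReal.ofReal (1 / 2) *
          (ENNReal.ofReal (1 - tau a) * ENNReal.ofReal (1 + tau b))) ∂x ∂y)
        + ∫⁻ a, ∫⁻ b, k (T a b) * (ENNReal.ofReal (1 / 2) *
          (ENNReal.ofReal (1 + tau a) * ENNReal.ofReal (1 - tau b))) ∂y ∂x := by
    have hkw : Measurable fun a => k a * ENNReal.ofReal (1 - tau a) := hk.mul hw
    rw [checkOp, lintegral_map hkw measurable_tauInv_mul]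
    change ∫⁻ p : EReal × EReal, k (T p.1 p.2) * ENNReal.ofReal (1 - tau (T p.1 p.2)) ∂_ = _
    simp only [hsplit, mul_add]
    rw [lintegral_add_left (hmeas k hk _ _ hw hw'),
      lintegral_prod_symm _ (hmeas k hk _ _ hw hw').aemeasurable,
      lintegral_prod _ (hmeas k hk _ _ hw' hw).aemeasurable]
  rw [hexpand (fun a => g (-a)) (hg.comp measurable_neg), hexpand g hg]
  congr 1
  · refine lintegral_congr fun b => ?_
    have := hx.2.lintegral_neg_mul
      (g := fun a => g (T a b) * (ENNReal.ofReal (1 / 2) * ENNReal.ofReal (1 + tau b)))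
      ((hg.comp (hT.comp measurable_prodMk_right)).mul_const _)
    calc _ = _ := lintegral_congr fun a => by rw [← hT1]; ring
      _ = _ := this
      _ = _ := lintegral_congr fun a => by ring
  · refine lintegral_congr fun a => ?_
    have := hy.2.lintegral_neg_mul
      (g := fun b => g (T a b) * (ENNReal.ofReal (1 / 2) * ENNReal.ofReal (1 + tau a)))
      ((hg.comp (hT.comp measurable_prodMk_left)).mul_const _)
    calc _ = _ := lintegral_congr fun b => by rw [← hT2]; ring
      _ = _ := this
      _ = _ := lintegral_congr fun b => by ring

/-- Reflect the two variables in turn, each time gaining an exponential factor; the factors combine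
to e^{-(a+b)}. Almost surely neither variable is -∞, so no sum is degenerate. -/
lemma varOp_mem {x y : Measure EReal} (hx : x ∈ symProb) (hy : y ∈ symProb) :
    varOp x y ∈ symProb := by
  have := hx.1
  have := hy.1
  refine ⟨inferInstance, fun E hE hbot => ?_⟩
  have hadd : Measurable fun p : EReal × EReal => p.1 + p.2 := measurable_fst.add measurable_snd
  have hexp : Measurable fun a : EReal => EReal.exp (-a) :=
    EReal.measurable_exp.comp measurable_neg
  have hg : Measurable (E.indicator (1 : EReal → ℝ≥0∞)) := measurable_one.indicator hE
  have hg0 : E.indicator (1 : EReal → ℝ≥0∞) ⊥ = 0 := Set.indicator_of_notMem hbot _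
  set g := E.indicator (1 : EReal → ℝ≥0∞)
  have hL : varOp x y ((fun a => -a) ⁻¹' E) = ∫⁻ a, g (-a) ∂(varOp x y) := by
    rw [← lintegral_indicator_one (measurable_neg hE)]
    rfl
  have hR : ∫⁻ a in E, EReal.exp (-a) ∂(varOp x y)
      = ∫⁻ a, g a * EReal.exp (-a) ∂(varOp x y) := by
    rw [← lintegral_indicator hE]
    refine lintegral_congr fun a => ?_
    by_cases h : a ∈ E <;> simp [g, h]
  have hae : ∀ᵐ b ∂y, b ≠ ⊥ := hy.2.ae_ne_bot
  have hgn : Measurable fun a => g (-a) := hg.comp measurable_neg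
  have hge : Measurable fun a => g a * EReal.exp (-a) := hg.mul hexp
  rw [hL, hR, varOp, lintegral_map hgn hadd, lintegral_map hge hadd,
    lintegral_prod_symm (fun p : EReal × EReal => g (-(p.1 + p.2)))
      (hgn.comp hadd).aemeasurable]
  calc ∫⁻ b, ∫⁻ a, g (-(a + b)) ∂x ∂y = ∫⁻ b, ∫⁻ a, g (-a + -b) ∂x ∂y := by
        refine lintegral_congr_ae ?_
        filter_upwards [hae] with b hb
        refine lintegral_congr_ae ?_
        filter_upwards [hx.2.ae_ne_bot] with a ha
        rw [EReal.neg_add (Or.inl ha) (Or.inr hb), sub_eq_add_neg]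
    _ = ∫⁻ b, ∫⁻ a, g (a + -b) * EReal.exp (-a) ∂x ∂y := by
        refine lintegral_congr fun b => ?_
        exact hx.2.lintegral_neg (g := fun a => g (a + -b))
          (hg.comp (measurable_id.add_const _)) (by simp [hg0])
    _ = ∫⁻ a, ∫⁻ b, g (a + -b) * EReal.exp (-a) ∂y ∂x := by
        rw [lintegral_lintegral_swap]
        refine Measurable.aemeasurable ?_
        have : Measurable fun p : EReal × EReal => g (p.2 + -p.1) :=
          hg.comp (measurable_snd.add measurable_fst.neg)
        exact this.mul (hexp.comp measurable_snd)
    _ = ∫⁻ a, ∫⁻ b, g (a + b) * EReal.exp (-a) * EReal.exp (-b) ∂y ∂x := by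
        refine lintegral_congr fun a => ?_
        exact hy.2.lintegral_neg (g := fun b => g (a + b) * EReal.exp (-a))
          ((hg.comp (measurable_id.const_add _)).mul_const _) (by simp [hg0])
    _ = ∫⁻ a, ∫⁻ b, g (a + b) * EReal.exp (-(a + b)) ∂y ∂x := by
        refine lintegral_congr_ae ?_
        filter_upwards [hx.2.ae_ne_bot] with a ha
        refine lintegral_congr_ae ?_
        filter_upwards [hae] with b hb
        rw [EReal.neg_add (Or.inl ha) (Or.inr hb), sub_eq_add_neg, EReal.exp_add, mul_assoc]
    _ = _ := by
        exact (lintegral_prod (fun p : EReal × EReal => g (p.1 + p.2) * EReal.exp (-(p.1 + p.2)))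
          (hge.comp hadd).aemeasurable).symm

lemma varPow_mem {x : Measure EReal} (hx : x ∈ symProb) : ∀ n, varPow x n ∈ symProb
  | 0 => deltaZero_mem
  | n + 1 => varOp_mem (varPow_mem hx n) hx

lemma checkPow_mem {x : Measure EReal} (hx : x ∈ symProb) : ∀ n, checkPow x n ∈ symProb
  | 0 => deltaInf_mem
  | n + 1 => checkOp_mem (checkPow_mem hx n) hx

lemma sum_smul_mem {ι : Type*} {s : Finset ι} {w : ι → ℝ≥0∞} {x : ι → Measure EReal}
    (hw : ∑ i ∈ s, w i = 1) (hx : ∀ i ∈ s, x i ∈ symProb) :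
    ∑ i ∈ s, w i • x i ∈ symProb := by
  refine ⟨⟨?_⟩, fun E hE hbot => ?_⟩
  · rw [Measure.finsetSum_apply, ← hw]
    refine Finset.sum_congr rfl fun i hi => ?_
    have := (hx i hi).1
    simp
  · rw [← lintegral_indicator hE, lintegral_finsetSum_measure, Measure.finsetSum_apply]
    refine Finset.sum_congr rfl fun i hi => ?_
    rw [lintegral_smul_measure, lintegral_indicator hE, ← (hx i hi).2 E hE hbot]
    rfl

lemma sum_ofReal_coeff {p : ℝ[X]} (hp : ∀ n, 0 ≤ p.coeff n) (h1 : p.eval 1 = 1) :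
    ∑ n ∈ Finset.range (p.natDegree + 1), ENNReal.ofReal (p.coeff n) = 1 := by
  rw [← ENNReal.ofReal_sum_of_nonneg fun n _ => hp n]
  rw [Polynomial.eval_eq_sum_range] at h1
  simp only [one_pow, mul_one] at h1
  rw [h1, ENNReal.ofReal_one]

lemma varPoly_mem {p : ℝ[X]} (hp : ∀ n, 0 ≤ p.coeff n) (h1 : p.eval 1 = 1) {x : Measure EReal}
    (hx : x ∈ symProb) : varPoly p x ∈ symProb :=
  sum_smul_mem (sum_ofReal_coeff hp h1) fun n _ => varPow_mem hx n

lemma checkPoly_mem {p : ℝ[X]} (hp : ∀ n, 0 ≤ p.coeff n) (h1 : p.eval 1 = 1) {x : Measure EReal}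
    (hx : x ∈ symProb) : checkPoly p x ∈ symProb :=
  sum_smul_mem (sum_ofReal_coeff hp h1) fun n _ => checkPow_mem hx n

lemma sum_inv_natCast {w : ℕ} (hw : 1 ≤ w) : ∑ _i ∈ Finset.range w, (w : ℝ≥0∞)⁻¹ = 1 := by
  rw [Finset.sum_const, Finset.card_range, nsmul_eq_mul]
  exact ENNReal.mul_inv_cancel (by simp; omega) (by simp)

lemma average_mem {w : ℕ} (hw : 1 ≤ w) {x : ℕ → Measure EReal} (hx : ∀ i, x i ∈ symProb) :
    (w : ℝ≥0∞)⁻¹ • ∑ i ∈ Finset.range w, x i ∈ symProb := by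
  rw [Finset.smul_sum]
  exact sum_smul_mem (sum_inv_natCast hw) fun i _ => hx i

/-! ### Weighted sums of moment sequences -/

/-- The entropy of the binary symmetric channel with crossover probability `(1 - t) / 2`. -/
noncomputable def bscEntropy (t : ℝ) : ℝ := Real.binEntropy ((1 + t) / 2) / Real.log 2

lemma gammaCoeff_succ_nonneg (k : ℕ) : 0 ≤ gammaCoeff (k + 1) := by
  have := Real.log_pos one_lt_two
  have h : (0 : ℝ) ≤ 2 * ((k + 1 : ℕ) : ℝ) - 1 := by push_cast; linarith [k.cast_nonneg (α := ℝ)]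
  unfold gammaCoeff
  positivity

lemma gammaCoeff_succ_pos (k : ℕ) : 0 < gammaCoeff (k + 1) := by
  have := Real.log_pos one_lt_two
  have h : (0 : ℝ) < 2 * ((k + 1 : ℕ) : ℝ) - 1 := by push_cast; linarith [k.cast_nonneg (α := ℝ)]
  unfold gammaCoeff
  positivity

lemma continuous_bscEntropy : Continuous bscEntropy := by
  unfold bscEntropy
  fun_prop

lemma bscEntropy_nonneg {t : ℝ} (ht : |t| ≤ 1) : 0 ≤ bscEntropy t := by
  rw [abs_le] at ht
  exact div_nonneg (Real.binEntropy_nonneg (by linarith) (by linarith))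
    (Real.log_pos one_lt_two).le

lemma bscEntropy_le_one (t : ℝ) : bscEntropy t ≤ 1 :=
  (div_le_one (Real.log_pos one_lt_two)).2 Real.binEntropy_le_log_two

lemma bscEntropy_eq {t : ℝ} (ht : |t| < 1) : 1 - bscEntropy t
    = (2 * Real.log 2)⁻¹ * ((1 + t) * Real.log (1 + t) + (1 - t) * Real.log (1 - t)) := by
  rw [abs_lt] at ht
  have h2 := Real.log_pos one_lt_two
  have e : 1 - (1 + t) / 2 = (1 - t) / 2 := by ring
  rw [bscEntropy, Real.binEntropy, e, Real.log_inv, Real.log_inv,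
    Real.log_div (by linarith) two_ne_zero, Real.log_div (by linarith) two_ne_zero]
  field_simp
  ring

/-- Combines the series of log(1-t²) and of log(1+t) - log(1-t) through 1/(2k(2k-1)) = 1/(2k-1) -
1/(2k). -/
lemma hasSum_bscEntropy_of_abs_lt_one {t : ℝ} (ht : |t| < 1) :
    HasSum (fun k : ℕ => gammaCoeff (k + 1) * t ^ (2 * (k + 1))) (1 - bscEntropy t) := by
  have hsq : |t ^ 2| < 1 := by
    rw [abs_pow]
    exact pow_lt_one₀ (abs_nonneg t) ht two_ne_zero
  have h1 := (Real.hasSum_pow_div_log_of_abs_lt_one hsq).mul_left (-(2 * Real.log 2)⁻¹)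
  have h2 := (Real.hasSum_log_sub_log_of_abs_lt_one ht).mul_left ((2 * Real.log 2)⁻¹ * t)
  have hl := Real.log_pos one_lt_two
  have ht' := abs_lt.1 ht
  convert! h1.add h2 using 1
  · funext k
    have h3 : (2 * (k : ℝ) + 1) ≠ 0 := by positivity
    have h4 : (2 * ((k : ℝ) + 1) - 1) = 2 * k + 1 := by ring
    simp only [gammaCoeff]
    push_cast
    rw [h4]
    field_simp
    ring
  · rw [bscEntropy_eq ht, show 1 - t ^ 2 = (1 + t) * (1 - t) by ring,
      Real.log_mul (by linarith) (by linarith)]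
    ring

lemma bscEntropy_one : bscEntropy 1 = 0 := by
  simp [bscEntropy]

/-- Abel's argument at the endpoint: let t ↑ 1 in the expansion. Non-negativity of the entropy
bounds the partial sums by 1, and its continuity with value 0 at t = 1 gives the reverse inequality.
-/
lemma hasSum_gammaCoeff : HasSum (fun k : ℕ => gammaCoeff (k + 1)) 1 := by
  have hlt : ∀ᶠ t : ℝ in 𝓝[<] 1, |t| < 1 := by
    filter_upwards [Ioo_mem_nhdsLT (show (0 : ℝ) < 1 by norm_num)] with t ht
    rw [abs_of_pos ht.1]; exact ht.2
  have hpart : ∀ n, ∑ k ∈ Finset.range n, gammaCoeff (k + 1) ≤ 1 := by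
    intro n
    have hc : Tendsto (fun t : ℝ => ∑ k ∈ Finset.range n, gammaCoeff (k + 1) * t ^ (2 * (k + 1)))
        (𝓝[<] 1) (𝓝 (∑ k ∈ Finset.range n, gammaCoeff (k + 1) * 1 ^ (2 * (k + 1)))) :=
      (Continuous.tendsto (by fun_prop) 1).mono_left nhdsWithin_le_nhds
    simp only [one_pow, mul_one] at hc
    refine le_of_tendsto hc ?_
    filter_upwards [hlt] with t ht
    have := hasSum_bscEntropy_of_abs_lt_one ht
    refine (sum_le_hasSum _ (fun k _ => ?_) this).trans ?_
    · exact mul_nonneg (gammaCoeff_succ_nonneg k) (by rw [pow_mul]; positivity)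
    · linarith [bscEntropy_nonneg ht.le]
  have hsum : Summable fun k : ℕ => gammaCoeff (k + 1) :=
    summable_of_sum_range_le gammaCoeff_succ_nonneg hpart
  have hle : ∑' k : ℕ, gammaCoeff (k + 1) ≤ 1 := hsum.tsum_le_of_sum_range_le hpart
  have hge : 1 ≤ ∑' k : ℕ, gammaCoeff (k + 1) := by
    have hc : Tendsto (fun t : ℝ => 1 - bscEntropy t) (𝓝[<] 1) (𝓝 (1 - bscEntropy 1)) :=
      (Continuous.tendsto (continuous_const.sub continuous_bscEntropy) 1).mono_left
        nhdsWithin_le_nhds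
    rw [bscEntropy_one, sub_zero] at hc
    refine le_of_tendsto hc ?_
    filter_upwards [hlt] with t ht
    refine hasSum_le (fun k => ?_) (hasSum_bscEntropy_of_abs_lt_one ht) hsum.hasSum
    refine mul_le_of_le_one_right (gammaCoeff_succ_nonneg k) ?_
    rw [pow_mul]
    exact pow_le_one₀ (sq_nonneg t) ((sq_le_one_iff_abs_le_one t).2 ht.le)
  rw [← le_antisymm hle hge]
  exact hsum.hasSum

lemma hasSum_bscEntropy {t : ℝ} (ht : |t| ≤ 1) :
    HasSum (fun k : ℕ => gammaCoeff (k + 1) * t ^ (2 * (k + 1))) (1 - bscEntropy t) := by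
  rcases ht.lt_or_eq with h | h
  · exact hasSum_bscEntropy_of_abs_lt_one h
  · have h2 : t ^ 2 = 1 := by rw [← sq_abs, h, one_pow]
    have h3 : bscEntropy t = 0 := by
      rcases (abs_eq zero_le_one).1 h with h | h
      · rw [h, bscEntropy_one]
      · simp [h, bscEntropy]
    simp only [pow_mul, h2, one_pow, mul_one, h3, sub_zero]
    exact hasSum_gammaCoeff

/-- The sum of a sequence `a` against the weights `γ₁, γ₂, …`. -/
noncomputable def gammaSum (a : ℕ → ℝ) : ℝ := ∑' k, gammaCoeff (k + 1) * a k

/-- Boundedness of a real sequence. -/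
def BddSeq (a : ℕ → ℝ) : Prop := ∃ C, ∀ k, |a k| ≤ C

namespace BddSeq

variable {a b : ℕ → ℝ}

lemma const (C : ℝ) : BddSeq fun _ => C := ⟨|C|, fun _ => le_rfl⟩

lemma of_mem_Icc (h : ∀ k, a k ∈ Set.Icc (0 : ℝ) 1) : BddSeq a :=
  ⟨1, fun k => abs_le.2 ⟨by linarith [(h k).1], (h k).2⟩⟩

lemma add (ha : BddSeq a) (hb : BddSeq b) : BddSeq fun k => a k + b k := by
  obtain ⟨C, hC⟩ := ha
  obtain ⟨D, hD⟩ := hb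
  exact ⟨C + D, fun k => (abs_add_le _ _).trans (add_le_add (hC k) (hD k))⟩

lemma neg (ha : BddSeq a) : BddSeq fun k => -a k := by
  obtain ⟨C, hC⟩ := ha
  exact ⟨C, fun k => by rw [abs_neg]; exact hC k⟩

lemma sub (ha : BddSeq a) (hb : BddSeq b) : BddSeq fun k => a k - b k := by
  simpa only [sub_eq_add_neg] using ha.add hb.neg

lemma mul (ha : BddSeq a) (hb : BddSeq b) : BddSeq fun k => a k * b k := by
  obtain ⟨C, hC⟩ := ha
  obtain ⟨D, hD⟩ := hb
  refine ⟨C * D, fun k => ?_⟩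
  rw [abs_mul]
  exact mul_le_mul (hC k) (hD k) (abs_nonneg _) ((abs_nonneg _).trans (hC k))

lemma summable (ha : BddSeq a) : Summable fun k => gammaCoeff (k + 1) * a k := by
  obtain ⟨C, hC⟩ := ha
  refine Summable.of_norm_bounded (hasSum_gammaCoeff.summable.mul_right C) fun k => ?_
  rw [Real.norm_eq_abs, abs_mul, abs_of_nonneg (gammaCoeff_succ_nonneg k)]
  exact mul_le_mul_of_nonneg_left (hC k) (gammaCoeff_succ_nonneg k)

end BddSeq

section gammaSum

variable {a b : ℕ → ℝ}

lemma gammaSum_const (C : ℝ) : gammaSum (fun _ => C) = C := by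
  rw [gammaSum, tsum_mul_right, hasSum_gammaCoeff.tsum_eq, one_mul]

lemma gammaSum_add (ha : BddSeq a) (hb : BddSeq b) :
    gammaSum (fun k => a k + b k) = gammaSum a + gammaSum b := by
  simp only [gammaSum, mul_add]
  exact ha.summable.tsum_add hb.summable

lemma gammaSum_sub (ha : BddSeq a) (hb : BddSeq b) :
    gammaSum (fun k => a k - b k) = gammaSum a - gammaSum b := by
  simp only [gammaSum, mul_sub]
  exact ha.summable.tsum_sub hb.summable

lemma gammaSum_const_mul (C : ℝ) : gammaSum (fun k => C * a k) = C * gammaSum a := by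
  rw [gammaSum, gammaSum, ← tsum_mul_left]
  exact tsum_congr fun k => by ring

lemma gammaSum_sum {ι : Type*} {s : Finset ι} {f : ι → ℕ → ℝ} (hf : ∀ i ∈ s, BddSeq (f i)) :
    gammaSum (fun k => ∑ i ∈ s, f i k) = ∑ i ∈ s, gammaSum (f i) := by
  simp only [gammaSum, Finset.mul_sum]
  exact Summable.tsum_finsetSum fun i hi => (hf i hi).summable

lemma gammaSum_mono (ha : BddSeq a) (hb : BddSeq b) (h : ∀ k, a k ≤ b k) :
    gammaSum a ≤ gammaSum b :=
  ha.summable.tsum_le_tsum (fun k => mul_le_mul_of_nonneg_left (h k) (gammaCoeff_succ_nonneg k))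
    hb.summable

lemma gammaSum_nonneg (h : ∀ k, 0 ≤ a k) : 0 ≤ gammaSum a :=
  tsum_nonneg fun k => mul_nonneg (gammaCoeff_succ_nonneg k) (h k)

end gammaSum

/-! ### Moments and entropy -/

/-- The sequence `M₁(x), M₂(x), …` of moments. -/
noncomputable def momentSeq (x : Measure EReal) (k : ℕ) : ℝ := moment (k + 1) x

lemma measurable_tau_pow (n : ℕ) : Measurable fun a => tau a ^ n := measurable_tau.pow_const n

lemma integrable_of_bound {x : Measure EReal} [IsFiniteMeasure x] {φ : EReal → ℝ}
    (hφ : Measurable φ) {C : ℝ} (hC : ∀ a, |φ a| ≤ C) : Integrable φ x :=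
  Integrable.of_bound hφ.aestronglyMeasurable C (ae_of_all _ hC)

lemma tau_pow_even_mem (k : ℕ) (a : EReal) : tau a ^ (2 * k) ∈ Set.Icc (0 : ℝ) 1 := by
  rw [pow_mul]
  exact ⟨by positivity,
    pow_le_one₀ (sq_nonneg _) ((sq_le_one_iff_abs_le_one _).2 (abs_tau_le_one a))⟩

lemma integrable_tau_pow (x : Measure EReal) [IsFiniteMeasure x] (k : ℕ) :
    Integrable (fun a => tau a ^ (2 * k)) x :=
  integrable_of_bound (measurable_tau_pow _) (C := 1) fun a => by
    rw [abs_of_nonneg (tau_pow_even_mem k a).1]; exact (tau_pow_even_mem k a).2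

lemma moment_mem (x : Measure EReal) [IsProbabilityMeasure x] (k : ℕ) :
    moment k x ∈ Set.Icc (0 : ℝ) 1 := by
  refine ⟨integral_nonneg fun a => (tau_pow_even_mem k a).1, ?_⟩
  calc moment k x ≤ ∫ _, (1 : ℝ) ∂x :=
        integral_mono (integrable_tau_pow x k) (integrable_const 1) fun a => (tau_pow_even_mem k a).2
    _ = 1 := by simp

lemma momentSeq_mem {x : Measure EReal} (hx : x ∈ symProb) (k : ℕ) :
    momentSeq x k ∈ Set.Icc (0 : ℝ) 1 := by
  have := hx.1
  exact moment_mem x _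

lemma bddSeq_momentSeq {x : Measure EReal} (hx : x ∈ symProb) : BddSeq (momentSeq x) :=
  BddSeq.of_mem_Icc (momentSeq_mem hx)

/-- This is why the generator side of the potential reduces to scalar calculus, one moment at a
time. -/
lemma moment_checkOp (x y : Measure EReal) [IsProbabilityMeasure x] [IsProbabilityMeasure y]
    (k : ℕ) : moment k (checkOp x y) = moment k x * moment k y := by
  rw [moment, checkOp, integral_map measurable_tauInv_mul.aemeasurable
    (measurable_tau_pow _).aestronglyMeasurable]
  simp only [tau_tauInv_mul, mul_pow]
  exact integral_prod_mul (fun a => tau a ^ (2 * k)) fun a => tau a ^ (2 * k)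

lemma momentSeq_checkOp {x y : Measure EReal} (hx : x ∈ symProb) (hy : y ∈ symProb) (k : ℕ) :
    momentSeq (checkOp x y) k = momentSeq x k * momentSeq y k := by
  have := hx.1
  have := hy.1
  exact moment_checkOp x y _

/-- The integrand `log₂ (1 + e^{-α})` of the entropy functional. -/
noncomputable def llrEntropy (a : EReal) : ℝ := Real.logb 2 (1 + (EReal.exp (-a)).toReal)

lemma llrEntropy_nonneg (a : EReal) : 0 ≤ llrEntropy a :=
  Real.logb_nonneg one_lt_two (by linarith [ENNReal.toReal_nonneg (a := EReal.exp (-a))])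

lemma measurable_llrEntropy : Measurable llrEntropy := by
  unfold llrEntropy Real.logb
  have : Measurable fun a : EReal => EReal.exp (-a) := EReal.measurable_exp.comp measurable_neg
  fun_prop

lemma llrEntropy_eq {a : EReal} (ha : a ≠ ⊥) :
    llrEntropy a = (Real.log 2 - Real.log (1 + tau a)) / Real.log 2 := by
  have := neg_one_lt_tau ha
  rw [llrEntropy, one_add_exp_neg ha, Real.logb, Real.log_div two_ne_zero (by linarith)]

/-- Given |α|, the weights (1 ± τ)/2 are the probabilities of the two signs: a symmetric law is a
mixture of binary symmetric channels, and this is the entropy of one component. -/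
lemma llrEntropy_average (a : EReal) :
    (1 + tau a) / 2 * llrEntropy a + (1 - tau a) / 2 * llrEntropy (-a) = bscEntropy (tau a) := by
  have h2 := Real.log_pos one_lt_two
  have key (b : EReal) : (1 + tau b) / 2 * llrEntropy b
      = (1 + tau b) / 2 * Real.log ((1 + tau b) / 2)⁻¹ / Real.log 2 := by
    by_cases hb : b = ⊥
    · simp [hb]
    · have := neg_one_lt_tau hb
      rw [llrEntropy_eq hb, Real.log_inv, Real.log_div (by linarith) two_ne_zero]
      ring
  have k1 := key (-a)
  rw [tau_neg, ← sub_eq_add_neg] at k1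
  rw [key, k1, bscEntropy, Real.binEntropy, show 1 - (1 + tau a) / 2 = (1 - tau a) / 2 by ring]
  ring

/-- The integrand log₂(1+e^{-α}) is unbounded near -∞. Working in [0,∞] needs no integrability, and
the bounded right side then provides it. -/
lemma lintegral_llrEntropy {x : Measure EReal} (hx : x ∈ symProb) :
    ∫⁻ a, ENNReal.ofReal (llrEntropy a) ∂x = ∫⁻ a, ENNReal.ofReal (bscEntropy (tau a)) ∂x := by
  rw [hx.2.lintegral_eq measurable_llrEntropy.ennreal_ofReal]
  refine lintegral_congr fun a => ?_
  have h1 : 0 ≤ (1 + tau a) / 2 := by linarith [neg_one_le_tau a]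
  have h2 : 0 ≤ (1 - tau a) / 2 := by linarith [tau_le_one a]
  rw [← ENNReal.ofReal_mul h1, ← ENNReal.ofReal_mul h2,
    ← ENNReal.ofReal_add (mul_nonneg h1 (llrEntropy_nonneg _))
      (mul_nonneg h2 (llrEntropy_nonneg _)), llrEntropy_average]

lemma integrable_llrEntropy {x : Measure EReal} (hx : x ∈ symProb) : Integrable llrEntropy x := by
  have := hx.1
  refine ⟨measurable_llrEntropy.aestronglyMeasurable, ?_⟩
  rw [hasFiniteIntegral_iff_ofReal (ae_of_all _ llrEntropy_nonneg), lintegral_llrEntropy hx]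
  calc ∫⁻ a, ENNReal.ofReal (bscEntropy (tau a)) ∂x ≤ ∫⁻ _, 1 ∂x :=
        lintegral_mono fun a => ENNReal.ofReal_le_one.2 (bscEntropy_le_one _)
    _ < ⊤ := by simp

lemma entropy_eq_integral_bscEntropy {x : Measure EReal} (hx : x ∈ symProb) :
    entropy x = ∫ a, bscEntropy (tau a) ∂x := by
  change ∫ a, llrEntropy a ∂x = _
  rw [integral_eq_lintegral_of_nonneg_ae (ae_of_all _ llrEntropy_nonneg)
      measurable_llrEntropy.aestronglyMeasurable,
    integral_eq_lintegral_of_nonneg_ae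
      (ae_of_all _ fun a => bscEntropy_nonneg (abs_tau_le_one a))
      (continuous_bscEntropy.measurable.comp measurable_tau).aestronglyMeasurable,
    lintegral_llrEntropy hx]

/-- Integrating the series of the binary entropy termwise makes entropy affine in the moment
sequence. Hence for ordered measures entropy differences are sums of non-negative moment
differences. -/
lemma entropy_eq {x : Measure EReal} (hx : x ∈ symProb) :
    entropy x = 1 - gammaSum (momentSeq x) := by
  have := hx.1
  have hF (k : ℕ) : Integrable (fun a => gammaCoeff (k + 1) * tau a ^ (2 * (k + 1))) x :=
    (integrable_tau_pow x _).const_mul _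
  have hmom (k : ℕ) : ∫ a, gammaCoeff (k + 1) * tau a ^ (2 * (k + 1)) ∂x
      = gammaCoeff (k + 1) * momentSeq x k := integral_const_mul _ _
  have hsum : Summable fun k => ∫ a, ‖gammaCoeff (k + 1) * tau a ^ (2 * (k + 1))‖ ∂x := by
    refine (bddSeq_momentSeq hx).summable.congr fun k => ?_
    rw [← hmom]
    refine integral_congr_ae (ae_of_all _ fun a => ?_)
    exact (Real.norm_of_nonneg
      (mul_nonneg (gammaCoeff_succ_nonneg k) (tau_pow_even_mem _ a).1)).symm
  have h := integral_tsum_of_summable_integral_norm hF hsum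
  have hint : Integrable (fun a => bscEntropy (tau a)) x :=
    integrable_of_bound (continuous_bscEntropy.measurable.comp measurable_tau) (C := 1) fun a => by
      rw [abs_of_nonneg (bscEntropy_nonneg (abs_tau_le_one a))]; exact bscEntropy_le_one _
  simp only [hmom, (hasSum_bscEntropy (abs_tau_le_one _)).tsum_eq] at h
  rw [integral_sub (integrable_const 1) hint, ← entropy_eq_integral_bscEntropy hx] at h
  simp only [integral_const, probReal_univ, smul_eq_mul, mul_one] at h
  rw [gammaSum, h]
  ring

/-- The logarithm of (1+τ(a+b))(1+τ(a)τ(b)) = (1+τ(a))(1+τ(b)), which is the addition formula for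
tanh. -/
lemma llrEntropy_add {a b : EReal} (ha : a ≠ ⊥) (hb : b ≠ ⊥) :
    llrEntropy (a + b) + llrEntropy (tauInv (tau a * tau b)) = llrEntropy a + llrEntropy b := by
  have h1 := neg_one_lt_tau ha
  have h2 := neg_one_lt_tau hb
  have h3 := tau_le_one a
  have h4 := tau_le_one b
  have h5 : 0 < 1 + tau a * tau b := by
    nlinarith [mul_pos (show 0 < 1 + tau a by linarith) (show 0 < 1 + tau b by linarith)]
  have hne : tauInv (tau a * tau b) ≠ ⊥ := by
    intro h
    have := tau_tauInv_mul a b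
    rw [h, tau_bot] at this
    linarith
  have hne2 : a + b ≠ ⊥ := by simp [EReal.add_eq_bot_iff, ha, hb]
  have h6 : 1 + tau (a + b) = (1 + tau a) * (1 + tau b) / (1 + tau a * tau b) := by
    rw [tau_add ha hb]; field_simp; ring
  rw [llrEntropy_eq hne2, llrEntropy_eq hne, llrEntropy_eq ha, llrEntropy_eq hb, tau_tauInv_mul, h6,
    Real.log_div (mul_ne_zero (by linarith) (by linarith)) h5.ne',
    Real.log_mul (by linarith) (by linarith)]
  ring

/-- The duality rule for the entropy. -/
lemma entropy_varOp_add_entropy_checkOp {x y : Measure EReal} (hx : x ∈ symProb)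
    (hy : y ∈ symProb) :
    entropy (varOp x y) + entropy (checkOp x y) = entropy x + entropy y := by
  have := hx.1
  have := hy.1
  have hadd : Measurable fun p : EReal × EReal => p.1 + p.2 := measurable_fst.add measurable_snd
  have hm := measurable_llrEntropy
  have i1 := integrable_llrEntropy (varOp_mem hx hy)
  have i2 := integrable_llrEntropy (checkOp_mem hx hy)
  rw [varOp, integrable_map_measure hm.aestronglyMeasurable hadd.aemeasurable] at i1
  rw [checkOp, integrable_map_measure hm.aestronglyMeasurable
    measurable_tauInv_mul.aemeasurable] at i2
  change ∫ a, llrEntropy a ∂_ + ∫ a, llrEntropy a ∂_ = ∫ a, llrEntropy a ∂_ + ∫ a, llrEntropy a ∂_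
  rw [varOp, checkOp, integral_map hadd.aemeasurable hm.aestronglyMeasurable,
    integral_map measurable_tauInv_mul.aemeasurable hm.aestronglyMeasurable]
  have e1 : ∫ a, llrEntropy a ∂x = ∫ p, llrEntropy p.1 ∂(x.prod y) := by
    rw [integral_fun_fst]; simp
  have e2 : ∫ a, llrEntropy a ∂y = ∫ p, llrEntropy p.2 ∂(x.prod y) := by
    rw [integral_fun_snd]; simp
  simp only [Function.comp_def] at i1 i2
  rw [e1, e2, ← integral_add ((integrable_llrEntropy hx).comp_fst y)
    ((integrable_llrEntropy hy).comp_snd x), ← integral_add i1 i2]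
  refine integral_congr_ae ?_
  have a1 : ∀ᵐ p ∂(x.prod y), p.1 ≠ ⊥ := Measure.quasiMeasurePreserving_fst.ae hx.2.ae_ne_bot
  have a2 : ∀ᵐ p ∂(x.prod y), p.2 ≠ ⊥ := Measure.quasiMeasurePreserving_snd.ae hy.2.ae_ne_bot
  filter_upwards [a1, a2] with p h1 h2
  exact llrEntropy_add h1 h2

/-- Duality exchanges ⊛ for ⊠, so the interaction of the two factors is bilinear in their moments.
All estimates on variable-node entropies start here. -/
lemma entropy_varOp {x y : Measure EReal} (hx : x ∈ symProb) (hy : y ∈ symProb) :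
    entropy (varOp x y)
      = entropy x + entropy y - 1 + gammaSum (fun k => momentSeq x k * momentSeq y k) := by
  have h := entropy_varOp_add_entropy_checkOp hx hy
  rw [entropy_eq (checkOp_mem hx hy)] at h
  simp only [funext (momentSeq_checkOp hx hy)] at h
  linarith

lemma integral_sum_smul {ι : Type*} {s : Finset ι} {w : ι → ℝ≥0∞} (hw : ∀ i ∈ s, w i ≠ ⊤)
    {x : ι → Measure EReal} {φ : EReal → ℝ} (hφ : ∀ i ∈ s, Integrable φ (x i)) :
    ∫ a, φ a ∂(∑ i ∈ s, w i • x i) = ∑ i ∈ s, (w i).toReal * ∫ a, φ a ∂(x i) := by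
  rw [integral_finsetSum_measure fun i hi => (hφ i hi).smul_measure (hw i hi)]
  simp [integral_smul_measure]

lemma integral_average {w : ℕ} (hw : 1 ≤ w) {x : ℕ → Measure EReal} {φ : EReal → ℝ}
    (hφ : ∀ i, Integrable φ (x i)) :
    ∫ a, φ a ∂((w : ℝ≥0∞)⁻¹ • ∑ i ∈ Finset.range w, x i)
      = (w : ℝ)⁻¹ * ∑ i ∈ Finset.range w, ∫ a, φ a ∂(x i) := by
  rw [Finset.smul_sum, integral_sum_smul (fun _ _ => by simp; omega) fun i _ => hφ i,
    Finset.mul_sum]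
  simp

lemma momentSeq_average {w : ℕ} (hw : 1 ≤ w) {x : ℕ → Measure EReal} (hx : ∀ i, x i ∈ symProb)
    (k : ℕ) : momentSeq ((w : ℝ≥0∞)⁻¹ • ∑ i ∈ Finset.range w, x i) k
      = (w : ℝ)⁻¹ * ∑ i ∈ Finset.range w, momentSeq (x i) k :=
  integral_average hw fun i => by
    have := (hx i).1
    exact integrable_tau_pow _ _

lemma integral_varPoly {p : ℝ[X]} (hp : ∀ n, 0 ≤ p.coeff n) {x : Measure EReal}
    (hx : x ∈ symProb) {φ : EReal → ℝ} (hφ : ∀ y ∈ symProb, Integrable φ y) :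
    ∫ a, φ a ∂(varPoly p x)
      = ∑ n ∈ Finset.range (p.natDegree + 1), p.coeff n * ∫ a, φ a ∂(varPow x n) := by
  rw [varPoly, integral_sum_smul (by simp) fun n _ => hφ _ (varPow_mem hx n)]
  simp [ENNReal.toReal_ofReal (hp _)]

lemma entropy_varPoly {p : ℝ[X]} (hp : ∀ n, 0 ≤ p.coeff n) {x : Measure EReal}
    (hx : x ∈ symProb) : entropy (varPoly p x)
    = ∑ n ∈ Finset.range (p.natDegree + 1), p.coeff n * entropy (varPow x n) :=
  integral_varPoly hp hx fun _ hy => integrable_llrEntropy hy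

lemma momentSeq_varPoly {p : ℝ[X]} (hp : ∀ n, 0 ≤ p.coeff n) {x : Measure EReal}
    (hx : x ∈ symProb) (k : ℕ) : momentSeq (varPoly p x) k
    = ∑ n ∈ Finset.range (p.natDegree + 1), p.coeff n * momentSeq (varPow x n) k :=
  integral_varPoly hp hx fun y hy => by
    have := hy.1
    exact integrable_tau_pow _ _

lemma momentSeq_checkPow {x : Measure EReal} (hx : x ∈ symProb) (n k : ℕ) :
    momentSeq (checkPow x n) k = momentSeq x k ^ n := by
  induction n with
  | zero => simp [checkPow, momentSeq, moment, deltaInf]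
  | succ n ih => rw [checkPow, momentSeq_checkOp (checkPow_mem hx n) hx, ih, pow_succ]

lemma momentSeq_checkPoly {p : ℝ[X]} (hp : ∀ n, 0 ≤ p.coeff n) {x : Measure EReal}
    (hx : x ∈ symProb) (k : ℕ) :
    momentSeq (checkPoly p x) k = p.eval (momentSeq x k) := by
  rw [Polynomial.eval_eq_sum_range, momentSeq, moment, checkPoly, integral_sum_smul (by simp)]
  · refine Finset.sum_congr rfl fun n _ => ?_
    rw [ENNReal.toReal_ofReal (hp _), ← momentSeq_checkPow hx]
    rfl
  · intro n _
    have := (checkPow_mem hx n).1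
    exact integrable_tau_pow _ _

/-! ### Degradation -/

lemma clamp_mem (t : ℝ) : max 0 (min 1 t) ∈ Set.Icc (0 : ℝ) 1 :=
  ⟨le_max_left _ _, max_le zero_le_one (min_le_left _ _)⟩

lemma clamp_of_mem {t : ℝ} (ht : t ∈ Set.Icc (0 : ℝ) 1) : max 0 (min 1 t) = t := by
  rw [min_eq_right ht.2, max_eq_right ht.1]

/-- Nothing is known of f outside [0,1]; clamping the argument makes it monotone on the whole line,
hence measurable. -/
lemma measurable_clamp {f : ℝ → ℝ} (hf : AntitoneOn f (Set.Icc 0 1)) :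
    Measurable fun t => f (max 0 (min 1 t)) := by
  refine Antitone.measurable fun s t hst => hf (clamp_mem s) (clamp_mem t) ?_
  exact max_le_max le_rfl (min_le_min le_rfl hst)

lemma measurable_comp_antitoneOn {α : Type*} [MeasurableSpace α] {f : ℝ → ℝ}
    (hf : AntitoneOn f (Set.Icc 0 1)) {u : α → ℝ} (hu : Measurable u)
    (hmem : ∀ a, u a ∈ Set.Icc (0 : ℝ) 1) : Measurable fun a => f (u a) := by
  convert (measurable_clamp hf).comp hu using 2 with a
  simp only [Function.comp_apply, clamp_of_mem (hmem a)]

lemma abs_le_of_antitoneOn {f : ℝ → ℝ} (hf : AntitoneOn f (Set.Icc 0 1)) {t : ℝ}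
    (ht : t ∈ Set.Icc (0 : ℝ) 1) : |f t| ≤ max |f 0| |f 1| := by
  have h0 : f t ≤ f 0 := hf ⟨le_rfl, zero_le_one⟩ ht ht.1
  have h1 : f 1 ≤ f t := hf ht ⟨zero_le_one, le_rfl⟩ ht.2
  rcases le_total 0 (f t) with h | h
  · rw [abs_of_nonneg h]
    exact (h0.trans (le_abs_self _)).trans (le_max_left _ _)
  · rw [abs_of_nonpos h]
    exact ((neg_le_neg h1).trans (neg_le_abs _)).trans (le_max_right _ _)

lemma integrable_comp_antitoneOn {α : Type*} [MeasurableSpace α] {μ : Measure α}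
    [IsFiniteMeasure μ] {f : ℝ → ℝ} (hf : AntitoneOn f (Set.Icc 0 1)) {u : α → ℝ}
    (hu : Measurable u) (hmem : ∀ a, u a ∈ Set.Icc (0 : ℝ) 1) : Integrable (fun a => f (u a)) μ :=
  Integrable.of_bound (measurable_comp_antitoneOn hf hu hmem).aestronglyMeasurable _
    (ae_of_all _ fun a => abs_le_of_antitoneOn hf (hmem a))

lemma integrable_abs_tau {f : ℝ → ℝ} (hf : AntitoneOn f (Set.Icc 0 1)) (x : Measure EReal)
    [IsFiniteMeasure x] : Integrable (fun a => f |tau a|) x :=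
  integrable_comp_antitoneOn hf measurable_tau.abs abs_tau_mem

lemma Degraded.refl (x : Measure EReal) : Degraded x x := fun _ _ _ => le_rfl

lemma Degraded.trans {x y z : Measure EReal} (h1 : Degraded x y) (h2 : Degraded y z) :
    Degraded x z := fun f hf hf' => (h2 f hf hf').trans (h1 f hf hf')

lemma degraded_deltaInf {x : Measure EReal} (hx : x ∈ symProb) : Degraded x deltaInf := by
  intro f _ hf
  have := hx.1
  have h : ∫ _, f 1 ∂x ≤ ∫ a, f |tau a| ∂x :=
    integral_mono (integrable_const _) (integrable_abs_tau hf x) fun a =>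
      hf (abs_tau_mem a) ⟨zero_le_one, le_rfl⟩ (abs_tau_le_one a)
  simpa [deltaInf] using h

lemma deltaZero_degraded {x : Measure EReal} (hx : x ∈ symProb) : Degraded deltaZero x := by
  intro f _ hf
  have := hx.1
  have h : ∫ a, f |tau a| ∂x ≤ ∫ _, f 0 ∂x :=
    integral_mono (integrable_abs_tau hf x) (integrable_const _) fun a =>
      hf ⟨le_rfl, zero_le_one⟩ (abs_tau_mem a) (abs_nonneg _)
  simpa [deltaZero] using h

lemma Degraded.sum_smul {ι : Type*} {s : Finset ι} {w : ι → ℝ≥0∞} (hw : ∀ i ∈ s, w i ≠ ⊤)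
    {x y : ι → Measure EReal} (hx : ∀ i ∈ s, x i ∈ symProb) (hy : ∀ i ∈ s, y i ∈ symProb)
    (h : ∀ i ∈ s, Degraded (x i) (y i)) :
    Degraded (∑ i ∈ s, w i • x i) (∑ i ∈ s, w i • y i) := by
  intro f hf hf'
  rw [integral_sum_smul hw, integral_sum_smul hw]
  · exact Finset.sum_le_sum fun i hi =>
      mul_le_mul_of_nonneg_left (h i hi f hf hf') ENNReal.toReal_nonneg
  · intro i hi
    have := (hx i hi).1
    exact integrable_abs_tau hf' _
  · intro i hi
    have := (hy i hi).1
    exact integrable_abs_tau hf' _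

lemma Degraded.average {w : ℕ} (hw : 1 ≤ w) {x y : ℕ → Measure EReal}
    (hx : ∀ i, x i ∈ symProb) (hy : ∀ i, y i ∈ symProb)
    (h : ∀ i ∈ Finset.range w, Degraded (x i) (y i)) :
    Degraded ((w : ℝ≥0∞)⁻¹ • ∑ i ∈ Finset.range w, x i)
      ((w : ℝ≥0∞)⁻¹ • ∑ i ∈ Finset.range w, y i) := by
  rw [Finset.smul_sum, Finset.smul_sum]
  exact Degraded.sum_smul (fun _ _ => by simp; omega) (fun i _ => hx i) (fun i _ => hy i) h

lemma average_const {w : ℕ} (hw : 1 ≤ w) (x : Measure EReal) :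
    (w : ℝ≥0∞)⁻¹ • ∑ _i ∈ Finset.range w, x = x := by
  rw [Finset.smul_sum, ← Finset.sum_smul, sum_inv_natCast hw, one_smul]

lemma Degraded.momentSeq_le {x y : Measure EReal} (h : Degraded x y) (k : ℕ) : momentSeq x k ≤ momentSeq y k := by
  have hcv : ConvexOn ℝ (Set.Icc 0 1) fun t : ℝ => t ^ (2 * (k + 1)) :=
    (convexOn_pow _).subset Set.Icc_subset_Ici_self (convex_Icc 0 1)
  have hm : AntitoneOn (fun t : ℝ => -t ^ (2 * (k + 1))) (Set.Icc 0 1) := fun s hs t _ hst =>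
    neg_le_neg (pow_le_pow_left₀ hs.1 hst _)
  have := h _ hcv.neg hm
  simp only [pow_mul, sq_abs, integral_neg, Pi.neg_apply] at this
  simp only [momentSeq, moment, pow_mul]
  linarith

lemma Degraded.entropy_le {x y : Measure EReal} (hx : x ∈ symProb) (hy : y ∈ symProb)
    (h : Degraded x y) : entropy y ≤ entropy x := by
  rw [entropy_eq hx, entropy_eq hy]
  have := gammaSum_mono (bddSeq_momentSeq hx) (bddSeq_momentSeq hy) h.momentSeq_le
  linarith

/-! ### The check-node operation preserves degradation -/

lemma checkOp_comm (x y : Measure EReal) [IsProbabilityMeasure x] [IsProbabilityMeasure y] :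
    checkOp x y = checkOp y x := by
  rw [checkOp, checkOp, ← Measure.prod_swap, Measure.map_map measurable_tauInv_mul measurable_swap]
  simp [Function.comp_def, mul_comm]

lemma measurable_abs_tau_mul : Measurable fun p : EReal × EReal => |tau p.1| * |tau p.2| :=
  (measurable_tau.comp measurable_fst).abs.mul (measurable_tau.comp measurable_snd).abs

lemma abs_tau_mul_mem (p : EReal × EReal) : |tau p.1| * |tau p.2| ∈ Set.Icc (0 : ℝ) 1 :=
  ⟨by positivity, mul_le_one₀ (abs_tau_le_one _) (abs_nonneg _) (abs_tau_le_one _)⟩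

lemma integral_checkOp {f : ℝ → ℝ} (hf : AntitoneOn f (Set.Icc 0 1)) (x z : Measure EReal)
    [IsProbabilityMeasure x] [IsProbabilityMeasure z] :
    ∫ a, f |tau a| ∂(checkOp x z) = ∫ b, ∫ a, f (|tau a| * |tau b|) ∂x ∂z := by
  rw [checkOp, integral_map measurable_tauInv_mul.aemeasurable
    (measurable_comp_antitoneOn hf measurable_tau.abs abs_tau_mem).aestronglyMeasurable]
  simp only [tau_tauInv_mul, abs_mul]
  rw [integral_prod_symm]
  exact integrable_comp_antitoneOn hf measurable_abs_tau_mul abs_tau_mul_mem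

/-- Condition on the second variable: scaling the argument by |τ(b)| ∈ [0,1] keeps f concave and
non-increasing. -/
lemma Degraded.checkOp_left {x x' z : Measure EReal} (hx : x ∈ symProb) (hx' : x' ∈ symProb)
    (hz : z ∈ symProb) (h : Degraded x x') : Degraded (checkOp x z) (checkOp x' z) := by
  intro f hf hf'
  have := hx.1
  have := hx'.1
  have := hz.1
  rw [integral_checkOp hf', integral_checkOp hf']
  have hint (y : Measure EReal) [IsProbabilityMeasure y] :
      Integrable (fun b => ∫ a, f (|tau a| * |tau b|) ∂y) z :=
    (integrable_comp_antitoneOn (μ := y.prod z) hf' measurable_abs_tau_mul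
      abs_tau_mul_mem).integral_prod_right
  refine integral_mono (hint x') (hint x) fun b => ?_
  have hb := abs_tau_mem b
  have hmem : ∀ t ∈ Set.Icc (0 : ℝ) 1, t * |tau b| ∈ Set.Icc (0 : ℝ) 1 := fun t ht =>
    ⟨mul_nonneg ht.1 hb.1, mul_le_one₀ ht.2 hb.1 hb.2⟩
  refine h (fun t => f (t * |tau b|)) ⟨convex_Icc 0 1, fun s hs t ht α β hα hβ hαβ => ?_⟩
    fun s hs t ht hst => hf' (hmem s hs) (hmem t ht) (mul_le_mul_of_nonneg_right hst hb.1)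
  have := hf.2 (hmem s hs) (hmem t ht) hα hβ hαβ
  simp only [smul_eq_mul] at this ⊢
  rwa [show (α * s + β * t) * |tau b| = α * (s * |tau b|) + β * (t * |tau b|) by ring]

lemma Degraded.checkOp {x x' z z' : Measure EReal} (hx : x ∈ symProb) (hx' : x' ∈ symProb)
    (hz : z ∈ symProb) (hz' : z' ∈ symProb) (h : Degraded x x') (h' : Degraded z z') :
    Degraded (checkOp x z) (checkOp x' z') := by
  have := hx.1
  have := hx'.1
  have := hz.1
  have := hz'.1
  refine (h.checkOp_left hx hx' hz).trans ?_
  rw [checkOp_comm x' z, checkOp_comm x' z']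
  exact h'.checkOp_left hz hz' hx'

/-! ### The variable-node operation preserves degradation -/

/-- The perspective `(u, v) ↦ v f(|u| / v)` of the even extension of `f`. -/
noncomputable def evenPersp (f : ℝ → ℝ) (u v : ℝ) : ℝ := v * f (|u| / v)

lemma abs_div_mem {u v : ℝ} (h : |u| ≤ v) : |u| / v ∈ Set.Icc (0 : ℝ) 1 :=
  ⟨div_nonneg (abs_nonneg u) ((abs_nonneg u).trans h),
    div_le_one_of_le₀ h ((abs_nonneg u).trans h)⟩

/-- The even extension of a concave non-increasing function is concave, and the perspective of a
concave function is jointly concave. -/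
lemma evenPersp_concave {f : ℝ → ℝ} (hf : ConcaveOn ℝ (Set.Icc 0 1) f)
    (hf' : AntitoneOn f (Set.Icc 0 1)) {u₁ v₁ u₂ v₂ α β : ℝ} (h₁ : |u₁| ≤ v₁) (h₂ : |u₂| ≤ v₂)
    (hα : 0 ≤ α) (hβ : 0 ≤ β) :
    α * evenPersp f u₁ v₁ + β * evenPersp f u₂ v₂
      ≤ evenPersp f (α * u₁ + β * u₂) (α * v₁ + β * v₂) := by
  have hv₁ := (abs_nonneg u₁).trans h₁
  have hv₂ := (abs_nonneg u₂).trans h₂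
  have hcan {u v : ℝ} (h : |u| ≤ v) : v * (|u| / v) = |u| := by
    rcases eq_or_ne v 0 with hv | hv
    · rw [hv, zero_mul]; rw [hv] at h; exact (le_antisymm h (abs_nonneg u)).symm
    · exact mul_div_cancel₀ _ hv
  have hp₁ := mul_nonneg hα hv₁
  have hp₂ := mul_nonneg hβ hv₂
  unfold evenPersp
  -- If the combined v vanishes, both weighted summands vanish too, so the junk value of division by
  -- zero has factor 0.
  rcases (add_nonneg hp₁ hp₂).eq_or_lt with hV | hV
  · have e₁ : α * v₁ = 0 := by linarith
    have e₂ : β * v₂ = 0 := by linarith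
    rw [← mul_assoc, ← mul_assoc, e₁, e₂]
    simp
  · set V := α * v₁ + β * v₂
    have hc := hf.2 (abs_div_mem h₁) (abs_div_mem h₂) (div_nonneg hp₁ hV.le)
      (div_nonneg hp₂ hV.le) (by rw [← add_div, div_self hV.ne'])
    have he : (α * v₁ / V) • (|u₁| / v₁) + (β * v₂ / V) • (|u₂| / v₂)
        = (α * |u₁| + β * |u₂|) / V := by
      simp only [smul_eq_mul]
      rw [div_mul_eq_mul_div, div_mul_eq_mul_div, mul_assoc, mul_assoc, hcan h₁, hcan h₂, add_div]
    have habs : |α * u₁ + β * u₂| ≤ α * |u₁| + β * |u₂| := by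
      refine (abs_add_le _ _).trans_eq ?_
      rw [abs_mul, abs_mul, abs_of_nonneg hα, abs_of_nonneg hβ]
    have hle : α * |u₁| + β * |u₂| ≤ V :=
      add_le_add (mul_le_mul_of_nonneg_left h₁ hα) (mul_le_mul_of_nonneg_left h₂ hβ)
    have hmono : f ((α * |u₁| + β * |u₂|) / V) ≤ f (|α * u₁ + β * u₂| / V) :=
      hf' (abs_div_mem (habs.trans hle))
        ⟨by positivity, div_le_one_of_le₀ hle hV.le⟩ (by gcongr)
    rw [he] at hc
    have := mul_le_mul_of_nonneg_left (hc.trans hmono) hV.le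
    simp only [smul_eq_mul] at this
    refine le_trans (le_of_eq ?_) this
    field_simp

/-- The kernel through which the variable-node operation acts on functionals `∫ f(|τ|)`. -/
noncomputable def varKernel (f : ℝ → ℝ) (s t : ℝ) : ℝ :=
  (evenPersp f (s + t) (1 + s * t) + evenPersp f (s - t) (1 - s * t)) / 2

lemma abs_add_le_one_add_mul {s t : ℝ} (hs : |s| ≤ 1) (ht : |t| ≤ 1) : |s + t| ≤ 1 + s * t := by
  rw [abs_le] at *
  constructor
  · nlinarith [mul_nonneg (show 0 ≤ 1 + s by linarith) (show 0 ≤ 1 + t by linarith)]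
  · nlinarith [mul_nonneg (show 0 ≤ 1 - s by linarith) (show 0 ≤ 1 - t by linarith)]

lemma abs_sub_le_one_sub_mul {s t : ℝ} (hs : |s| ≤ 1) (ht : |t| ≤ 1) : |s - t| ≤ 1 - s * t := by
  have := abs_add_le_one_add_mul hs (t := -t) (by rwa [abs_neg])
  rwa [← sub_eq_add_neg, mul_neg, ← sub_eq_add_neg] at this

lemma varKernel_neg (f : ℝ → ℝ) (s t : ℝ) : varKernel f (-s) t = varKernel f s t := by
  have h1 : |-s + t| = |s - t| := by rw [← abs_neg]; congr 1; ring
  have h2 : |-s - t| = |s + t| := by rw [← abs_neg]; congr 1; ring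
  simp only [varKernel, evenPersp, h1, h2, neg_mul, sub_neg_eq_add, ← sub_eq_add_neg]
  ring

lemma varKernel_abs (f : ℝ → ℝ) (s t : ℝ) : varKernel f |s| t = varKernel f s t := by
  rcases abs_choice s with h | h <;> rw [h]
  exact varKernel_neg f s t

/-- For fixed t, both arguments of each perspective are affine in s. -/
lemma varKernel_concave {f : ℝ → ℝ} (hf : ConcaveOn ℝ (Set.Icc 0 1) f)
    (hf' : AntitoneOn f (Set.Icc 0 1)) {t : ℝ} (ht : |t| ≤ 1) {s₁ s₂ α β : ℝ} (h₁ : |s₁| ≤ 1)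
    (h₂ : |s₂| ≤ 1) (hα : 0 ≤ α) (hβ : 0 ≤ β) (hαβ : α + β = 1) :
    α * varKernel f s₁ t + β * varKernel f s₂ t ≤ varKernel f (α * s₁ + β * s₂) t := by
  have k1 := evenPersp_concave hf hf' (abs_add_le_one_add_mul h₁ ht)
    (abs_add_le_one_add_mul h₂ ht) hα hβ
  have k2 := evenPersp_concave hf hf' (abs_sub_le_one_sub_mul h₁ ht)
    (abs_sub_le_one_sub_mul h₂ ht) hα hβ
  have hβ' : β = 1 - α := by linarith
  rw [show α * (s₁ + t) + β * (s₂ + t) = (α * s₁ + β * s₂) + t by rw [hβ']; ring,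
    show α * (1 + s₁ * t) + β * (1 + s₂ * t) = 1 + (α * s₁ + β * s₂) * t by rw [hβ']; ring] at k1
  rw [show α * (s₁ - t) + β * (s₂ - t) = (α * s₁ + β * s₂) - t by rw [hβ']; ring,
    show α * (1 - s₁ * t) + β * (1 - s₂ * t) = 1 - (α * s₁ + β * s₂) * t by rw [hβ']; ring] at k2
  unfold varKernel
  linarith

lemma varKernel_concaveOn {f : ℝ → ℝ} (hf : ConcaveOn ℝ (Set.Icc 0 1) f)
    (hf' : AntitoneOn f (Set.Icc 0 1)) {t : ℝ} (ht : |t| ≤ 1) :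
    ConcaveOn ℝ (Set.Icc 0 1) fun s => varKernel f s t := by
  have habs : ∀ s ∈ Set.Icc (0 : ℝ) 1, |s| ≤ 1 := fun s hs => by rw [abs_of_nonneg hs.1]; exact hs.2
  exact ⟨convex_Icc 0 1, fun s hs s' hs' α β hα hβ hαβ =>
    varKernel_concave hf hf' ht (habs s hs) (habs s' hs') hα hβ hαβ⟩

/-- An even concave function decreases on [0,1]: for 0 ≤ s ≤ s', the point s is a convex combination
of s' and -s', where the kernel has equal values. -/
lemma varKernel_antitoneOn {f : ℝ → ℝ} (hf : ConcaveOn ℝ (Set.Icc 0 1) f)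
    (hf' : AntitoneOn f (Set.Icc 0 1)) {t : ℝ} (ht : |t| ≤ 1) :
    AntitoneOn (fun s => varKernel f s t) (Set.Icc 0 1) := by
  intro s hs s' hs' hss'
  rcases hs'.1.eq_or_lt with h0 | h0
  · have : s = s' := le_antisymm hss' (by rw [← h0]; exact hs.1)
    rw [this]
  have habs : |s'| ≤ 1 := by rw [abs_of_nonneg hs'.1]; exact hs'.2
  have key := varKernel_concave hf hf' ht habs (by rwa [abs_neg] : |-s'| ≤ 1)
    (α := (1 + s / s') / 2) (β := (1 - s / s') / 2)
    (by have := div_nonneg hs.1 h0.le; linarith)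
    (by have := (div_le_one h0).2 hss'; linarith) (by ring)
  rw [varKernel_neg] at key
  have e : (1 + s / s') / 2 * s' + (1 - s / s') / 2 * -s' = s := by field_simp; ring
  rw [e] at key
  linarith

lemma measurable_llrRatio :
    Measurable fun p : EReal × EReal => |tau p.1 + tau p.2| / (1 + tau p.1 * tau p.2) := by
  have h1 : Measurable fun p : EReal × EReal => tau p.1 := measurable_tau.comp measurable_fst
  have h2 : Measurable fun p : EReal × EReal => tau p.2 := measurable_tau.comp measurable_snd
  exact (h1.add h2).abs.div ((h1.mul h2).const_add 1)

lemma llrRatio_mem (p : EReal × EReal) :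
    |tau p.1 + tau p.2| / (1 + tau p.1 * tau p.2) ∈ Set.Icc (0 : ℝ) 1 :=
  abs_div_mem (abs_add_le_one_add_mul (abs_tau_le_one _) (abs_tau_le_one _))

lemma integrable_tau_mul_snd {x z : Measure EReal} [IsProbabilityMeasure x]
    [IsProbabilityMeasure z] {φ : EReal × EReal → ℝ} (hφ : Integrable φ (x.prod z)) :
    Integrable (fun p => tau p.2 * φ p) (x.prod z) :=
  hφ.bdd_mul (measurable_tau.comp measurable_snd).aestronglyMeasurable
    (ae_of_all _ fun p => abs_tau_le_one p.2)

lemma integrable_tau_mul_fst {x z : Measure EReal} [IsProbabilityMeasure x]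
    [IsProbabilityMeasure z] {φ : EReal × EReal → ℝ} (hφ : Integrable φ (x.prod z)) :
    Integrable (fun p => tau p.1 * φ p) (x.prod z) :=
  hφ.bdd_mul (measurable_tau.comp measurable_fst).aestronglyMeasurable
    (ae_of_all _ fun p => abs_tau_le_one p.1)

/-- A function which is odd in each of two independent symmetric variables. -/
lemma integral_odd_odd {x z : Measure EReal} (hx : x ∈ symProb) (hz : z ∈ symProb)
    {φ : EReal × EReal → ℝ} (hφ : Integrable φ (x.prod z))
    (hm : ∀ b, Integrable (fun a => φ (a, b)) x) (hm' : ∀ a, Integrable (fun b => φ (a, b)) z)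
    (h1 : ∀ a b, φ (-a, b) = -φ (a, b)) (h2 : ∀ a b, φ (a, -b) = -φ (a, b)) :
    ∫ p, φ p ∂(x.prod z) = ∫ p, tau p.1 * tau p.2 * φ p ∂(x.prod z) := by
  have := hx.1
  have := hz.1
  calc ∫ p, φ p ∂(x.prod z) = ∫ b, ∫ a, φ (a, b) ∂x ∂z := integral_prod_symm _ hφ
    _ = ∫ b, ∫ a, tau a * φ (a, b) ∂x ∂z := by
        congr 1; funext b
        exact hx.2.integral_odd (fun a => h1 a b) (hm b)
    _ = ∫ p, tau p.1 * φ p ∂(x.prod z) := (integral_prod_symm _ (integrable_tau_mul_fst hφ)).symm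
    _ = ∫ a, ∫ b, tau a * φ (a, b) ∂z ∂x := integral_prod _ (integrable_tau_mul_fst hφ)
    _ = ∫ a, ∫ b, tau b * (tau a * φ (a, b)) ∂z ∂x := by
        congr 1; funext a
        exact hz.2.integral_odd (fun b => by rw [h2]; ring) ((hm' a).const_mul _)
    _ = ∫ p, tau p.2 * (tau p.1 * φ p) ∂(x.prod z) :=
        (integral_prod _ (integrable_tau_mul_snd (integrable_tau_mul_fst hφ))).symm
    _ = _ := by congr 1; funext p; ring

/-- With G the integrand as a function of both variables, φ(a,b) = G(a,b) - G(-a,b) is odd in each,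
so symmetry lets τ(a)τ(b)φ replace φ. This yields weights (1 ± τ(a)τ(b))/2 on the two relative
signs, which is the kernel. Conditioning on b then reduces monotonicity of ⊛ to properties of that
kernel. -/
lemma integral_varOp {f : ℝ → ℝ} (hf : AntitoneOn f (Set.Icc 0 1)) {x z : Measure EReal}
    (hx : x ∈ symProb) (hz : z ∈ symProb) :
    Integrable (fun p : EReal × EReal => varKernel f (tau p.1) (tau p.2)) (x.prod z) ∧
    ∫ a, f |tau a| ∂(varOp x z) = ∫ b, ∫ a, varKernel f (tau a) (tau b) ∂x ∂z := by
  have := hx.1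
  have := hz.1
  let G : EReal × EReal → ℝ := fun p => f (|tau p.1 + tau p.2| / (1 + tau p.1 * tau p.2))
  have hneg : Measurable fun p : EReal × EReal => (-p.1, p.2) :=
    measurable_fst.neg.prodMk measurable_snd
  have hG : Measurable G := measurable_comp_antitoneOn hf measurable_llrRatio llrRatio_mem
  have hGb (p) : |G p| ≤ max |f 0| |f 1| := abs_le_of_antitoneOn hf (llrRatio_mem p)
  have iG : Integrable G (x.prod z) :=
    Integrable.of_bound hG.aestronglyMeasurable _ (ae_of_all _ hGb)
  have iG' : Integrable (fun p => G (-p.1, p.2)) (x.prod z) :=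
    Integrable.of_bound (hG.comp hneg).aestronglyMeasurable _ (ae_of_all _ fun p => hGb _)
  have hGG (a b : EReal) : G (-a, -b) = G (a, b) := by
    simp only [G, tau_neg]
    rw [← neg_add, abs_neg, neg_mul_neg]
  have hGG' (a b : EReal) : G (a, -b) = G (-a, b) := by
    rw [← hGG a (-b), neg_neg]
  let φ : EReal × EReal → ℝ := fun p => G p - G (-p.1, p.2)
  have iφ : Integrable φ (x.prod z) := iG.sub iG'
  have hφm : Measurable φ := hG.sub (hG.comp hneg)
  have hφb (p) : |φ p| ≤ max |f 0| |f 1| + max |f 0| |f 1| :=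
    (abs_sub _ _).trans (add_le_add (hGb _) (hGb _))
  have hodd := integral_odd_odd hx hz iφ
    (fun b => integrable_of_bound (hφm.comp measurable_prodMk_right) fun a => hφb (a, b))
    (fun a => integrable_of_bound (hφm.comp measurable_prodMk_left) fun b => hφb (a, b))
    (fun a b => by simp only [φ, neg_neg]; ring)
    (fun a b => by simp only [φ, hGG, hGG']; ring)
  have iφ' : Integrable (fun p => tau p.1 * tau p.2 * φ p) (x.prod z) := by
    simpa only [mul_assoc] using integrable_tau_mul_fst (integrable_tau_mul_snd iφ)
  have hK (p : EReal × EReal) : varKernel f (tau p.1) (tau p.2)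
      = (1 / 2) * (G p + G (-p.1, p.2)) + (1 / 2) * (tau p.1 * tau p.2 * φ p) := by
    have e1 : |-tau p.1 + tau p.2| = |tau p.1 - tau p.2| := by
      rw [← abs_neg]; congr 1; ring
    have e2 : 1 + -tau p.1 * tau p.2 = 1 - tau p.1 * tau p.2 := by ring
    simp only [varKernel, evenPersp, φ, G, tau_neg, e1, e2]
    ring
  have iK : Integrable (fun p : EReal × EReal => varKernel f (tau p.1) (tau p.2)) (x.prod z) := by
    simp only [hK]
    exact ((iG.add iG').const_mul _).add (iφ'.const_mul _)
  refine ⟨iK, ?_⟩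
  have hadd : Measurable fun p : EReal × EReal => p.1 + p.2 := measurable_fst.add measurable_snd
  have a1 : ∀ᵐ p ∂(x.prod z), p.1 ≠ ⊥ := Measure.quasiMeasurePreserving_fst.ae hx.2.ae_ne_bot
  have a2 : ∀ᵐ p ∂(x.prod z), p.2 ≠ ⊥ := Measure.quasiMeasurePreserving_snd.ae hz.2.ae_ne_bot
  calc ∫ a, f |tau a| ∂(varOp x z) = ∫ p, f |tau (p.1 + p.2)| ∂(x.prod z) :=
        integral_map hadd.aemeasurable
          (measurable_comp_antitoneOn hf measurable_tau.abs abs_tau_mem).aestronglyMeasurable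
    _ = ∫ p, G p ∂(x.prod z) := by
        refine integral_congr_ae ?_
        filter_upwards [a1, a2] with p h1 h2
        have h0 := (abs_nonneg _).trans
          (abs_add_le_one_add_mul (abs_tau_le_one p.1) (abs_tau_le_one p.2))
        rw [tau_add h1 h2, abs_div, abs_of_nonneg h0]
    _ = ∫ p, ((1 / 2) * (G p + G (-p.1, p.2)) + (1 / 2) * φ p) ∂(x.prod z) := by
        congr 1; funext p; simp only [φ]; ring
    _ = ∫ p, varKernel f (tau p.1) (tau p.2) ∂(x.prod z) := by
        have iS : Integrable (fun p => (1 / 2 : ℝ) * (G p + G (-p.1, p.2))) (x.prod z) :=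
          (iG.add iG').const_mul _
        simp only [hK]
        rw [integral_add iS (iφ.const_mul _), integral_add iS (iφ'.const_mul _),
          integral_const_mul _ φ, hodd,
          integral_const_mul _ fun p : EReal × EReal => tau p.1 * tau p.2 * φ p]
    _ = _ := integral_prod_symm _ iK

lemma varOp_comm (x y : Measure EReal) [SFinite x] [SFinite y] : varOp x y = varOp y x :=
  Measure.conv_comm x y

lemma varOp_assoc (x y z : Measure EReal) [SFinite y] [SFinite z] :
    varOp (varOp x y) z = varOp x (varOp y z) :=
  Measure.conv_assoc x y z

lemma deltaZero_varOp (x : Measure EReal) [SFinite x] : varOp deltaZero x = x :=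
  Measure.dirac_zero_conv x

lemma Degraded.varOp_left {x x' z : Measure EReal} (hx : x ∈ symProb) (hx' : x' ∈ symProb)
    (hz : z ∈ symProb) (h : Degraded x x') : Degraded (varOp x z) (varOp x' z) := by
  intro f hf hf'
  have := hx.1
  have := hx'.1
  have := hz.1
  obtain ⟨i1, e1⟩ := integral_varOp hf' hx hz
  obtain ⟨i2, e2⟩ := integral_varOp hf' hx' hz
  rw [e1, e2]
  refine integral_mono i2.integral_prod_right i1.integral_prod_right fun b => ?_
  have := h _ (varKernel_concaveOn hf hf' (abs_tau_le_one b))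
    (varKernel_antitoneOn hf hf' (abs_tau_le_one b))
  simpa only [varKernel_abs] using this

lemma Degraded.varOp {x x' z z' : Measure EReal} (hx : x ∈ symProb) (hx' : x' ∈ symProb)
    (hz : z ∈ symProb) (hz' : z' ∈ symProb) (h : Degraded x x') (h' : Degraded z z') :
    Degraded (varOp x z) (varOp x' z') := by
  have := hx'.1
  have := hz.1
  have := hz'.1
  refine (h.varOp_left hx hx' hz).trans ?_
  rw [varOp_comm x' z, varOp_comm x' z']
  exact h'.varOp_left hz hz' hx'

lemma Degraded.varPow {x x' : Measure EReal} (hx : x ∈ symProb) (hx' : x' ∈ symProb)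
    (h : Degraded x x') : ∀ n, Degraded (varPow x n) (varPow x' n)
  | 0 => Degraded.refl _
  | n + 1 => (h.varPow hx hx' n).varOp (varPow_mem hx n) (varPow_mem hx' n) hx hx' h

lemma Degraded.checkPow {x x' : Measure EReal} (hx : x ∈ symProb) (hx' : x' ∈ symProb)
    (h : Degraded x x') : ∀ n, Degraded (checkPow x n) (checkPow x' n)
  | 0 => Degraded.refl _
  | n + 1 => (h.checkPow hx hx' n).checkOp (checkPow_mem hx n) (checkPow_mem hx' n) hx hx' h

lemma Degraded.varPoly (p : ℝ[X]) {x x' : Measure EReal} (hx : x ∈ symProb) (hx' : x' ∈ symProb)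
    (h : Degraded x x') : Degraded (varPoly p x) (varPoly p x') :=
  Degraded.sum_smul (by simp) (fun n _ => varPow_mem hx n) (fun n _ => varPow_mem hx' n)
    fun n _ => h.varPow hx hx' n

lemma Degraded.checkPoly (p : ℝ[X]) {x x' : Measure EReal} (hx : x ∈ symProb)
    (hx' : x' ∈ symProb) (h : Degraded x x') : Degraded (checkPoly p x) (checkPoly p x') :=
  Degraded.sum_smul (by simp) (fun n _ => checkPow_mem hx n) (fun n _ => checkPow_mem hx' n)
    fun n _ => h.checkPow hx hx' n

/-! ### Limits of symmetric measures -/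

/-- Since 1-τ is bounded and continuous, symmetry can be tested on continuous functions and
therefore passes to weak limits. -/
lemma isSymmetric_of_integral_neg_mul {x : Measure EReal} [IsProbabilityMeasure x]
    (h : ∀ g : BoundedContinuousFunction EReal ℝ,
      ∫ a, (1 - tau a) * g (-a) ∂x = ∫ a, (1 - tau a) * g a ∂x) : IsSymmetric x := by
  have hm : Measurable fun a => ENNReal.ofReal (1 - tau a) :=
    (measurable_tau.const_sub 1).ennreal_ofReal
  set ν := x.withDensity fun a => ENNReal.ofReal (1 - tau a) with hν
  have hfin : IsFiniteMeasure ν := by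
    refine isFiniteMeasure_withDensity (ne_of_lt ?_)
    calc ∫⁻ a, ENNReal.ofReal (1 - tau a) ∂x ≤ ∫⁻ _, 2 ∂x := by
          refine lintegral_mono fun a => ?_
          rw [show (2 : ℝ≥0∞) = ENNReal.ofReal 2 by simp]
          exact ENNReal.ofReal_le_ofReal (by linarith [neg_one_le_tau a])
      _ < ⊤ := by simp
  have hint (ψ : EReal → ℝ) : ∫ a, (1 - tau a) * ψ a ∂x = ∫ a, ψ a ∂ν := by
    rw [hν, integral_withDensity_eq_integral_toReal_smul hm (by simp)]
    refine integral_congr_ae (ae_of_all _ fun a => ?_)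
    simp [ENNReal.toReal_ofReal (by linarith [tau_le_one a] : 0 ≤ 1 - tau a)]
  have hmap : ν.map (fun a => -a) = ν := by
    have : IsFiniteMeasure (ν.map fun a => -a) := Measure.isFiniteMeasure_map ν _
    refine ext_of_forall_integral_eq_of_IsFiniteMeasure fun g => ?_
    rw [integral_map measurable_neg.aemeasurable g.continuous.measurable.aestronglyMeasurable,
      ← hint g, ← h g, hint fun a => g (-a)]
  refine isSymmetric_of_lintegral_neg_mul fun g hg => ?_
  have hl (k : EReal → ℝ≥0∞) (hk : Measurable k) :
      ∫⁻ a, k a * ENNReal.ofReal (1 - tau a) ∂x = ∫⁻ a, k a ∂ν := by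
    rw [hν, lintegral_withDensity_eq_lintegral_mul _ hm hk]
    simp only [Pi.mul_apply, mul_comm]
  have hgn : Measurable fun a => g (-a) := hg.comp measurable_neg
  rw [hl _ hgn, hl g hg, ← lintegral_map hg measurable_neg, hmap]

/-- The probability measures on the compact extended line form a compact space, so a limit exists
along any ultrafilter; no subsequence has to be extracted. -/
lemma exists_tendsto_integral {y : ℕ → Measure EReal} (hy : ∀ n, y n ∈ symProb) :
    ∃ f ∈ symProb, ∀ g : BoundedContinuousFunction EReal ℝ,
      Tendsto (fun n => ∫ a, g a ∂(y n)) (hyperfilter ℕ) (𝓝 (∫ a, g a ∂f)) := by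
  let Y : ℕ → ProbabilityMeasure EReal := fun n => ⟨y n, (hy n).1⟩
  obtain ⟨F, hF⟩ : ∃ F, Tendsto Y (hyperfilter ℕ) (𝓝 F) :=
    ⟨_, ((hyperfilter ℕ).map Y).le_nhds_lim⟩
  have hlim := ProbabilityMeasure.tendsto_iff_forall_integral_tendsto.1 hF
  refine ⟨F, ⟨F.2, isSymmetric_of_integral_neg_mul fun g => ?_⟩, hlim⟩
  let t : BoundedContinuousFunction EReal ℝ :=
    BoundedContinuousFunction.mkOfCompact ⟨fun a => 1 - tau a, continuous_const.sub continuous_tau⟩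
  let n : C(EReal, EReal) := ⟨fun a => -a, continuous_neg⟩
  have h1 := hlim (t * g.compContinuous n)
  have h2 := hlim (t * g)
  refine tendsto_nhds_unique (h1.congr fun m => ?_) h2
  exact (hy m).2.integral_neg_mul g

/-- Along a degrading sequence each moment is monotone and bounded, so it converges; the ultrafilter
limit identifies the limits as moments of one symmetric law. -/
lemma exists_tendsto_momentSeq {y : ℕ → Measure EReal} (hy : ∀ n, y n ∈ symProb)
    (hmono : ∀ n, Degraded (y (n + 1)) (y n)) :
    ∃ f ∈ symProb, ∀ k, Tendsto (fun n => momentSeq (y n) k) atTop (𝓝 (momentSeq f k)) := by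
  obtain ⟨f, hf, hlim⟩ := exists_tendsto_integral hy
  refine ⟨f, hf, fun k => ?_⟩
  have hanti : Antitone fun n => momentSeq (y n) k :=
    antitone_nat_of_succ_le fun n => (hmono n).momentSeq_le k
  have hbdd : BddBelow (Set.range fun n => momentSeq (y n) k) :=
    ⟨0, by rintro _ ⟨n, rfl⟩; exact (momentSeq_mem (hy n) k).1⟩
  have h1 := tendsto_atTop_ciInf hanti hbdd
  have h2 := hlim (BoundedContinuousFunction.mkOfCompact
    ⟨fun a => tau a ^ (2 * (k + 1)), continuous_tau.pow _⟩)
  rwa [tendsto_nhds_unique (h1.mono_left Nat.hyperfilter_le_atTop) h2] at h1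

lemma tendsto_entropyDist {y : ℕ → Measure EReal} {f : Measure EReal} (hy : ∀ n, y n ∈ symProb)
    (hf : f ∈ symProb)
    (h : ∀ k, Tendsto (fun n => momentSeq (y n) k) atTop (𝓝 (momentSeq f k))) :
    Tendsto (fun n => entropyDist (y n) f) atTop (𝓝 0) := by
  have hlim (k : ℕ) : Tendsto
      (fun n => gammaCoeff (k + 1) * |momentSeq (y n) k - momentSeq f k|) atTop (𝓝 0) := by
    have := (((h k).sub_const (momentSeq f k)).abs).const_mul (gammaCoeff (k + 1))
    simpa using this
  have hb (n k : ℕ) : ‖gammaCoeff (k + 1) * |momentSeq (y n) k - momentSeq f k|‖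
      ≤ gammaCoeff (k + 1) := by
    rw [Real.norm_eq_abs, abs_mul, abs_abs, abs_of_nonneg (gammaCoeff_succ_nonneg k)]
    refine mul_le_of_le_one_right (gammaCoeff_succ_nonneg k) (abs_le.2 ?_)
    have h1 := momentSeq_mem (hy n) k
    have h2 := momentSeq_mem hf k
    constructor <;> linarith [h1.1, h1.2, h2.1, h2.2]
  have := tendsto_tsum_of_dominated_convergence hasSum_gammaCoeff.summable hlim
    (Eventually.of_forall fun n k => hb n k)
  rw [tsum_zero] at this
  exact this

lemma tendsto_momentSeq {y : ℕ → Measure EReal} {f : Measure EReal} (hy : ∀ n, y n ∈ symProb)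
    (hf : f ∈ symProb) (h : Tendsto (fun n => entropyDist (y n) f) atTop (𝓝 0)) (k : ℕ) :
    Tendsto (fun n => momentSeq (y n) k) atTop (𝓝 (momentSeq f k)) := by
  rw [tendsto_iff_dist_tendsto_zero]
  have hpos := gammaCoeff_succ_pos k
  have h0 := h.const_mul (gammaCoeff (k + 1))⁻¹
  rw [mul_zero] at h0
  refine squeeze_zero (fun _ => dist_nonneg) (fun n => ?_) h0
  rw [Real.dist_eq, ← div_eq_inv_mul, le_div_iff₀ hpos, mul_comm]
  have hb : BddSeq fun k => |momentSeq (y n) k - momentSeq f k| := by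
    obtain ⟨C, hC⟩ := (bddSeq_momentSeq (hy n)).sub (bddSeq_momentSeq hf)
    exact ⟨C, fun k => by rw [abs_abs]; exact hC k⟩
  exact hb.summable.le_tsum k fun j _ => mul_nonneg (gammaCoeff_succ_nonneg j) (abs_nonneg _)

lemma integral_eval_tau_sq {x : Measure EReal} (hx : x ∈ symProb) (p : ℝ[X]) :
    ∫ a, p.eval (tau a ^ 2) ∂x
      = p.coeff 0 + ∑ n ∈ Finset.range p.natDegree, p.coeff (n + 1) * momentSeq x n := by
  have := hx.1
  simp only [Polynomial.eval_eq_sum_range, ← pow_mul]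
  rw [integral_finsetSum _ fun n _ => (integrable_tau_pow x n).const_mul _,
    Finset.sum_range_succ']
  simp only [integral_const_mul]
  rw [add_comm]
  congr 1
  simp

/-- Convergence of all moments implies convergence of the integrals of continuous functions of
`|τ|`. -/
lemma tendsto_integral_of_tendsto_momentSeq {y : ℕ → Measure EReal} {f : Measure EReal}
    (hy : ∀ n, y n ∈ symProb) (hf : f ∈ symProb)
    (h : ∀ k, Tendsto (fun n => momentSeq (y n) k) atTop (𝓝 (momentSeq f k))) {g : ℝ → ℝ}
    (hg : ContinuousOn g (Set.Icc 0 1)) :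
    Tendsto (fun n => ∫ a, g |tau a| ∂(y n)) atTop (𝓝 (∫ a, g |tau a| ∂f)) := by
  rw [Metric.tendsto_atTop]
  intro ε hε
  -- Only even moments are controlled, so Weierstrass approximation is applied in the variable s =
  -- τ².
  have hsq : ContinuousOn (fun s => g √s) (Set.Icc 0 1) :=
    hg.comp Real.continuous_sqrt.continuousOn fun s hs =>
      ⟨Real.sqrt_nonneg s, Real.sqrt_le_one.2 hs.2⟩
  obtain ⟨p, hp⟩ := exists_polynomial_near_of_continuousOn 0 1 _ hsq (ε / 3) (by positivity)
  have hnear (a : EReal) : |g |tau a| - p.eval (tau a ^ 2)| ≤ ε / 3 := by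
    have := hp (tau a ^ 2) ⟨sq_nonneg _, (sq_le_one_iff_abs_le_one _).2 (abs_tau_le_one a)⟩
    rw [Real.sqrt_sq_eq_abs, abs_sub_comm] at this
    exact this.le
  have hcont : Continuous fun a => g |tau a| :=
    hg.comp_continuous continuous_tau.abs abs_tau_mem
  have hcont' : Continuous fun a => p.eval (tau a ^ 2) :=
    p.continuous.comp (continuous_tau.pow 2)
  have hint (x : Measure EReal) (hx : x ∈ symProb) :
      |∫ a, g |tau a| ∂x - ∫ a, p.eval (tau a ^ 2) ∂x| ≤ ε / 3 := by
    have := hx.1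
    have i1 : Integrable (fun a => g |tau a|) x :=
      (BoundedContinuousFunction.mkOfCompact ⟨_, hcont⟩).integrable x
    have i2 : Integrable (fun a => p.eval (tau a ^ 2)) x :=
      (BoundedContinuousFunction.mkOfCompact ⟨_, hcont'⟩).integrable x
    rw [← integral_sub i1 i2]
    have := norm_integral_le_of_norm_le_const (μ := x)
      (f := fun a => g |tau a| - p.eval (tau a ^ 2)) (ae_of_all _ hnear)
    simpa using this
  have hpl : Tendsto (fun n => ∫ a, p.eval (tau a ^ 2) ∂(y n)) atTop
      (𝓝 (∫ a, p.eval (tau a ^ 2) ∂f)) := by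
    simp only [integral_eval_tau_sq (hy _), integral_eval_tau_sq hf]
    exact (tendsto_finsetSum _ fun k _ => (h k).const_mul _).const_add _
  obtain ⟨N, hN⟩ := Metric.tendsto_atTop.1 hpl (ε / 3) (by positivity)
  refine ⟨N, fun n hn => ?_⟩
  have h1 := abs_le.1 (hint _ (hy n))
  have h2 := abs_le.1 (hint _ hf)
  have h3 := hN n hn
  rw [Real.dist_eq, abs_lt] at h3 ⊢
  constructor <;> linarith [h1.1, h1.2, h2.1, h2.2, h3.1, h3.2]

/-- The even extension is concave and has 0 in its interior, so f can be discontinuous only at 1. -/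
lemma continuousOn_comp_abs {f : ℝ → ℝ} (hf : ConcaveOn ℝ (Set.Icc 0 1) f)
    (hf' : AntitoneOn f (Set.Icc 0 1)) : ContinuousOn (fun t => f |t|) (Set.Ioo (-1) 1) := by
  have hmem : ∀ t ∈ Set.Icc (-1 : ℝ) 1, |t| ∈ Set.Icc (0 : ℝ) 1 := fun t ht =>
    ⟨abs_nonneg t, abs_le.2 ht⟩
  have hc : ConcaveOn ℝ (Set.Icc (-1) 1) fun t => f |t| := by
    refine ⟨convex_Icc _ _, fun s hs t ht α β hα hβ hαβ => ?_⟩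
    have h1 := hf.2 (hmem s hs) (hmem t ht) hα hβ hαβ
    have h2 := hf.1 (hmem s hs) (hmem t ht) hα hβ hαβ
    refine h1.trans (hf' (hmem _ ((convex_Icc _ _) hs ht hα hβ hαβ)) h2 ?_)
    simp only [smul_eq_mul]
    refine (abs_add_le _ _).trans_eq ?_
    rw [abs_mul, abs_mul, abs_of_nonneg hα, abs_of_nonneg hβ]
  simpa using hc.continuousOn_interior

/-- Degradation may be tested on continuous functions. -/
lemma degraded_of_continuousOn {x y : Measure EReal} [IsProbabilityMeasure x]
    [IsProbabilityMeasure y]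
    (h : ∀ f : ℝ → ℝ, ContinuousOn f (Set.Icc 0 1) → ConcaveOn ℝ (Set.Icc 0 1) f →
      AntitoneOn f (Set.Icc 0 1) → ∫ a, f |tau a| ∂y ≤ ∫ a, f |tau a| ∂x) : Degraded x y := by
  intro f hf hf'
  let r : ℕ → ℝ := fun n => n / (n + 1)
  have hr0 (n) : 0 ≤ r n := by positivity
  have hr1 (n) : r n < 1 := by
    rw [div_lt_one (by positivity)]; linarith
  have hrmem (n) : r n ∈ Set.Icc (0 : ℝ) 1 := ⟨hr0 n, (hr1 n).le⟩
  have hrlim : Tendsto r atTop (𝓝 1) := tendsto_natCast_div_add_atTop 1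
  let J : ℕ → ℝ := fun n => f (r n) - f 1
  have hJ0 (n) : 0 ≤ J n := sub_nonneg.2 (hf' (hrmem n) ⟨zero_le_one, le_rfl⟩ (hr1 n).le)
  have hJ1 (n) : J n ≤ f 0 - f 1 :=
    sub_le_sub_right (hf' ⟨le_rfl, zero_le_one⟩ (hrmem n) (hr0 n)) _
  -- Shrinking the argument by r n < 1 avoids the possible jump of f at 1. Subtracting the convex
  -- increasing J n · tⁿ restores the value f(1) at t = 1 and vanishes in the limit for t < 1.
  let F : ℕ → ℝ → ℝ := fun n t => f (r n * t) - J n * t ^ n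
  have hmem (n) {t : ℝ} (ht : t ∈ Set.Icc (0 : ℝ) 1) : r n * t ∈ Set.Icc (0 : ℝ) 1 :=
    ⟨mul_nonneg (hr0 n) ht.1, mul_le_one₀ (hr1 n).le ht.1 ht.2⟩
  have hFcont (n) : ContinuousOn (F n) (Set.Icc 0 1) := by
    refine ContinuousOn.sub ?_ (by fun_prop)
    have h1 : ContinuousOn (fun t => f |r n * t|) (Set.Icc 0 1) := by
      refine (continuousOn_comp_abs hf hf').comp (f := fun t => r n * t) (by fun_prop) fun t ht => ?_
      have := (hmem n ht).1
      exact ⟨by linarith, lt_of_le_of_lt (mul_le_of_le_one_right (hr0 n) ht.2) (hr1 n)⟩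
    exact h1.congr fun t ht => by simp only [abs_of_nonneg (hmem n ht).1]
  have hFconc (n) : ConcaveOn ℝ (Set.Icc 0 1) (F n) := by
    refine ConcaveOn.sub ⟨convex_Icc 0 1, fun s hs t ht α β hα hβ hαβ => ?_⟩ ?_
    · have := hf.2 (hmem n hs) (hmem n ht) hα hβ hαβ
      simp only [smul_eq_mul] at this ⊢
      rwa [show r n * (α * s + β * t) = α * (r n * s) + β * (r n * t) by ring]
    · exact ((convexOn_pow n).subset Set.Icc_subset_Ici_self (convex_Icc 0 1)).smul (hJ0 n)
  have hFanti (n) : AntitoneOn (F n) (Set.Icc 0 1) := by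
    intro s hs t ht hst
    exact sub_le_sub (hf' (hmem n hs) (hmem n ht) (mul_le_mul_of_nonneg_left hst (hr0 n)))
      (mul_le_mul_of_nonneg_left (pow_le_pow_left₀ hs.1 hst n) (hJ0 n))
  have hFlim {t : ℝ} (ht : t ∈ Set.Icc (0 : ℝ) 1) : Tendsto (fun n => F n t) atTop (𝓝 (f t)) := by
    rcases ht.2.lt_or_eq with h1 | h1
    · have e1 : Tendsto (fun n => f (r n * t)) atTop (𝓝 (f t)) := by
        have hc : ContinuousAt (fun t => f |t|) t :=
          (continuousOn_comp_abs hf hf').continuousAt (Ioo_mem_nhds (by linarith [ht.1]) h1)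
        have hl : Tendsto (fun n => r n * t) atTop (𝓝 t) := by
          simpa using hrlim.mul_const t
        have := hc.tendsto.comp hl
        simpa only [Function.comp_def, abs_of_nonneg ht.1, abs_of_nonneg (hmem _ ht).1] using this
      have e2 : Tendsto (fun n => J n * t ^ n) atTop (𝓝 0) := by
        have := (tendsto_pow_atTop_nhds_zero_of_lt_one ht.1 h1).const_mul (f 0 - f 1)
        rw [mul_zero] at this
        exact squeeze_zero (fun n => mul_nonneg (hJ0 n) (pow_nonneg ht.1 n))
          (fun n => mul_le_mul_of_nonneg_right (hJ1 n) (pow_nonneg ht.1 n)) this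
      simpa using e1.sub e2
    · have : ∀ n, F n t = f t := fun n => by simp only [F, J, h1]; ring_nf
      simp only [this, tendsto_const_nhds]
  have hFb (n) {t : ℝ} (ht : t ∈ Set.Icc (0 : ℝ) 1) : ‖F n t‖ ≤ max |f 0| |f 1| + (f 0 - f 1) := by
    refine (norm_sub_le _ _).trans (add_le_add (abs_le_of_antitoneOn hf' (hmem n ht)) ?_)
    rw [Real.norm_of_nonneg (mul_nonneg (hJ0 n) (pow_nonneg ht.1 n))]
    exact (mul_le_of_le_one_right (hJ0 n) (pow_le_one₀ ht.1 ht.2)).trans (hJ1 n)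
  have hint (z : Measure EReal) [IsProbabilityMeasure z] :
      Tendsto (fun n => ∫ a, F n |tau a| ∂z) atTop (𝓝 (∫ a, f |tau a| ∂z)) :=
    tendsto_integral_of_dominated_convergence _
      (fun n => (integrable_abs_tau (hFanti n) z).aestronglyMeasurable) (integrable_const _)
      (fun n => ae_of_all _ fun a => hFb n (abs_tau_mem a))
      (ae_of_all _ fun a => hFlim (abs_tau_mem a))
  exact le_of_tendsto_of_tendsto' (hint y) (hint x) fun n => h _ (hFcont n) (hFconc n) (hFanti n)

lemma degraded_of_tendsto_left {y : ℕ → Measure EReal} {f x : Measure EReal}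
    (hy : ∀ n, y n ∈ symProb) (hf : f ∈ symProb) (hx : x ∈ symProb)
    (h : ∀ k, Tendsto (fun n => momentSeq (y n) k) atTop (𝓝 (momentSeq f k)))
    (hd : ∀ᶠ n in atTop, Degraded (y n) x) : Degraded f x := by
  have := hf.1
  have := hx.1
  refine degraded_of_continuousOn fun g hg hg' hg'' => ?_
  exact ge_of_tendsto (tendsto_integral_of_tendsto_momentSeq hy hf h hg)
    (hd.mono fun n hn => hn g hg' hg'')

lemma degraded_of_tendsto_right {y : ℕ → Measure EReal} {f x : Measure EReal}
    (hy : ∀ n, y n ∈ symProb) (hf : f ∈ symProb) (hx : x ∈ symProb)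
    (h : ∀ k, Tendsto (fun n => momentSeq (y n) k) atTop (𝓝 (momentSeq f k)))
    (hd : ∀ᶠ n in atTop, Degraded x (y n)) : Degraded x f := by
  have := hf.1
  have := hx.1
  refine degraded_of_continuousOn fun g hg hg' hg'' => ?_
  exact le_of_tendsto (tendsto_integral_of_tendsto_momentSeq hy hf h hg)
    (hd.mono fun n hn => hn g hg' hg'')

/-! ### Polynomials with non-negative coefficients -/

section Poly

variable {p : ℝ[X]}

lemma eval_nonneg_of_coeff (hp : ∀ n, 0 ≤ p.coeff n) {t : ℝ} (ht : 0 ≤ t) : 0 ≤ p.eval t := by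
  rw [Polynomial.eval_eq_sum_range]
  exact Finset.sum_nonneg fun n _ => mul_nonneg (hp n) (pow_nonneg ht n)

lemma eval_mono_of_coeff (hp : ∀ n, 0 ≤ p.coeff n) {s t : ℝ} (hs : 0 ≤ s) (hst : s ≤ t) :
    p.eval s ≤ p.eval t := by
  rw [Polynomial.eval_eq_sum_range, Polynomial.eval_eq_sum_range]
  exact Finset.sum_le_sum fun n _ => mul_le_mul_of_nonneg_left (pow_le_pow_left₀ hs hst n) (hp n)

lemma coeff_derivative_nonneg (hp : ∀ n, 0 ≤ p.coeff n) (n : ℕ) : 0 ≤ p.derivative.coeff n := by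
  rw [Polynomial.coeff_derivative]
  exact mul_nonneg (hp _) (by positivity)

lemma sum_coeff_mul_eq (p : ℝ[X]) (g : ℕ → ℝ) {N : ℕ} (hN : p.natDegree < N) :
    ∑ n ∈ Finset.range (p.natDegree + 1), p.coeff n * g n
      = ∑ n ∈ Finset.range N, p.coeff n * g n := by
  refine Finset.sum_subset (Finset.range_subset_range.2 hN) fun n _ hn => ?_
  rw [Polynomial.coeff_eq_zero_of_natDegree_lt (by simpa using hn), zero_mul]

/-- Passage from node to edge perspective. At n = 0 the truncated `n - 1` is harmless because of the
factor n. -/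
lemma sum_coeff_mul_natCast (p : ℝ[X]) (g : ℕ → ℝ) :
    ∑ n ∈ Finset.range (p.natDegree + 1), p.coeff n * (n * g (n - 1))
      = ∑ n ∈ Finset.range (p.derivative.natDegree + 1), p.derivative.coeff n * g n := by
  have h1 : p.derivative.natDegree ≤ p.natDegree - 1 := Polynomial.natDegree_derivative_le p
  rw [sum_coeff_mul_eq p.derivative g (N := p.natDegree + 1) (by omega), Finset.sum_range_succ',
    Finset.sum_range_succ, Polynomial.coeff_derivative, Polynomial.coeff_natDegree_succ_eq_zero]
  simp only [Nat.cast_zero, zero_mul, mul_zero, add_zero]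
  refine Finset.sum_congr rfl fun n _ => ?_
  rw [Polynomial.coeff_derivative, Nat.add_sub_cancel]
  push_cast
  ring

lemma pow_succ_sub_pow_succ_le {s t : ℝ} (hs : 0 ≤ s) (hst : s ≤ t) (n : ℕ) :
    t ^ (n + 1) - s ^ (n + 1) ≤ (n + 1) * t ^ n * (t - s) := by
  induction n with
  | zero => simp
  | succ n ih =>
    have ht := hs.trans hst
    have h1 := mul_le_mul_of_nonneg_left ih ht
    have h2 := mul_le_mul_of_nonneg_right (pow_le_pow_left₀ hs hst (n + 1)) (sub_nonneg.2 hst)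
    calc t ^ (n + 1 + 1) - s ^ (n + 1 + 1)
        = t * (t ^ (n + 1) - s ^ (n + 1)) + s ^ (n + 1) * (t - s) := by ring
      _ ≤ t * ((n + 1) * t ^ n * (t - s)) + t ^ (n + 1) * (t - s) := add_le_add h1 h2
      _ = _ := by push_cast; ring

lemma eval_sub_eval_le (hp : ∀ n, 0 ≤ p.coeff n) {s t : ℝ} (hs : 0 ≤ s) (hst : s ≤ t) :
    p.eval t - p.eval s ≤ p.derivative.eval t * (t - s) := by
  rw [Polynomial.eval_eq_sum_range (p := p.derivative), ← sum_coeff_mul_natCast,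
    Polynomial.eval_eq_sum_range, Polynomial.eval_eq_sum_range, ← Finset.sum_sub_distrib,
    Finset.sum_mul]
  refine Finset.sum_le_sum fun n _ => ?_
  rw [← mul_sub, mul_assoc]
  refine mul_le_mul_of_nonneg_left ?_ (hp n)
  cases n with
  | zero => simp
  | succ n => simpa using pow_succ_sub_pow_succ_le hs hst n

lemma eval_sub_eval_le_derivative_one (hp : ∀ n, 0 ≤ p.coeff n) {s t : ℝ} (hs : 0 ≤ s)
    (hst : s ≤ t) (ht : t ≤ 1) : p.eval t - p.eval s ≤ p.derivative.eval 1 * (t - s) :=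
  (eval_sub_eval_le hp hs hst).trans <| mul_le_mul_of_nonneg_right
    (eval_mono_of_coeff (coeff_derivative_nonneg hp) (hs.trans hst) ht) (sub_nonneg.2 hst)

lemma eval_one_eq_sum (p : ℝ[X]) :
    p.eval 1 = ∑ n ∈ Finset.range (p.natDegree + 1), p.coeff n := by
  simp [Polynomial.eval_eq_sum_range]

end Poly

/-! ### Second-order estimate for the entropy of variable-node powers -/

/-- The measure `y^{⊛ i} ⊛ x^{⊛ j}`. -/
noncomputable def mixedPow (y x : Measure EReal) (i j : ℕ) : Measure EReal :=
  varOp (varPow y i) (varPow x j)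

section Remainder

variable {x y : Measure EReal} {δ : ℝ}

lemma mixedPow_mem (hx : x ∈ symProb) (hy : y ∈ symProb) (i j : ℕ) :
    mixedPow y x i j ∈ symProb := varOp_mem (varPow_mem hy i) (varPow_mem hx j)

lemma mixedPow_zero_left (hx : x ∈ symProb) (j : ℕ) : mixedPow y x 0 j = varPow x j := by
  have := (varPow_mem hx j).1
  exact deltaZero_varOp _

lemma mixedPow_zero_right (hy : y ∈ symProb) (i : ℕ) : mixedPow y x i 0 = varPow y i := by
  have := (varPow_mem hy i).1
  have := deltaZero_mem.1
  rw [mixedPow, varPow, varOp_comm, deltaZero_varOp]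

lemma mixedPow_succ_right (hx : x ∈ symProb) (i j : ℕ) :
    mixedPow y x i (j + 1) = varOp (mixedPow y x i j) x := by
  have := hx.1
  have := (varPow_mem hx j).1
  exact (varOp_assoc _ _ _).symm

lemma mixedPow_succ_left (hx : x ∈ symProb) (hy : y ∈ symProb) (i j : ℕ) :
    mixedPow y x (i + 1) j = varOp (mixedPow y x i j) y := by
  have := hy.1
  have := (varPow_mem hx j).1
  rw [mixedPow, mixedPow, varPow, varOp_assoc, varOp_comm y, varOp_assoc]

lemma degraded_mixedPow (hx : x ∈ symProb) (hy : y ∈ symProb) (h : Degraded x y) (i j : ℕ) :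
    Degraded (varPow x (i + j)) (mixedPow y x i j) := by
  induction i generalizing j with
  | zero => rw [mixedPow_zero_left hx, zero_add]; exact Degraded.refl _
  | succ i ih =>
    have h1 := ih (j + 1)
    rw [show i + (j + 1) = i + 1 + j by ring] at h1
    refine h1.trans ?_
    rw [mixedPow_succ_right hx, mixedPow_succ_left hx hy]
    exact (Degraded.refl _).varOp (mixedPow_mem hx hy i j) (mixedPow_mem hx hy i j) hx hy h

lemma bddSeq_sub (hx : x ∈ symProb) (hy : y ∈ symProb) :
    BddSeq fun k => momentSeq y k - momentSeq x k :=
  (bddSeq_momentSeq hy).sub (bddSeq_momentSeq hx)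

lemma gammaSum_momentSeq_sub (hx : x ∈ symProb) (hy : y ∈ symProb) :
    gammaSum (fun k => momentSeq y k - momentSeq x k) = entropy x - entropy y := by
  rw [gammaSum_sub (bddSeq_momentSeq hy) (bddSeq_momentSeq hx), entropy_eq hx, entropy_eq hy]
  ring

/-- Exact cost of replacing one ⊛-factor. The powers of x and y are compared by replacing the
factors one at a time through `mixedPow`. -/
lemma entropy_varOp_sub {z : Measure EReal} (hz : z ∈ symProb) (hx : x ∈ symProb)
    (hy : y ∈ symProb) : entropy (varOp z y) - entropy (varOp z x)
      = gammaSum (fun k => momentSeq z k * (momentSeq y k - momentSeq x k))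
        - gammaSum (fun k => momentSeq y k - momentSeq x k) := by
  rw [entropy_varOp hz hy, entropy_varOp hz hx, gammaSum_momentSeq_sub hx hy]
  simp only [mul_sub]
  rw [gammaSum_sub ((bddSeq_momentSeq hz).mul (bddSeq_momentSeq hy))
    ((bddSeq_momentSeq hz).mul (bddSeq_momentSeq hx))]
  ring

lemma entropy_varPow_sub_mixedPow_le (hx : x ∈ symProb) (hy : y ∈ symProb) (h : Degraded x y)
    (i j : ℕ) : entropy (varPow x (i + j)) - entropy (mixedPow y x i j)
      ≤ i * gammaSum (fun k => momentSeq y k - momentSeq x k) := by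
  induction i generalizing j with
  | zero => rw [mixedPow_zero_left hx]; simp
  | succ i ih =>
    have h1 := ih (j + 1)
    have h2 := entropy_varOp_sub (mixedPow_mem hx hy i j) hx hy
    rw [← mixedPow_succ_right hx, ← mixedPow_succ_left hx hy] at h2
    have h3 : 0 ≤ gammaSum (fun k => momentSeq (mixedPow y x i j) k *
        (momentSeq y k - momentSeq x k)) := gammaSum_nonneg fun k =>
      mul_nonneg (momentSeq_mem (mixedPow_mem hx hy i j) k).1 (sub_nonneg.2 (h.momentSeq_le k))
    rw [show i + (j + 1) = i + 1 + j by ring] at h1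
    push_cast
    linarith

/-- Freezing the weight at the pure power of x costs a sum of products of two moment differences.
One of them is at most δ in every moment; the other sums to an entropy difference, at most i times
that of a single factor. -/
lemma gammaSum_mixedPow_le (hx : x ∈ symProb) (hy : y ∈ symProb) (h : Degraded x y)
    (hδ0 : 0 ≤ δ) (hδ : ∀ k, momentSeq y k - momentSeq x k ≤ δ) (i j : ℕ) :
    gammaSum (fun k => momentSeq (mixedPow y x i j) k * (momentSeq y k - momentSeq x k))
      ≤ gammaSum (fun k => momentSeq (varPow x (i + j)) k * (momentSeq y k - momentSeq x k))
        + δ * (i * gammaSum (fun k => momentSeq y k - momentSeq x k)) := by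
  have hm := mixedPow_mem hx hy i j
  have hp := varPow_mem hx (i + j)
  have hb := bddSeq_sub hp hm
  have hpb := (bddSeq_momentSeq hp).mul (bddSeq_sub hx hy)
  calc _ ≤ gammaSum (fun k => momentSeq (varPow x (i + j)) k * (momentSeq y k - momentSeq x k)
        + δ * (momentSeq (mixedPow y x i j) k - momentSeq (varPow x (i + j)) k)) := by
        refine gammaSum_mono ((bddSeq_momentSeq hm).mul (bddSeq_sub hx hy))
          (hpb.add ((BddSeq.const δ).mul hb)) fun k => ?_
        have h1 := (degraded_mixedPow hx hy h i j).momentSeq_le k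
        have := mul_le_mul_of_nonneg_right (hδ k) (sub_nonneg.2 h1)
        linarith
    _ = gammaSum (fun k => momentSeq (varPow x (i + j)) k * (momentSeq y k - momentSeq x k))
        + δ * (entropy (varPow x (i + j)) - entropy (mixedPow y x i j)) := by
        rw [gammaSum_add hpb ((BddSeq.const δ).mul hb), gammaSum_const_mul,
          gammaSum_momentSeq_sub hp hm]
    _ ≤ _ := by
        have := mul_le_mul_of_nonneg_left (entropy_varPow_sub_mixedPow_le hx hy h i j) hδ0
        linarith

lemma entropy_mixedPow_le (hx : x ∈ symProb) (hy : y ∈ symProb) (h : Degraded x y)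
    (hδ0 : 0 ≤ δ) (hδ : ∀ k, momentSeq y k - momentSeq x k ≤ δ) (m i j : ℕ) (hij : i + j = m + 1) :
    entropy (mixedPow y x i j) ≤ entropy (varPow x (m + 1))
      + i * (gammaSum (fun k => momentSeq (varPow x m) k * (momentSeq y k - momentSeq x k))
        - gammaSum (fun k => momentSeq y k - momentSeq x k))
      + i * m * (δ * gammaSum (fun k => momentSeq y k - momentSeq x k)) := by
  induction i generalizing j with
  | zero => rw [mixedPow_zero_left hx, ← hij]; simp
  | succ i ih =>
    have h1 := ih (j + 1) (by omega)
    have h2 := entropy_varOp_sub (mixedPow_mem hx hy i j) hx hy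
    have h3 := gammaSum_mixedPow_le hx hy h hδ0 hδ i j
    rw [← mixedPow_succ_right hx, ← mixedPow_succ_left hx hy] at h2
    rw [show i + j = m by omega] at h3
    -- Each replacement is charged m remainders instead of i. The total loses a factor 2 against the
    -- exact sum of the i, and the coefficient 2 of λ'(1)ρ'(1)² in the coupling constant pays for
    -- it.
    have hD : 0 ≤ δ * gammaSum (fun k => momentSeq y k - momentSeq x k) :=
      mul_nonneg hδ0 (gammaSum_nonneg fun k => sub_nonneg.2 (h.momentSeq_le k))
    have him : (i : ℝ) ≤ m := by exact_mod_cast (by omega : i ≤ m)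
    have h4 := mul_le_mul_of_nonneg_right him hD
    push_cast
    linarith

lemma entropy_varPow_le (hx : x ∈ symProb) (hy : y ∈ symProb) (h : Degraded x y)
    (hδ0 : 0 ≤ δ) (hδ : ∀ k, momentSeq y k - momentSeq x k ≤ δ) (n : ℕ) :
    entropy (varPow y n) - entropy (varPow x n)
      ≤ n * (gammaSum (fun k => momentSeq (varPow x (n - 1)) k * (momentSeq y k - momentSeq x k))
        - gammaSum (fun k => momentSeq y k - momentSeq x k))
      + n * ((n - 1 : ℕ) : ℝ) * (δ * gammaSum (fun k => momentSeq y k - momentSeq x k)) := by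
  cases n with
  | zero => simp [varPow]
  | succ m =>
    have := entropy_mixedPow_le hx hy h hδ0 hδ m (m + 1) 0 rfl
    rw [mixedPow_zero_right hy] at this
    rw [Nat.add_sub_cancel]
    linarith

end Remainder

/-! ### Edge-perspective degree distributions and the information-node estimate. -/

namespace Ensemble

variable (E : Ensemble)

lemma avgL_pos : 0 < E.avgL := E.L_deriv_pos

lemma avgR_pos : 0 < E.avgR := E.R_deriv_pos

lemma lam_coeff_nonneg (n : ℕ) : 0 ≤ E.lam.coeff n := by
  rw [lam, Polynomial.coeff_C_mul]
  exact mul_nonneg (inv_nonneg.2 E.avgL_pos.le) (coeff_derivative_nonneg E.L_nonneg n)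

lemma rho_coeff_nonneg (n : ℕ) : 0 ≤ E.rho.coeff n := by
  rw [rho, Polynomial.coeff_C_mul]
  exact mul_nonneg (inv_nonneg.2 E.avgR_pos.le) (coeff_derivative_nonneg E.R_nonneg n)

lemma lam_eval_one : E.lam.eval 1 = 1 := by
  rw [lam, Polynomial.eval_mul, Polynomial.eval_C]
  exact inv_mul_cancel₀ E.avgL_pos.ne'

lemma rho_eval_one : E.rho.eval 1 = 1 := by
  rw [rho, Polynomial.eval_mul, Polynomial.eval_C]
  exact inv_mul_cancel₀ E.avgR_pos.ne'

lemma derivative_R_eval (t : ℝ) : E.R.derivative.eval t = E.avgR * E.rho.eval t := by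
  rw [rho, Polynomial.eval_mul, Polynomial.eval_C, mul_inv_cancel_left₀ E.avgR_pos.ne']

lemma derivative_L_eq : E.L.derivative = Polynomial.C E.avgL * E.lam := by
  rw [lam, ← mul_assoc, ← Polynomial.C_mul, mul_inv_cancel₀ E.avgL_pos.ne', Polynomial.C_1, one_mul]

lemma natDegree_lam : E.lam.natDegree = E.L.derivative.natDegree := by
  rw [lam, Polynomial.natDegree_C_mul (inv_ne_zero E.avgL_pos.ne')]

lemma sum_L_coeff_mul (g : ℕ → ℝ) :
    ∑ n ∈ Finset.range (E.L.natDegree + 1), E.L.coeff n * (n * g (n - 1))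
      = E.avgL * ∑ n ∈ Finset.range (E.lam.natDegree + 1), E.lam.coeff n * g n := by
  rw [sum_coeff_mul_natCast, natDegree_lam, Finset.mul_sum]
  refine Finset.sum_congr rfl fun n _ => ?_
  rw [derivative_L_eq, Polynomial.coeff_C_mul, mul_assoc]

lemma sum_L_coeff_mul_natCast :
    ∑ n ∈ Finset.range (E.L.natDegree + 1), E.L.coeff n * (n * ((n - 1 : ℕ) : ℝ))
      = E.avgL * E.lam.derivative.eval 1 := by
  rw [E.sum_L_coeff_mul fun n => (n : ℝ), eval_one_eq_sum]
  have := sum_coeff_mul_natCast E.lam fun _ => 1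
  simp only [mul_one] at this
  rw [this]

/-- Second-order estimate for the information-node part of the potential. -/
lemma entropy_varPoly_L_le {x y : Measure EReal} {δ : ℝ} (hx : x ∈ symProb) (hy : y ∈ symProb)
    (h : Degraded x y) (hδ0 : 0 ≤ δ) (hδ : ∀ k, momentSeq y k - momentSeq x k ≤ δ) :
    entropy (varPoly E.L y) - entropy (varPoly E.L x)
      ≤ E.avgL * E.lam.derivative.eval 1 * δ * gammaSum (fun k => momentSeq y k - momentSeq x k)
        - E.avgL * gammaSum (fun k => (1 - momentSeq (varPoly E.lam x) k) *
            (momentSeq y k - momentSeq x k)) := by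
  set D := gammaSum (fun k => momentSeq y k - momentSeq x k) with hD
  let S : ℕ → ℝ := fun n =>
    gammaSum (fun k => momentSeq (varPow x n) k * (momentSeq y k - momentSeq x k))
  have hlam := varPoly_mem E.lam_coeff_nonneg E.lam_eval_one hx
  have hS : gammaSum (fun k => (1 - momentSeq (varPoly E.lam x) k) *
      (momentSeq y k - momentSeq x k))
      = D - ∑ n ∈ Finset.range (E.lam.natDegree + 1), E.lam.coeff n * S n := by
    simp only [sub_mul, one_mul]
    rw [gammaSum_sub (bddSeq_sub hx hy) ((bddSeq_momentSeq hlam).mul (bddSeq_sub hx hy)), ← hD]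
    congr 1
    simp only [momentSeq_varPoly E.lam_coeff_nonneg hx, Finset.sum_mul, mul_assoc]
    rw [gammaSum_sum fun n _ => (BddSeq.const _).mul
      ((bddSeq_momentSeq (varPow_mem hx n)).mul (bddSeq_sub hx hy))]
    simp only [gammaSum_const_mul, S]
  have h1 : ∑ n ∈ Finset.range (E.L.natDegree + 1), E.L.coeff n * (n * (S (n - 1) - D))
      = E.avgL * (∑ n ∈ Finset.range (E.lam.natDegree + 1), E.lam.coeff n * S n - D) := by
    rw [E.sum_L_coeff_mul fun n => S n - D]
    simp only [mul_sub, Finset.sum_sub_distrib]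
    rw [← Finset.sum_mul, ← eval_one_eq_sum, lam_eval_one, one_mul]
  rw [entropy_varPoly E.L_nonneg hx, entropy_varPoly E.L_nonneg hy, ← Finset.sum_sub_distrib, hS]
  calc _ ≤ ∑ n ∈ Finset.range (E.L.natDegree + 1), (E.L.coeff n * (n * (S (n - 1) - D))
        + E.L.coeff n * (n * ((n - 1 : ℕ) : ℝ)) * (δ * D)) := by
        refine Finset.sum_le_sum fun n _ => ?_
        rw [← mul_sub, mul_assoc, ← mul_add]
        exact mul_le_mul_of_nonneg_left (entropy_varPow_le hx hy h hδ0 hδ n) (E.L_nonneg n)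
    _ = _ := by
        rw [Finset.sum_add_distrib, h1, ← Finset.sum_mul, sum_L_coeff_mul_natCast]
        ring

end Ensemble

namespace Ensemble

variable (E : Ensemble) {c : Measure EReal}

/-! ### Density evolution of the single system -/

lemma checkPoly_rho_mem {x : Measure EReal} (hx : x ∈ symProb) : checkPoly E.rho x ∈ symProb :=
  checkPoly_mem E.rho_coeff_nonneg E.rho_eval_one hx

lemma genOut_mem (hc : c ∈ symProb) {x : Measure EReal} (hx : x ∈ symProb) :
    E.genOut c x ∈ symProb := checkOp_mem hc (E.checkPoly_rho_mem hx)

lemma varPoly_lam_mem {x : Measure EReal} (hx : x ∈ symProb) : varPoly E.lam x ∈ symProb :=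
  varPoly_mem E.lam_coeff_nonneg E.lam_eval_one hx

lemma de_mem (hc : c ∈ symProb) {x : Measure EReal} (hx : x ∈ symProb) : E.de c x ∈ symProb :=
  E.varPoly_lam_mem (E.genOut_mem hc hx)

lemma de_iterate_mem (hc : c ∈ symProb) {x : Measure EReal} (hx : x ∈ symProb) (n : ℕ) :
    (E.de c)^[n] x ∈ symProb := by
  induction n with
  | zero => exact hx
  | succ n ih => rw [Function.iterate_succ_apply']; exact E.de_mem hc ih

lemma momentSeq_genOut (hc : c ∈ symProb) {x : Measure EReal} (hx : x ∈ symProb) (k : ℕ) :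
    momentSeq (E.genOut c x) k = momentSeq c k * E.rho.eval (momentSeq x k) := by
  rw [genOut, momentSeq_checkOp hc (E.checkPoly_rho_mem hx),
    momentSeq_checkPoly E.rho_coeff_nonneg hx]

lemma degraded_genOut (hc : c ∈ symProb) {x y : Measure EReal} (hx : x ∈ symProb)
    (hy : y ∈ symProb) (h : Degraded x y) : Degraded (E.genOut c x) (E.genOut c y) :=
  (Degraded.refl c).checkOp hc hc (E.checkPoly_rho_mem hx) (E.checkPoly_rho_mem hy)
    (h.checkPoly _ hx hy)

lemma degraded_de (hc : c ∈ symProb) {x y : Measure EReal} (hx : x ∈ symProb)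
    (hy : y ∈ symProb) (h : Degraded x y) : Degraded (E.de c x) (E.de c y) :=
  (E.degraded_genOut hc hx hy h).varPoly _ (E.genOut_mem hc hx) (E.genOut_mem hc hy)

lemma degraded_de_iterate (hc : c ∈ symProb) (n : ℕ) :
    Degraded ((E.de c)^[n + 1] deltaInf) ((E.de c)^[n] deltaInf) := by
  induction n with
  | zero => exact degraded_deltaInf (E.de_iterate_mem hc deltaInf_mem 1)
  | succ n ih =>
    have h := E.degraded_de hc (E.de_iterate_mem hc deltaInf_mem _)
      (E.de_iterate_mem hc deltaInf_mem _) ih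
    rwa [← Function.iterate_succ_apply' (E.de c) (n + 1),
      ← Function.iterate_succ_apply' (E.de c) n] at h

lemma degraded_de_iterate_of_le (hc : c ∈ symProb) {m n : ℕ} (h : m ≤ n) :
    Degraded ((E.de c)^[n] deltaInf) ((E.de c)^[m] deltaInf) := by
  induction n, h using Nat.le_induction with
  | base => exact Degraded.refl _
  | succ n _ ih => exact (E.degraded_de_iterate hc n).trans ih

/-- The minimal fixed point exists. -/
lemma deConverges_minFixedPoint (hc : c ∈ symProb) :
    E.DEConverges c deltaInf (E.minFixedPoint c) := by
  have hex : ∃ f, E.DEConverges c deltaInf f := by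
    obtain ⟨f, hf, hlim⟩ := exists_tendsto_momentSeq (E.de_iterate_mem hc deltaInf_mem)
      (E.degraded_de_iterate hc)
    exact ⟨f, hf, tendsto_entropyDist (E.de_iterate_mem hc deltaInf_mem) hf hlim⟩
  rw [minFixedPoint, dif_pos hex]
  exact hex.choose_spec

lemma minFixedPoint_mem (hc : c ∈ symProb) : E.minFixedPoint c ∈ symProb :=
  (E.deConverges_minFixedPoint hc).1

/-- This half of the fixed point property suffices, and it needs no continuity of 𝖳: the limit is
degraded with respect to every iterate of Δ_∞, so its image under 𝖳 is too, hence also with respect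
to their limit. -/
lemma degraded_de_minFixedPoint (hc : c ∈ symProb) :
    Degraded (E.de c (E.minFixedPoint c)) (E.minFixedPoint c) := by
  have hf := E.minFixedPoint_mem hc
  have hy := E.de_iterate_mem hc deltaInf_mem
  have hlim := tendsto_momentSeq hy hf (E.deConverges_minFixedPoint hc).2
  have hle (n : ℕ) : Degraded (E.minFixedPoint c) ((E.de c)^[n] deltaInf) :=
    degraded_of_tendsto_left hy hf (hy n) hlim
      ((eventually_ge_atTop n).mono fun m hm => E.degraded_de_iterate_of_le hc hm)
  refine degraded_of_tendsto_right hy hf (E.de_mem hc hf) hlim (Eventually.of_forall fun n => ?_)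
  refine Degraded.trans ?_ (E.degraded_de_iterate hc n)
  rw [Function.iterate_succ_apply']
  exact E.degraded_de hc hf (hy n) (hle n)

/-! ### The potential in terms of moments -/

/-- The contribution of a generator-node with moment `m` to the potential. -/
noncomputable def genPotential (m : ℝ) : ℝ :=
  m * E.rho.eval m - E.rho.eval m - E.R.eval m / E.avgR

lemma eval_mem {p : ℝ[X]} (hp : ∀ n, 0 ≤ p.coeff n) (h1 : p.eval 1 = 1) {t : ℝ}
    (ht : t ∈ Set.Icc (0 : ℝ) 1) : p.eval t ∈ Set.Icc (0 : ℝ) 1 :=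
  ⟨eval_nonneg_of_coeff hp ht.1, h1 ▸ eval_mono_of_coeff hp ht.1 ht.2⟩

lemma rho_eval_mem {t : ℝ} (ht : t ∈ Set.Icc (0 : ℝ) 1) : E.rho.eval t ∈ Set.Icc (0 : ℝ) 1 :=
  eval_mem E.rho_coeff_nonneg E.rho_eval_one ht

lemma R_eval_mem {t : ℝ} (ht : t ∈ Set.Icc (0 : ℝ) 1) : E.R.eval t ∈ Set.Icc (0 : ℝ) 1 :=
  eval_mem E.R_nonneg E.R_eval_one ht

lemma bddSeq_genPotential {x : Measure EReal} (hx : x ∈ symProb) :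
    BddSeq fun k => E.genPotential (momentSeq x k) := by
  have h1 := bddSeq_momentSeq hx
  have h2 : BddSeq fun k => E.rho.eval (momentSeq x k) :=
    BddSeq.of_mem_Icc fun k => E.rho_eval_mem (momentSeq_mem hx k)
  have h3 : BddSeq fun k => E.R.eval (momentSeq x k) :=
    BddSeq.of_mem_Icc fun k => E.R_eval_mem (momentSeq_mem hx k)
  simp only [genPotential, div_eq_mul_inv]
  exact ((h1.mul h2).sub h2).sub (h3.mul (BddSeq.const _))

/-- All generator-node terms become a scalar function evaluated at each moment, the constants
cancelling. The information-node term stays an entropy, as moments are not multiplicative under ⊛.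
-/
lemma potential_eq (hc : c ∈ symProb) {x : Measure EReal} (hx : x ∈ symProb) :
    E.potential c x = E.avgL / E.avgR * gammaSum (momentSeq c)
      + E.avgL * gammaSum (fun k => momentSeq c k * E.genPotential (momentSeq x k))
      - entropy (varPoly E.L (E.genOut c x)) := by
  have hR := checkPoly_mem E.R_nonneg E.R_eval_one hx
  have hg := E.genOut_mem hc hx
  have b0 := bddSeq_momentSeq hc
  have b1 := bddSeq_momentSeq hx
  have b2 : BddSeq fun k => E.rho.eval (momentSeq x k) :=
    BddSeq.of_mem_Icc fun k => E.rho_eval_mem (momentSeq_mem hx k)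
  have b3 : BddSeq fun k => E.R.eval (momentSeq x k) :=
    BddSeq.of_mem_Icc fun k => E.R_eval_mem (momentSeq_mem hx k)
  have e1 : entropy (checkOp c (checkPoly E.R x))
      = 1 - gammaSum fun k => momentSeq c k * E.R.eval (momentSeq x k) := by
    rw [entropy_eq (checkOp_mem hc hR)]
    congr 2; funext k
    rw [momentSeq_checkOp hc hR, momentSeq_checkPoly E.R_nonneg hx]
  have e2 : entropy (checkOp x (E.genOut c x))
      = 1 - gammaSum fun k => momentSeq x k * (momentSeq c k * E.rho.eval (momentSeq x k)) := by
    rw [entropy_eq (checkOp_mem hx hg)]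
    congr 2; funext k
    rw [momentSeq_checkOp hx hg, E.momentSeq_genOut hc hx]
  have e3 : entropy (E.genOut c x)
      = 1 - gammaSum fun k => momentSeq c k * E.rho.eval (momentSeq x k) := by
    rw [entropy_eq hg]
    congr 2; funext k
    rw [E.momentSeq_genOut hc hx]
  have e4 : gammaSum (fun k => momentSeq c k * E.genPotential (momentSeq x k))
      = gammaSum (fun k => momentSeq x k * (momentSeq c k * E.rho.eval (momentSeq x k)))
        - gammaSum (fun k => momentSeq c k * E.rho.eval (momentSeq x k))
        - E.avgR⁻¹ * gammaSum (fun k => momentSeq c k * E.R.eval (momentSeq x k)) := by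
    rw [← gammaSum_const_mul, ← gammaSum_sub (b1.mul (b0.mul b2)) (b0.mul b2),
      ← gammaSum_sub ((b1.mul (b0.mul b2)).sub (b0.mul b2)) ((BddSeq.const _).mul (b0.mul b3))]
    congr 1; funext k
    simp only [genPotential]
    ring
  rw [potential, e1, e2, e3, e4, entropy_eq hc]
  ring

/-- The left-over is (t-s)ρ(t) - (R(t)-R(s))/R'(1), non-negative because R is convex on [0,∞) with
R' = R'(1)ρ. The weight 1-s is taken at the worse endpoint, as the coupled system produces it. -/
lemma genPotential_sub_nonneg {s t : ℝ} (hs : 0 ≤ s) (hst : s ≤ t) :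
    0 ≤ E.genPotential t - E.genPotential s + (1 - s) * (E.rho.eval t - E.rho.eval s) := by
  have h := eval_sub_eval_le E.R_nonneg hs hst
  rw [derivative_R_eval, mul_assoc] at h
  have h2 : (E.R.eval t - E.R.eval s) / E.avgR ≤ E.rho.eval t * (t - s) := by
    rw [div_le_iff₀ E.avgR_pos, mul_comm]
    exact h
  rw [sub_div] at h2
  unfold genPotential
  linarith

/-! ### The bi-infinite coupled system -/

/-- The input of the information-nodes at position `i` of the coupled system. -/
noncomputable def infoIn (w : ℕ) (c : Measure EReal) (z : ℤ → Measure EReal) (i : ℤ) :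
    Measure EReal :=
  (w : ℝ≥0∞)⁻¹ • ∑ j ∈ Finset.range w, E.genOut c (z (i + (j : ℤ)))

/-- The density evolution map of the coupled system without boundary. -/
noncomputable def freeDE (w : ℕ) (c : Measure EReal) (z : ℤ → Measure EReal) (i : ℤ) :
    Measure EReal :=
  (w : ℝ≥0∞)⁻¹ • ∑ k ∈ Finset.range w, varPoly E.lam (E.infoIn w c z (i - (k : ℤ)))

section Coupled

variable {E} {w : ℕ} {z z' : ℤ → Measure EReal}

lemma infoIn_mem (hw : 1 ≤ w) (hc : c ∈ symProb) (hz : ∀ i, z i ∈ symProb) (i : ℤ) :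
    E.infoIn w c z i ∈ symProb := average_mem hw fun _ => E.genOut_mem hc (hz _)

lemma freeDE_mem (hw : 1 ≤ w) (hc : c ∈ symProb) (hz : ∀ i, z i ∈ symProb) (i : ℤ) :
    E.freeDE w c z i ∈ symProb :=
  average_mem hw fun _ => E.varPoly_lam_mem (infoIn_mem hw hc hz _)

lemma degraded_infoIn (hw : 1 ≤ w) (hc : c ∈ symProb) (hz : ∀ i, z i ∈ symProb)
    (hz' : ∀ i, z' i ∈ symProb) (h : ∀ i, Degraded (z i) (z' i)) (i : ℤ) :
    Degraded (E.infoIn w c z i) (E.infoIn w c z' i) :=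
  Degraded.average hw (fun _ => E.genOut_mem hc (hz _)) (fun _ => E.genOut_mem hc (hz' _))
    fun _ _ => E.degraded_genOut hc (hz _) (hz' _) (h _)

lemma degraded_freeDE (hw : 1 ≤ w) (hc : c ∈ symProb) (hz : ∀ i, z i ∈ symProb)
    (hz' : ∀ i, z' i ∈ symProb) (h : ∀ i, Degraded (z i) (z' i)) (i : ℤ) :
    Degraded (E.freeDE w c z i) (E.freeDE w c z' i) :=
  Degraded.average hw (fun _ => E.varPoly_lam_mem (infoIn_mem hw hc hz _))
    (fun _ => E.varPoly_lam_mem (infoIn_mem hw hc hz' _)) fun _ _ =>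
      (degraded_infoIn hw hc hz hz' h _).varPoly _ (infoIn_mem hw hc hz _) (infoIn_mem hw hc hz' _)

lemma infoIn_shift (d i : ℤ) : E.infoIn w c (fun i => z (i + d)) i = E.infoIn w c z (i + d) := by
  simp only [infoIn, add_right_comm]

lemma freeDE_shift (d i : ℤ) : E.freeDE w c (fun i => z (i + d)) i = E.freeDE w c z (i + d) := by
  simp only [freeDE, infoIn_shift, sub_add_eq_add_sub]

lemma infoIn_of_const (hw : 1 ≤ w) {x : Measure EReal} {i : ℤ}
    (h : ∀ j ∈ Finset.range w, z (i + (j : ℤ)) = x) : E.infoIn w c z i = E.genOut c x := by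
  rw [infoIn, Finset.sum_congr rfl fun j hj => by rw [h j hj], average_const hw]

lemma freeDE_const (hw : 1 ≤ w) (x : Measure EReal) (i : ℤ) :
    E.freeDE w c (fun _ => x) i = E.de c x := by
  simp only [freeDE, infoIn_of_const (E := E) (c := c) hw (z := fun _ => x) fun _ _ => rfl]
  exact average_const hw _

lemma momentSeq_infoIn (hw : 1 ≤ w) (hc : c ∈ symProb) (hz : ∀ i, z i ∈ symProb) (i : ℤ) (k : ℕ) :
    momentSeq (E.infoIn w c z i) k
      = (w : ℝ)⁻¹ * ∑ j ∈ Finset.range w, momentSeq (E.genOut c (z (i + (j : ℤ)))) k :=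
  momentSeq_average hw (fun j : ℕ => E.genOut_mem hc (hz (i + (j : ℤ)))) k

lemma momentSeq_freeDE (hw : 1 ≤ w) (hc : c ∈ symProb) (hz : ∀ i, z i ∈ symProb) (i : ℤ) (k : ℕ) :
    momentSeq (E.freeDE w c z i) k
      = (w : ℝ)⁻¹ * ∑ l ∈ Finset.range w,
        momentSeq (varPoly E.lam (E.infoIn w c z (i - (l : ℤ)))) k :=
  momentSeq_average hw
    (fun l : ℕ => E.varPoly_lam_mem (infoIn_mem hw hc hz (i - (l : ℤ)))) k

end Coupled

end Ensemble

/-! ### Summation by parts for window averages -/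

/-- Substitute s = a + (w-1-j); the terms not reached have r evaluated outside 1, …, n, where it
vanishes. -/
lemma sum_Icc_shift {r : ℤ → ℝ} (h : ℤ → ℝ) {n w j : ℕ} (hj : j < w)
    (h0 : ∀ a : ℤ, a ≤ 0 → r a = 0) (hn : ∀ a : ℤ, (n : ℤ) < a → r a = 0) :
    ∑ s ∈ Finset.range (n + w - 1), h (2 - w + s) * r (2 - w + s + j)
      = ∑ a ∈ Finset.range n, h (a + 1 - j) * r (a + 1) := by
  symm
  refine Finset.sum_of_injOn (fun a => a + (w - 1 - j)) (fun a _ b _ hab => by simpa using hab)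
    ?_ ?_ ?_
  · intro a ha
    simp only [Finset.coe_range, Set.mem_Iio] at ha ⊢
    omega
  · intro s _ hs'
    simp only [Finset.coe_range, Set.mem_image, Set.mem_Iio, not_exists, not_and] at hs'
    rcases le_or_gt ((2 : ℤ) - w + s + j) 0 with hle | hgt
    · rw [h0 _ hle, mul_zero]
    · rw [hn, mul_zero]
      by_contra! hcon
      exact hs' (s + j + 1 - w) (by omega) (by omega)
  · intro a _
    have e : ((a + (w - 1 - j) : ℕ) : ℤ) = a + (w - 1 - j) := by omega
    rw [e]
    congr 2 <;> ring

/-- Telescoping sums of differences of window averages of `q` against weights `h`. -/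
lemma sum_window_mul {q : ℤ → ℝ} (h : ℤ → ℝ) {n w : ℕ}
    (h0 : ∀ i : ℤ, i ≤ 0 → q i = q 0) (hn : ∀ i : ℤ, (n : ℤ) ≤ i → q i = q n) :
    ∑ s ∈ Finset.range (n + w - 1), h (2 - w + s) *
        ((w : ℝ)⁻¹ * ∑ j ∈ Finset.range w, q (1 - w + s + j)
          - (w : ℝ)⁻¹ * ∑ j ∈ Finset.range w, q (2 - w + s + j))
      = ∑ a ∈ Finset.range n, ((w : ℝ)⁻¹ * ∑ j ∈ Finset.range w, h (a + 1 - j)) *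
          (q a - q (a + 1)) := by
  -- A difference of neighbouring forward window averages is the window average of r. Exchanging the
  -- sums moves the averaging onto h, as a backward window: the same one that averages
  -- information-node outputs in `freeDE`.
  let r : ℤ → ℝ := fun a => q (a - 1) - q a
  have hr0 : ∀ a : ℤ, a ≤ 0 → r a = 0 := fun a ha => by
    simp only [r, h0 a ha, h0 (a - 1) (by omega), sub_self]
  have hrn : ∀ a : ℤ, (n : ℤ) < a → r a = 0 := fun a ha => by
    simp only [r, hn a ha.le, hn (a - 1) (by omega), sub_self]
  have hl (s : ℕ) : h (2 - w + s) *
        ((w : ℝ)⁻¹ * ∑ j ∈ Finset.range w, q (1 - w + s + j)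
          - (w : ℝ)⁻¹ * ∑ j ∈ Finset.range w, q (2 - w + s + j))
      = ∑ j ∈ Finset.range w, (w : ℝ)⁻¹ * (h (2 - w + s) * r (2 - w + s + j)) := by
    rw [← mul_sub, ← Finset.sum_sub_distrib, Finset.mul_sum, Finset.mul_sum]
    refine Finset.sum_congr rfl fun j _ => ?_
    have e : (2 : ℤ) - w + s + j - 1 = 1 - w + s + j := by ring
    simp only [r, e]
    ring
  have hr (a : ℕ) : ((w : ℝ)⁻¹ * ∑ j ∈ Finset.range w, h (a + 1 - j)) * (q a - q (a + 1))
      = ∑ j ∈ Finset.range w, (w : ℝ)⁻¹ * (h (a + 1 - j) * r (a + 1)) := by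
    rw [Finset.mul_sum, Finset.sum_mul]
    refine Finset.sum_congr rfl fun j _ => ?_
    simp only [r, add_sub_cancel_right]
    ring
  simp only [hl, hr]
  rw [Finset.sum_comm, Finset.sum_comm (s := Finset.range n)]
  refine Finset.sum_congr rfl fun j hj => ?_
  rw [← Finset.mul_sum, ← Finset.mul_sum, sum_Icc_shift h (Finset.mem_range.1 hj) hr0 hrn]

/-! ### Spatial profiles and the change of the potential along them. -/

namespace Ensemble

variable (E : Ensemble) {c : Measure EReal}

/-- A spatial profile: a degradation-monotone family of symmetric measures that equals the minimal
fixed point at non-positive positions and is constant from position `n` on. -/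
structure IsProfile (c : Measure EReal) (n : ℕ) (z : ℤ → Measure EReal) : Prop where
  mem : ∀ i, z i ∈ symProb
  mono : ∀ i, Degraded (z (i + 1)) (z i)
  left : ∀ i ≤ 0, z i = E.minFixedPoint c
  right : ∀ i, (n : ℤ) ≤ i → z i = z n

variable {E} {n w : ℕ} {z : ℤ → Measure EReal}

lemma IsProfile.mono_of_le (hz : E.IsProfile c n z) {i j : ℤ} (h : i ≤ j) :
    Degraded (z j) (z i) := by
  induction j, h using Int.leInduction with
  | base => exact Degraded.refl _
  | succ j _ ih => exact (hz.mono j).trans ih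

lemma IsProfile.degraded_infoIn (hw : 1 ≤ w) (hc : c ∈ symProb) (hz : E.IsProfile c n z) (i : ℤ) :
    Degraded (E.infoIn w c z (i + 1)) (E.infoIn w c z i) := by
  rw [← infoIn_shift]
  exact Ensemble.degraded_infoIn hw hc (fun _ => hz.mem _) hz.mem hz.mono i

lemma IsProfile.degraded_freeDE (hw : 1 ≤ w) (hc : c ∈ symProb) (hz : E.IsProfile c n z) (i : ℤ) :
    Degraded (E.freeDE w c z (i + 1)) (E.freeDE w c z i) := by
  rw [← freeDE_shift]
  exact Ensemble.degraded_freeDE hw hc (fun _ => hz.mem _) hz.mem hz.mono i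

/-- The bound 1 absorbs the fixed-point defect in `IsProfile.potential_sub_le`; the bound ρ'(1)
controls the size of the information-node steps and their total. -/
lemma momentSeq_genOut_sub_mem (hc : c ∈ symProb) {x y : Measure EReal} (hx : x ∈ symProb)
    (hy : y ∈ symProb) (h : Degraded x y) (k : ℕ) :
    0 ≤ momentSeq (E.genOut c y) k - momentSeq (E.genOut c x) k ∧
    momentSeq (E.genOut c y) k - momentSeq (E.genOut c x) k ≤ 1 ∧
    momentSeq (E.genOut c y) k - momentSeq (E.genOut c x) k ≤ E.rho.derivative.eval 1 := by
  refine ⟨sub_nonneg.2 ((E.degraded_genOut hc hx hy h).momentSeq_le k), ?_, ?_⟩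
  · linarith [(momentSeq_mem (E.genOut_mem hc hy) k).2, (momentSeq_mem (E.genOut_mem hc hx) k).1]
  · rw [E.momentSeq_genOut hc hx, E.momentSeq_genOut hc hy, ← mul_sub]
    have h1 := momentSeq_mem hx k
    have h2 := momentSeq_mem hy k
    have h3 := momentSeq_mem hc k
    have h4 := h.momentSeq_le k
    have h5 := eval_sub_eval_le_derivative_one E.rho_coeff_nonneg h1.1 h4 h2.2
    have h6 := eval_mono_of_coeff E.rho_coeff_nonneg h1.1 h4
    have h7 : 0 ≤ E.rho.derivative.eval 1 :=
      eval_nonneg_of_coeff (coeff_derivative_nonneg E.rho_coeff_nonneg) zero_le_one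
    calc _ ≤ E.rho.eval (momentSeq y k) - E.rho.eval (momentSeq x k) :=
          mul_le_of_le_one_left (sub_nonneg.2 h6) h3.2
      _ ≤ E.rho.derivative.eval 1 * (momentSeq y k - momentSeq x k) := h5
      _ ≤ _ := mul_le_of_le_one_right h7 (by linarith [h1.1, h2.2])

/-- Neighbouring windows share all but their extreme entries, so the difference telescopes to 1/w
times one difference of generator outputs. The only smallness in the argument that comes from w
enters here. -/
lemma IsProfile.momentSeq_infoIn_sub_le (hw : 1 ≤ w) (hc : c ∈ symProb)
    (hz : E.IsProfile c n z) (i : ℤ) (k : ℕ) :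
    momentSeq (E.infoIn w c z i) k - momentSeq (E.infoIn w c z (i + 1)) k
      ≤ E.rho.derivative.eval 1 / w := by
  rw [momentSeq_infoIn hw hc hz.mem, momentSeq_infoIn hw hc hz.mem, ← mul_sub,
    ← Finset.sum_sub_distrib, inv_mul_eq_div]
  have h := Finset.sum_range_sub' (fun j : ℕ => momentSeq (E.genOut c (z (i + (j : ℤ)))) k) w
  have e (j : ℕ) : i + 1 + (j : ℤ) = i + ((j + 1 : ℕ) : ℤ) := by push_cast; ring
  simp only [e, h]
  gcongr
  refine (momentSeq_genOut_sub_mem hc (hz.mem _) (hz.mem _) (hz.mono_of_le ?_) k).2.2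
  push_cast
  omega

lemma IsProfile.infoIn_left (hw : 1 ≤ w) (hz : E.IsProfile c n z) :
    E.infoIn w c z (1 - w) = E.genOut c (E.minFixedPoint c) :=
  infoIn_of_const hw fun j hj => hz.left _ (by rw [Finset.mem_range] at hj; omega)

lemma IsProfile.infoIn_right (hw : 1 ≤ w) (hz : E.IsProfile c n z) :
    E.infoIn w c z n = E.genOut c (z n) :=
  infoIn_of_const hw fun j _ => hz.right _ (by omega)

/-- Information-node part of the potential difference between the two ends of a profile. -/
lemma IsProfile.entropy_varPoly_L_sub_ge (hw : 1 ≤ w) (hc : c ∈ symProb)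
    (hz : E.IsProfile c n z) :
    E.avgL * ∑ a ∈ Finset.range n, gammaSum (fun k =>
        (1 - momentSeq (E.freeDE w c z (a + 1)) k) *
          (momentSeq (E.genOut c (z a)) k - momentSeq (E.genOut c (z (a + 1))) k))
      - E.avgL * E.lam.derivative.eval 1 * E.rho.derivative.eval 1 ^ 2 / w
      ≤ entropy (varPoly E.L (E.genOut c (z n)))
        - entropy (varPoly E.L (E.genOut c (E.minFixedPoint c))) := by
  have hmem := fun i => infoIn_mem (E := E) hw hc hz.mem i
  have hwpos : (0 : ℝ) < w := by exact_mod_cast hw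
  set δ := E.rho.derivative.eval 1 / w with hδ
  have hρ : 0 ≤ E.rho.derivative.eval 1 :=
    eval_nonneg_of_coeff (coeff_derivative_nonneg E.rho_coeff_nonneg) zero_le_one
  have hlam : 0 ≤ E.lam.derivative.eval 1 :=
    eval_nonneg_of_coeff (coeff_derivative_nonneg E.lam_coeff_nonneg) zero_le_one
  have hδ0 : 0 ≤ δ := div_nonneg hρ hwpos.le
  have hidx (s : ℕ) : (1 - w + (s : ℤ)) + 1 = 2 - w + s := by ring
  have hidx' (s : ℕ) : 1 - w + ((s + 1 : ℕ) : ℤ) = 2 - w + s := by push_cast; ring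
  -- The n+w-1 steps run from 1-w, the last window lying in positions ≤ 0, to n, the first window
  -- inside the constant right part. Both ends are thus single-system values.
  have hlast : (1 : ℤ) - w + ((n + w - 1 : ℕ) : ℤ) = n := by omega
  have htel (F : ℤ → ℝ) : ∑ s ∈ Finset.range (n + w - 1), (F (2 - w + s) - F (1 - w + s))
      = F n - F (1 - w) := by
    have := Finset.sum_range_sub (fun s : ℕ => F (1 - w + s)) (n + w - 1)
    simp only [hidx', hlast] at this
    simpa using this
  let Δ : ℕ → ℕ → ℝ := fun s k => momentSeq (E.infoIn w c z (1 - w + s)) k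
    - momentSeq (E.infoIn w c z (2 - w + s)) k
  have hΔb (s) : BddSeq (Δ s) := bddSeq_sub (hmem _) (hmem _)
  let B : ℕ → ℕ → ℝ := fun s k =>
    (1 - momentSeq (varPoly E.lam (E.infoIn w c z (2 - w + s))) k) * Δ s k
  have hBb (s) : BddSeq (B s) := ((BddSeq.const 1).sub
    (bddSeq_momentSeq (E.varPoly_lam_mem (hmem _)))).mul (hΔb s)
  have hstep (s : ℕ) : E.avgL * gammaSum (B s)
      - E.avgL * E.lam.derivative.eval 1 * δ * gammaSum (Δ s)
      ≤ entropy (varPoly E.L (E.infoIn w c z (2 - w + s)))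
        - entropy (varPoly E.L (E.infoIn w c z (1 - w + s))) := by
    have hd := hz.degraded_infoIn hw hc (1 - w + s)
    have hle := hz.momentSeq_infoIn_sub_le hw hc (1 - w + s)
    rw [hidx] at hd hle
    have := E.entropy_varPoly_L_le (hmem _) (hmem _) hd hδ0 hle
    simp only [B, Δ]
    linarith
  have hsum := Finset.sum_le_sum fun s (_ : s ∈ Finset.range (n + w - 1)) => hstep s
  rw [htel fun i => entropy (varPoly E.L (E.infoIn w c z i)), hz.infoIn_left hw,
    hz.infoIn_right hw, Finset.sum_sub_distrib, ← Finset.mul_sum, ← Finset.mul_sum] at hsum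
  have hgam (s : ℕ) : gammaSum (Δ s) = entropy (E.infoIn w c z (2 - w + s))
      - entropy (E.infoIn w c z (1 - w + s)) := gammaSum_momentSeq_sub (hmem _) (hmem _)
  -- The first-order sizes telescope to one entropy difference, bounded independently of n. The
  -- accumulated second-order error is therefore δ times a constant, however long the chain.
  have hD : ∑ s ∈ Finset.range (n + w - 1), gammaSum (Δ s) ≤ E.rho.derivative.eval 1 := by
    simp only [hgam]
    rw [htel fun i => entropy (E.infoIn w c z i), hz.infoIn_left hw, hz.infoIn_right hw,
      ← hz.left 0 le_rfl, ← gammaSum_momentSeq_sub (E.genOut_mem hc (hz.mem _))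
        (E.genOut_mem hc (hz.mem _)), ← gammaSum_const (E.rho.derivative.eval 1)]
    refine gammaSum_mono (bddSeq_sub (E.genOut_mem hc (hz.mem _)) (E.genOut_mem hc (hz.mem _)))
      (BddSeq.const _) fun k => ?_
    exact (momentSeq_genOut_sub_mem hc (hz.mem _) (hz.mem _) (hz.mono_of_le (by omega)) k).2.2
  have hB : ∑ s ∈ Finset.range (n + w - 1), gammaSum (B s)
      = ∑ a ∈ Finset.range n, gammaSum (fun k =>
        (1 - momentSeq (E.freeDE w c z (a + 1)) k) *
          (momentSeq (E.genOut c (z a)) k - momentSeq (E.genOut c (z (a + 1))) k)) := by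
    rw [← gammaSum_sum fun s _ => hBb s, ← gammaSum_sum fun a _ => ((BddSeq.const 1).sub
      (bddSeq_momentSeq (freeDE_mem hw hc hz.mem _))).mul
        (bddSeq_sub (E.genOut_mem hc (hz.mem _)) (E.genOut_mem hc (hz.mem _)))]
    congr 1; funext k
    have hl : ∀ i : ℤ, i ≤ 0 → momentSeq (E.genOut c (z i)) k = momentSeq (E.genOut c (z 0)) k :=
      fun i hi => by rw [hz.left i hi, hz.left 0 le_rfl]
    have hr : ∀ i : ℤ, (n : ℤ) ≤ i →
        momentSeq (E.genOut c (z i)) k = momentSeq (E.genOut c (z n)) k :=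
      fun i hi => by rw [hz.right i hi]
    have := sum_window_mul (w := w)
      (fun i => 1 - momentSeq (varPoly E.lam (E.infoIn w c z i)) k) hl hr
    simp only [B, Δ, momentSeq_infoIn hw hc hz.mem]
    rw [this]
    refine Finset.sum_congr rfl fun a _ => ?_
    rw [momentSeq_freeDE hw hc hz.mem, Finset.sum_sub_distrib, mul_sub _ (∑ _j ∈ Finset.range w, _),
      Finset.sum_const, Finset.card_range, nsmul_one, inv_mul_cancel₀ hwpos.ne']
  rw [hB] at hsum
  have hfin := mul_le_mul_of_nonneg_left hD
    (mul_nonneg (mul_nonneg E.avgL_pos.le hlam) hδ0)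
  have he : E.avgL * E.lam.derivative.eval 1 * δ * E.rho.derivative.eval 1
      = E.avgL * E.lam.derivative.eval 1 * E.rho.derivative.eval 1 ^ 2 / w := by
    rw [hδ]; ring
  linarith

/-- The potential difference between the two ends of a profile is controlled by the window size and
by how far the profile is from being a fixed point. -/
lemma IsProfile.potential_sub_le (hw : 1 ≤ w) (hc : c ∈ symProb) (hz : E.IsProfile c n z)
    (hle : ∀ a ∈ Finset.range n, Degraded (z (a + 1)) (E.freeDE w c z (a + 1))) :
    E.potential c (z n) - E.potential c (E.minFixedPoint c)
      ≤ E.avgL * E.lam.derivative.eval 1 * E.rho.derivative.eval 1 ^ 2 / w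
        + E.avgL * ∑ a ∈ Finset.range n,
          (entropy (z (a + 1)) - entropy (E.freeDE w c z (a + 1))) := by
  have hinfo := hz.entropy_varPoly_L_sub_ge hw hc
  let g : ℤ → ℕ → ℝ := fun i k => momentSeq c k * E.genPotential (momentSeq (z i) k)
  have hgb (i) : BddSeq (g i) := (bddSeq_momentSeq hc).mul (E.bddSeq_genPotential (hz.mem i))
  rw [E.potential_eq hc (hz.mem _), E.potential_eq hc (E.minFixedPoint_mem hc)]
  rw [← hz.left 0 le_rfl] at hinfo ⊢
  have htel := Finset.sum_range_sub' (fun a : ℕ => gammaSum (g a)) n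
  have hstep : ∀ a ∈ Finset.range n,
      -(entropy (z (a + 1)) - entropy (E.freeDE w c z (a + 1)))
      ≤ (gammaSum (g a) - gammaSum (g ((a + 1 : ℕ) : ℤ)))
        + gammaSum (fun k => (1 - momentSeq (E.freeDE w c z (a + 1)) k) *
          (momentSeq (E.genOut c (z a)) k - momentSeq (E.genOut c (z (a + 1))) k)) := by
    intro a ha
    have hF := freeDE_mem (E := E) hw hc hz.mem (a + 1)
    have hb := bddSeq_sub (hz.mem (a + 1)) hF
    have hb2 : BddSeq (fun k => (1 - momentSeq (E.freeDE w c z (a + 1)) k) *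
        (momentSeq (E.genOut c (z a)) k - momentSeq (E.genOut c (z (a + 1))) k)) :=
      ((BddSeq.const 1).sub (bddSeq_momentSeq hF)).mul
        (bddSeq_sub (E.genOut_mem hc (hz.mem _)) (E.genOut_mem hc (hz.mem _)))
    rw [← gammaSum_sub (hgb _) (hgb _), ← gammaSum_add ((hgb _).sub (hgb _)) hb2,
      ← gammaSum_momentSeq_sub (hz.mem _) hF, neg_eq_neg_one_mul, ← gammaSum_const_mul]
    refine gammaSum_mono ((BddSeq.const _).mul hb) (((hgb _).sub (hgb _)).add hb2) fun k => ?_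
    have hm := (hle a ha).momentSeq_le k
    have hd := momentSeq_genOut_sub_mem (E := E) hc (hz.mem (a + 1)) (hz.mem a) (hz.mono a) k
    have hgen := mul_nonneg (momentSeq_mem hc k).1 (E.genPotential_sub_nonneg
      (momentSeq_mem (hz.mem (a + 1)) k).1 ((hz.mono a).momentSeq_le k))
    -- Convexity of R handles the weight 1-M(z_{a+1}), but the actual weight involves the updated
    -- profile. The discrepancy of the weights is multiplied by a generator difference of at most 1,
    -- leaving just the moment defect.
    have h1 := mul_le_mul_of_nonneg_left hd.2.1 (sub_nonneg.2 hm)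
    have e : momentSeq (E.genOut c (z a)) k - momentSeq (E.genOut c (z (a + 1))) k
        = momentSeq c k * (E.rho.eval (momentSeq (z a) k)
          - E.rho.eval (momentSeq (z (a + 1)) k)) := by
      rw [E.momentSeq_genOut hc (hz.mem _), E.momentSeq_genOut hc (hz.mem _), mul_sub]
    rw [e] at h1 ⊢
    simp only [g, Nat.cast_add, Nat.cast_one]
    linarith
  have hsum := Finset.sum_le_sum hstep
  rw [Finset.sum_add_distrib, htel, Finset.sum_neg_distrib] at hsum
  have h2 := mul_le_mul_of_nonneg_left hsum E.avgL_pos.le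
  simp only [g, Nat.cast_zero] at h2
  linarith

/-! ### Density evolution on profiles, started from the useless channel -/

variable (E) in
/-- Iterates of density evolution on profiles, started from the useless channel. -/
noncomputable def profileIter (w : ℕ) (c : Measure EReal) (n : ℕ) : ℕ → ℤ → Measure EReal
  | 0 => fun i => if i ≤ 0 then E.minFixedPoint c else deltaZero
  | l + 1 => fun i =>
      if i ≤ 0 then E.minFixedPoint c else E.freeDE w c (profileIter w c n l) (min i n)

lemma profileIter_zero_of_pos {i : ℤ} (hi : 0 < i) : E.profileIter w c n 0 i = deltaZero :=
  if_neg hi.not_ge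

lemma profileIter_succ_of_pos {l : ℕ} {i : ℤ} (hi : 0 < i) : E.profileIter w c n (l + 1) i
    = E.freeDE w c (E.profileIter w c n l) (min i n) := if_neg hi.not_ge

/-- Keeps the profile monotone across the pinned edge between positions 0 and 1. -/
lemma degraded_freeDE_minFixedPoint (hw : 1 ≤ w) (hc : c ∈ symProb) (hz : ∀ i, z i ∈ symProb)
    (h : ∀ i, Degraded (z i) (E.minFixedPoint c)) (i : ℤ) :
    Degraded (E.freeDE w c z i) (E.minFixedPoint c) := by
  refine Degraded.trans ?_ (E.degraded_de_minFixedPoint hc)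
  rw [← freeDE_const hw (E.minFixedPoint c) i]
  exact Ensemble.degraded_freeDE hw hc hz (fun _ => E.minFixedPoint_mem hc) h i

lemma isProfile_profileIter (hw : 1 ≤ w) (hc : c ∈ symProb) (hn : 1 ≤ n) (l : ℕ) :
    E.IsProfile c n (E.profileIter w c n l) := by
  have hf := E.minFixedPoint_mem hc
  induction l with
  | zero =>
    refine ⟨fun i => ?_, fun i => ?_, fun i hi => if_pos hi, fun i hi => ?_⟩
    · unfold profileIter; split_ifs; exacts [hf, deltaZero_mem]
    · unfold profileIter
      split_ifs
      · exact Degraded.refl _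
      · omega
      · exact deltaZero_degraded hf
      · exact Degraded.refl _
    · rw [profileIter_zero_of_pos (by omega), profileIter_zero_of_pos (by omega)]
  | succ l ih =>
    refine ⟨fun i => ?_, fun i => ?_, fun i hi => if_pos hi, fun i hi => ?_⟩
    · unfold profileIter; split_ifs; exacts [hf, freeDE_mem hw hc ih.mem _]
    · have hge (i) : Degraded (E.profileIter w c n l i) (E.minFixedPoint c) := by
        rcases le_total i 0 with h | h
        · rw [ih.left i h]; exact Degraded.refl _
        · rw [← ih.left 0 le_rfl]; exact ih.mono_of_le h
      unfold profileIter
      split_ifs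
      · exact Degraded.refl _
      · omega
      · exact degraded_freeDE_minFixedPoint hw hc ih.mem hge _
      · rcases le_or_gt (n : ℤ) i with h | h
        · rw [min_eq_right h, min_eq_right (by omega)]; exact Degraded.refl _
        · rw [min_eq_left h.le, min_eq_left (by omega)]; exact ih.degraded_freeDE hw hc i
    · rw [profileIter_succ_of_pos (by omega), profileIter_succ_of_pos (by omega), min_eq_right hi,
        min_self]

/-- The start Δ₀ is the worst channel, so the first step can only improve; monotonicity of the map
propagates this. -/
lemma degraded_profileIter (hw : 1 ≤ w) (hc : c ∈ symProb) (hn : 1 ≤ n) (l : ℕ) (i : ℤ) :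
    Degraded (E.profileIter w c n l i) (E.profileIter w c n (l + 1) i) := by
  have hP := fun l => isProfile_profileIter (E := E) hw hc hn l
  induction l generalizing i with
  | zero =>
    rcases le_or_gt i 0 with h | h
    · rw [(hP 0).left i h, (hP 1).left i h]; exact Degraded.refl _
    · rw [profileIter_zero_of_pos (by omega)]
      exact deltaZero_degraded ((hP 1).mem i)
  | succ l ih =>
    rcases le_or_gt i 0 with h | h
    · rw [(hP _).left i h, (hP _).left i h]; exact Degraded.refl _
    · rw [profileIter_succ_of_pos h, profileIter_succ_of_pos h]
      exact Ensemble.degraded_freeDE hw hc (hP l).mem (hP (l + 1)).mem ih _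

lemma profileIter_succ_apply {l : ℕ} {a : ℕ} (ha : a ∈ Finset.range n) :
    E.profileIter w c n (l + 1) (a + 1) = E.freeDE w c (E.profileIter w c n l) (a + 1) := by
  rw [Finset.mem_range] at ha
  rw [profileIter_succ_of_pos (by omega), min_eq_left (by omega)]

/-- Up to an arbitrarily small error, some iterate has potential at its right end close to that of
the minimal fixed point. -/
lemma exists_potential_profileIter_le (hw : 1 ≤ w) (hc : c ∈ symProb) (hn : 1 ≤ n) {ε : ℝ}
    (hε : 0 < ε) : ∃ l, E.potential c (E.profileIter w c n l n)
      - E.potential c (E.minFixedPoint c)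
      ≤ E.avgL * E.lam.derivative.eval 1 * E.rho.derivative.eval 1 ^ 2 / w + ε := by
  have hP := fun l => isProfile_profileIter (E := E) hw hc hn l
  -- The total entropy decreases in l and is non-negative, so its increments tend to 0. Times L'(1),
  -- an increment is exactly the defect term of `IsProfile.potential_sub_le`.
  let S : ℕ → ℝ := fun l => ∑ a ∈ Finset.range n, entropy (E.profileIter w c n l (a + 1))
  have hanti : Antitone S := antitone_nat_of_succ_le fun l => Finset.sum_le_sum fun a _ =>
    (degraded_profileIter hw hc hn l (a + 1)).entropy_le ((hP l).mem _) ((hP (l + 1)).mem _)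
  have hbdd : BddBelow (Set.range S) := by
    refine ⟨0, ?_⟩
    rintro _ ⟨l, rfl⟩
    exact Finset.sum_nonneg fun a _ => integral_nonneg fun b => llrEntropy_nonneg b
  have h1 := tendsto_atTop_ciInf hanti hbdd
  have h2 := (h1.sub (h1.comp (tendsto_add_atTop_nat 1))).const_mul E.avgL
  rw [sub_self, mul_zero] at h2
  obtain ⟨l, hl⟩ := (h2.eventually (gt_mem_nhds hε)).exists
  refine ⟨l, ((hP l).potential_sub_le hw hc fun a ha => ?_).trans (add_le_add le_rfl ?_)⟩
  · rw [← profileIter_succ_apply ha]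
    exact degraded_profileIter hw hc hn l _
  · refine le_of_eq_of_le ?_ hl.le
    simp only [Function.comp_apply, S]
    rw [← Finset.sum_sub_distrib]
    congr 1
    exact Finset.sum_congr rfl fun a ha => by rw [profileIter_succ_apply ha]

/-! ### Fixed points of the coupled system -/

variable {N : ℕ} {x : ℤ → Measure EReal}

lemma coupledDE_of_mem {i : ℤ} (hi : i ∈ genPositions N w) :
    E.coupledDE N w c x i
      = (w : ℝ≥0∞)⁻¹ • ∑ k ∈ Finset.range w,
        E.infoOut N (i - (k : ℤ)) (E.infoIn w c x (i - (k : ℤ))) := if_pos hi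

lemma infoOut_mem {y : Measure EReal} (hy : y ∈ symProb) (i : ℤ) :
    E.infoOut N i y ∈ symProb := by
  unfold infoOut
  split_ifs
  exacts [E.varPoly_lam_mem hy, deltaInf_mem]

/-- Compare position by position: inside 1, …, 2N both maps apply λ^⊛, and elsewhere the coupled
system emits Δ_∞, better than anything. -/
lemma IsCoupledFixedPoint.degraded_freeDE (hx : E.IsCoupledFixedPoint N w c x) (hw : 1 ≤ w)
    (hc : c ∈ symProb) (hz : ∀ i, z i ∈ symProb) (h : ∀ i, Degraded (z i) (x i)) {i : ℤ}
    (hi : i ∈ genPositions N w) : Degraded (E.freeDE w c z i) (x i) := by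
  rw [← congrFun hx.2 i, coupledDE_of_mem hi]
  refine Degraded.average hw (fun _ => E.varPoly_lam_mem (infoIn_mem hw hc hz _))
    (fun _ => infoOut_mem (infoIn_mem hw hc hx.1 _) _) fun k _ => ?_
  unfold infoOut
  split_ifs
  · exact (Ensemble.degraded_infoIn hw hc hz hx.1 h _).varPoly _ (infoIn_mem hw hc hz _)
      (infoIn_mem hw hc hx.1 _)
  · exact degraded_deltaInf (E.varPoly_lam_mem (infoIn_mem hw hc hz _))

lemma IsCoupledFixedPoint.eq_deltaInf (hx : E.IsCoupledFixedPoint N w c x) {i : ℤ}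
    (hi : i ∉ genPositions N w) : x i = deltaInf := by
  rw [← congrFun hx.2 i]
  exact if_neg hi

/-- With n = 2N+w-1 the clamp `min i n` is inactive at every generator position; at the remaining
positions x is Δ_∞ and the comparison is free. -/
lemma IsCoupledFixedPoint.degraded_profileIter (hx : E.IsCoupledFixedPoint N w c x) (hw : 1 ≤ w)
    (hc : c ∈ symProb) (hn : 1 ≤ 2 * N + w - 1) (l : ℕ) (i : ℤ) :
    Degraded (E.profileIter w c (2 * N + w - 1) l i) (x i) := by
  have hP := fun l => isProfile_profileIter (E := E) hw hc hn l
  induction l generalizing i with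
  | zero =>
    by_cases hi : i ∈ genPositions N w
    · have h1 : 1 ≤ i := hi.1
      rw [profileIter_zero_of_pos (by omega)]
      exact deltaZero_degraded (hx.1 i)
    · rw [hx.eq_deltaInf hi]
      exact degraded_deltaInf ((hP 0).mem i)
  | succ l ih =>
    by_cases hi : i ∈ genPositions N w
    · have h1 : 1 ≤ i := hi.1
      have h2 : i ≤ 2 * (N : ℤ) + (w : ℤ) - 1 := hi.2
      rw [profileIter_succ_of_pos (by omega), min_eq_left (by omega)]
      exact hx.degraded_freeDE hw hc (hP l).mem ih hi
    · rw [hx.eq_deltaInf hi]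
      exact degraded_deltaInf ((hP (l + 1)).mem i)

/-- A coupled fixed point which is better than a constant profile in the basin of attraction of the
minimal fixed point is better than the minimal fixed point. -/
lemma IsCoupledFixedPoint.degraded_of_mem_basin (hx : E.IsCoupledFixedPoint N w c x) (hw : 1 ≤ w)
    (hc : c ∈ symProb) {u : Measure EReal} (hu : u ∈ E.basin c) (h : ∀ i, Degraded u (x i))
    (i : ℤ) : Degraded (E.minFixedPoint c) (x i) := by
  have hy := E.de_iterate_mem hc hu.1
  have hf := E.minFixedPoint_mem hc
  have key (m : ℕ) : ∀ i, Degraded ((E.de c)^[m] u) (x i) := by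
    induction m with
    | zero => exact h
    | succ m ih =>
      intro i
      by_cases hi : i ∈ genPositions N w
      · rw [Function.iterate_succ_apply', ← freeDE_const hw _ i]
        exact hx.degraded_freeDE hw hc (fun _ => hy m) ih hi
      · rw [hx.eq_deltaInf hi]
        exact degraded_deltaInf (hy _)
  exact degraded_of_tendsto_left hy hf (hx.1 i) (tendsto_momentSeq hy hf hu.2.2)
    (Eventually.of_forall fun m => key m i)

-- The ρ''(1) and ρ'(1) parts of the constant are non-negative and are dropped; the remaining part
-- is twice the coefficient of 1/w in the potential estimate.
variable (E) in
lemma couplingConst_bound : 0 ≤ E.couplingConst ∧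
    2 * (E.avgL * E.lam.derivative.eval 1 * E.rho.derivative.eval 1 ^ 2) ≤ E.couplingConst := by
  have h0 := E.avgL_pos.le
  have h1 : 0 ≤ E.rho.derivative.eval 1 :=
    eval_nonneg_of_coeff (coeff_derivative_nonneg E.rho_coeff_nonneg) zero_le_one
  have h2 : 0 ≤ E.lam.derivative.eval 1 :=
    eval_nonneg_of_coeff (coeff_derivative_nonneg E.lam_coeff_nonneg) zero_le_one
  have h3 : 0 ≤ E.rho.derivative.derivative.eval 1 :=
    eval_nonneg_of_coeff (coeff_derivative_nonneg (coeff_derivative_nonneg E.rho_coeff_nonneg))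
      zero_le_one
  have h4 : 0 ≤ E.avgL * E.lam.derivative.eval 1 * E.rho.derivative.eval 1 ^ 2 :=
    mul_nonneg (mul_nonneg h0 h2) (sq_nonneg _)
  have h5 : 0 ≤ E.avgL * (2 * E.rho.derivative.derivative.eval 1 + E.rho.derivative.eval 1) :=
    mul_nonneg h0 (by linarith)
  unfold couplingConst
  constructor <;> linarith

lemma energyGap_le {u : Measure EReal} (hu : u ∈ symProb) (hu' : u ∉ E.basin c) :
    E.energyGap c ≤ ((E.potential c u - E.potential c (E.minFixedPoint c) : ℝ) : EReal) := by
  rw [EReal.coe_sub]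
  exact EReal.sub_le_sub (iInf₂_le u ⟨hu, hu'⟩) le_rfl

end Ensemble

end LDGM

/-! ### The dichotomy for the right end of the profile iterates. -/

theorem mainTheorem3 (E : LDGM.Ensemble) (c : MeasureTheory.Measure EReal)
    (hc : c ∈ LDGM.symProb) (hgap : 0 < E.energyGap c) :
    E.DEConverges c LDGM.deltaInf (E.minFixedPoint c) ∧
      ∀ N w : ℕ, (E.couplingConst : EReal) / (2 * E.energyGap c) < (w : EReal) →
        ∀ x : ℤ → MeasureTheory.Measure EReal, E.IsCoupledFixedPoint N w c x →
          ∀ i ∈ LDGM.Ensemble.genPositions N w, LDGM.Degraded (E.minFixedPoint c) (x i) := by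
  refine ⟨E.deConverges_minFixedPoint hc, fun N w hw x hx i hi => ?_⟩
  obtain ⟨hK, hK'⟩ := E.couplingConst_bound
  have hw1 : 1 ≤ w := by
    have h0 : (0 : EReal) ≤ (E.couplingConst : EReal) / (2 * E.energyGap c) :=
      EReal.div_nonneg (EReal.coe_nonneg.2 hK) (mul_nonneg (by norm_num) hgap.le)
    have := h0.trans_lt hw
    rw [← Nat.cast_zero (R := EReal), EReal.natCast_lt_iff] at this
    exact this
  have hwpos : (0 : ℝ) < w := by exact_mod_cast hw1
  have hn : 1 ≤ 2 * N + w - 1 := by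
    have h1 : 1 ≤ i := hi.1
    have h2 : i ≤ 2 * (N : ℤ) + (w : ℤ) - 1 := hi.2
    omega
  have hP := fun l => LDGM.Ensemble.isProfile_profileIter (E := E) hw1 hc hn l
  have hdeg := hx.degraded_profileIter hw1 hc hn
  -- The value at the right end is the worst of its profile. If it ever enters the basin, the
  -- constant profile with this value already dominates x; if it never does, every iterate is a
  -- competitor in the infimum defining the energy gap.
  by_cases hb : ∃ l, E.profileIter w c (2 * N + w - 1) l (2 * N + w - 1 : ℕ) ∈ E.basin c
  · obtain ⟨l, hl⟩ := hb
    refine hx.degraded_of_mem_basin hw1 hc hl (fun j => ?_) i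
    refine LDGM.Degraded.trans ?_ (hdeg l j)
    rcases le_total j (2 * N + w - 1 : ℕ) with h | h
    · exact (hP l).mono_of_le h
    · rw [(hP l).right j h]; exact LDGM.Degraded.refl _
  · exfalso
    push Not at hb
    have hle : ∀ ε > 0, E.energyGap c ≤ ((E.couplingConst / (2 * w) + ε : ℝ) : EReal) := by
      intro ε hε
      obtain ⟨l, hl⟩ := LDGM.Ensemble.exists_potential_profileIter_le (E := E) hw1 hc hn hε
      refine (LDGM.Ensemble.energyGap_le ((hP l).mem _) (hb l)).trans (EReal.coe_le_coe_iff.2 ?_)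
      refine hl.trans (add_le_add ?_ le_rfl)
      rw [div_le_div_iff₀ hwpos (by positivity)]
      have := mul_le_mul_of_nonneg_right hK' hwpos.le
      linarith
    -- In this case the gap is real: a competitor bounds it above, and positivity excludes -∞.
    -- Letting ε → 0 then contradicts the choice of w.
    obtain ⟨d, hd⟩ : ∃ d : ℝ, E.energyGap c = d := by
      refine ⟨(E.energyGap c).toReal, (EReal.coe_toReal ?_ ?_).symm⟩
      · exact ((hle 1 one_pos).trans_lt (EReal.coe_lt_top _)).ne
      · exact ((EReal.bot_lt_coe 0).trans (by simpa using hgap)).ne'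
    rw [hd] at hle hgap hw
    have hd0 : 0 < d := EReal.coe_pos.1 hgap
    have hle' : d ≤ E.couplingConst / (2 * w) :=
      le_of_forall_pos_le_add fun ε hε => EReal.coe_le_coe_iff.1 (hle ε hε)
    have hw' : E.couplingConst / (2 * d) < w := by
      rw [show (2 : EReal) = ((2 : ℝ) : EReal) from rfl, ← EReal.coe_mul, ← EReal.coe_div,
        ← EReal.coe_natCast, EReal.coe_lt_coe_iff] at hw
      exact hw
    rw [div_lt_iff₀ (by positivity)] at hw'
    rw [le_div_iff₀ (by positivity)] at hle'
    linarith
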